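/- Let $\mathfrak g$ be one of the complex Lie superalgebras $\mathfrak{gl}(m|n)$, $\mathfrak{osp}(2m|2n)$, $\mathfrak{osp}(2m+1|2n)$, with $\mathfrak h^*$ spanned by $\varepsilon_1,\dots,\varepsilon_m,\delta_1,\dots,\delta_n$, the form $(\varepsilon_i|\varepsilon_j)=\delta_{ij}=-(\delta_i|\delta_j)$, $(\varepsilon_i|\delta_j)=0$, and the lattice $\Lambda_{m|n}=\bigoplus_i\mathbb Z\varepsilon_i\oplus\bigoplus_j\mathbb Z\delta_j$. Bases of the root system $\Delta$ that are compatible with the standard even positive roots $\Delta_0^+$ are encoded by words in the letters $\varepsilon,\delta$. Let $\Sigma$ be the base with the word $\varepsilon^m\delta^n$ for $\mathfrak{gl}(m|n)$; $\delta^{n-m}(\delta\varepsilon)^m$ if $n\ge m$ and $\varepsilon^{m-n}(\delta\varepsilon)^n$ if $n\le m$ for $\mathfrak{osp}(2m|2n)$; $\delta^{n-m}(\varepsilon\delta)^m$ if $n\ge m$ and $\varepsilon^{m-n}(\varepsilon\delta)^n$ if $n\le m$ for $\mathfrak{osp}(2m+1|2n)$. Let $\Delta_1^+$ be the odd roots positive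 for $\Sigma$, and $$R=\frac{\prod_{\alpha\in\Delta_0^+}(1-e^{-\alpha})}{\prod_{\alpha\in\Delta_1^+}(1+e^{-\alpha})}.$$ The Weyl vector $\rho$ of $\Sigma$ is $\frac12\sum_{\alpha\in\Delta_0^+}\alpha-\frac12\sum_{\alpha\in\Delta_1^+}\alpha$ in the $\mathfrak{osp}$-case and $\sum_{i=1}^m(m+1-i)\varepsilon_i-\sum_{j=1}^n j\delta_j$ for $\mathfrak{gl}(m|n)$; the Weyl vector of another base $\Sigma'$ is $\rho+\frac12\sum_{\alpha\in\Delta_1^+}\alpha-\frac12\sum_{\alpha\in\Delta_1^+(\Sigma')}\alpha$. Put $$S_s=\{\varepsilon_{m+1-i}-\delta_i\}_{i=1}^s,\qquad \{\delta_{n-i}-\varepsilon_{m-i}\}_{i=0}^{s-1},\qquad \{\varepsilon_{m-i}-\delta_{n-i}\}_{i=0}^{s-1}$$ for $\mathfrak{gl}(m|n)$, $\mathfrak{osp}(2m|2n)$, $\mathfrak{osp}(2m+1|2n)$ respectively. Let $W$ be the Weyl group of $\mathfrak g_0$ with its sign character. In the field of fractions of the group ring $\mathbb Q[\mathfrak h^*]$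 put $\mathcal J_W(P)=\sum_{w\in W}\operatorname{sgn}(w)\,w(P)$ and $$\mathrm{KW}(\mu,S)=\mathcal J_W\Bigl(\frac{e^\mu}{\prod_{\beta\in S}(1+e^{-\beta})}\Bigr).$$ A weight $\lambda\in\Lambda_{m|n}$ is dominant if the simple module $L(\lambda)$ of highest weight $\lambda$ with respect to $\Sigma$ is finite-dimensional. An equal rank subalgebra is a subalgebra $\mathfrak{gl}(s|s)\subset\mathfrak{gl}(m|n)$, $\mathfrak{osp}(2s+1|2s)\subset\mathfrak{osp}(2m+1|2n)$, $\mathfrak{osp}(2s|2s)$ or $\mathfrak{osp}(2s+2|2s)\subset\mathfrak{osp}(2m|2n)$, $s\ge0$, which has a base contained in $\Sigma$; its defect is $s$. The atypicality of a weight is the maximal cardinality of a linearly independent set of pairwise orthogonal isotropic odd roots which are orthogonal to the weight. A dominant weight $\lambda$ of $\mathfrak{gl}(m|n)$ is stable if for some equal rank subalgebra $\mathfrak{gl}(s|s)$ both $\lambda+\rho$ and its restriction to $\mathfrak h\cap\mathfrak{gl}(s|s)$ have atypicality $s$. For $\lambda$ dominant (and stable if $\mathfrak g=\mathfrak{gl}(m|n)$),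 the tail subalgebra $\mathfrak g_\lambda$ is the largest equal rank subalgebra such that $\lambda$ vanishes on $\mathfrak h\cap[\mathfrak g_\lambda,\mathfrak g_\lambda]$, $\operatorname{tail}(\lambda)$ is its defect, and the Euler character of $\lambda$ is $$\mathcal E_\lambda=R^{-1}e^{-\rho}\,\mathcal J_W\Bigl(\frac{e^{\lambda+\rho}}{\prod_{\alpha\in\Delta(\mathfrak g_\lambda)\cap\Delta_1^+}(1+e^{-\alpha})}\Bigr).$$ Let $t=1$ for $\mathfrak{osp}(2m+1|2n)$; for $\mathfrak{osp}(2m|2n)$ let $t=0$ if the numbers of the indices $i$ with $(\lambda+\rho|\varepsilon_i)=0$ and of the indices $j$ with $(\lambda+\rho|\delta_j)=0$ are equal, and $t=2$ otherwise. **Proposition.** Let $\lambda\in\Lambda_{m|n}$ be dominant, and stable if $\mathfrak g=\mathfrak{gl}(m|n)$. Put $s=\operatorname{tail}(\lambda)$. (i) In the $\mathfrak{osp}$-case, $j_s\,Re^{\rho}\,\mathcal E_\lambda=\mathrm{KW}(\lambda+\rho,S_s)$, where $j_s=\max(1,2^{s-1}s!)$ if $t=0$ and $j_s=2^s s!$ if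 $t=1,2$. (ii) For $\mathfrak g=\mathfrak{gl}(m|n)$, $j_s\,Re^{\rho}\,\mathcal E_\lambda=\mathrm{KW}(\lambda+\rho_L,S_s)$, where $j_s=(-1)^{[s/2]}s!$ and $\rho_L$ is the Weyl vector of the base with the word $\varepsilon^{m-s}(\varepsilon\delta)^s\delta^{n-s}$. -/

import Mathlib

namespace SuperKW

open Finset

/-! ### The Lie superalgebras `gl(m|n)`, `osp(2m|2n)`, `osp(2m+1|2n)`: weights and roots -/

/-- The three families `gl(m|n)`, `osp(2m|2n)` and `osp(2m+1|2n)`. -/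
inductive Kind
  | gl
  | ospEven
  | ospOdd
  deriving DecidableEq

/-- The letters of the words that encode the bases (sets of simple roots). -/
inductive Letter
  | eps
  | del
  deriving DecidableEq

/-- The dual `𝔥^*` of the Cartan subalgebra, in the coordinates given by the basis
`ε_1, …, ε_m, δ_1, …, δ_n`.  (Indices start from `0` in the code.) -/
abbrev Wt (m n : ℕ) : Type := Fin m ⊕ Fin n → ℂ

section Roots

variable {m n : ℕ}

/-- The basis vector `ε_i`. -/
def eps (i : Fin m) : Wt m n := Pi.single (Sum.inl i) 1

/-- The basis vector `δ_j`. -/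
def del (j : Fin n) : Wt m n := Pi.single (Sum.inr j) 1

/-- The bilinear form on `𝔥^*` with `(ε_i|ε_j) = δ_{ij} = -(δ_i|δ_j)` and `(ε_i|δ_j) = 0`. -/
def form (x y : Wt m n) : ℂ :=
  ∑ i : Fin m, x (Sum.inl i) * y (Sum.inl i) - ∑ j : Fin n, x (Sum.inr j) * y (Sum.inr j)

/-- The integral weight with the given coordinates, as an element of `𝔥^*`. -/
def toWt (lam : Fin m ⊕ Fin n → ℤ) : Wt m n := fun k => (lam k : ℂ)

/-- In the word `w`, the `ε` with index `i` stands to the left of the `δ` with index `j`: some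
initial segment of `w` contains that `ε` but does not contain that `δ`. -/
def Precedes (w : List Letter) (i : Fin m) (j : Fin n) : Prop :=
  ∃ k : ℕ, (i : ℕ) < (w.take k).count Letter.eps ∧ (w.take k).count Letter.del ≤ (j : ℕ)

/-- The word of the fixed base `Σ`: `ε^m δ^n` for `gl(m|n)`; `δ^{n-m}(δε)^m` or `ε^{m-n}(δε)^n` for
`osp(2m|2n)`; `δ^{n-m}(εδ)^m` or `ε^{m-n}(εδ)^n` for `osp(2m+1|2n)`.  (The truncated differences
make the superfluous one of the two initial powers empty.) -/
def stdWord (m n : ℕ) : Kind → List Letter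
  | .gl => List.replicate m .eps ++ List.replicate n .del
  | .ospEven => List.replicate (n - m) .del ++ List.replicate (m - n) .eps ++
      (List.replicate (min m n) [Letter.del, Letter.eps]).flatten
  | .ospOdd => List.replicate (n - m) .del ++ List.replicate (m - n) .eps ++
      (List.replicate (min m n) [Letter.eps, Letter.del]).flatten

/-- The word `ε^{m-s}(εδ)^s δ^{n-s}`. -/
def wordL (m n s : ℕ) : List Letter :=
  List.replicate (m - s) .eps ++ (List.replicate s [Letter.eps, Letter.del]).flatten ++
    List.replicate (n - s) .del

open Classical in
/-- The positive even roots `Δ_0^+` (the same for all the bases under consideration). -/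
noncomputable def posEven (m n : ℕ) (k : Kind) : Finset (Wt m n) :=
  let typeA : Finset (Wt m n) :=
    ((univ.filter fun p : Fin m × Fin m => p.1 < p.2).image fun p => eps p.1 - eps p.2) ∪
    ((univ.filter fun p : Fin n × Fin n => p.1 < p.2).image fun p => del p.1 - del p.2)
  let typeDC : Finset (Wt m n) := typeA ∪
    ((univ.filter fun p : Fin m × Fin m => p.1 < p.2).image fun p => eps p.1 + eps p.2) ∪
    ((univ.filter fun p : Fin n × Fin n => p.1 < p.2).image fun p => del p.1 + del p.2) ∪
    (univ.image fun j : Fin n => (2 : ℂ) • del j)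
  match k with
  | .gl => typeA
  | .ospEven => typeDC
  | .ospOdd => typeDC ∪ univ.image fun i : Fin m => eps i

open Classical in
/-- The positive odd roots `Δ_1^+` for the base encoded by the word `w`: an odd root is positive
if its letter which comes first in `w` has positive coefficient. -/
noncomputable def posOdd (m n : ℕ) (k : Kind) (w : List Letter) : Finset (Wt m n) :=
  let diff : Finset (Wt m n) := univ.image fun p : Fin m × Fin n =>
    if Precedes w p.1 p.2 then eps p.1 - del p.2 else del p.2 - eps p.1
  let sum : Finset (Wt m n) := univ.image fun p : Fin m × Fin n => eps p.1 + del p.2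
  match k with
  | .gl => diff
  | .ospEven => diff ∪ sum
  | .ospOdd => diff ∪ sum ∪ univ.image fun j : Fin n => del j

open Classical in
/-- The positive roots for the fixed base `Σ`. -/
noncomputable def posRoots (m n : ℕ) (k : Kind) : Finset (Wt m n) :=
  posEven m n k ∪ posOdd m n k (stdWord m n k)

open Classical in
/-- The set `Δ_1` of all odd roots. -/
noncomputable def oddRoots (m n : ℕ) (k : Kind) : Finset (Wt m n) :=
  posOdd m n k (stdWord m n k) ∪ (posOdd m n k (stdWord m n k)).image fun α => -α

/-- `ρ_1`, the half-sum of the positive odd roots, for the base encoded by `w`. -/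
noncomputable def rho1 (m n : ℕ) (k : Kind) (w : List Letter) : Wt m n :=
  (1 / 2 : ℂ) • ∑ α ∈ posOdd m n k w, α

/-- The Weyl vector `ρ` of the base `Σ`.  For `gl(m|n)` it is normalised as
`∑ (m+1-i) ε_i - ∑ j δ_j` (indices from `1`). -/
noncomputable def rho (m n : ℕ) : Kind → Wt m n
  | .gl => Sum.elim (fun i : Fin m => (m : ℂ) - (i : ℕ)) (fun j : Fin n => -(((j : ℕ) : ℂ) + 1))
  | .ospEven => (1 / 2 : ℂ) • ∑ α ∈ posEven m n .ospEven, α -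
      rho1 m n .ospEven (stdWord m n .ospEven)
  | .ospOdd => (1 / 2 : ℂ) • ∑ α ∈ posEven m n .ospOdd, α -
      rho1 m n .ospOdd (stdWord m n .ospOdd)

/-- The Weyl vector of the base `ε^{m-s}(εδ)^s δ^{n-s}` of `gl(m|n)`.  All Weyl vectors are of the
form `ρ_0 - ρ_1` with the same `ρ_0`. -/
noncomputable def rhoL (m n s : ℕ) : Wt m n :=
  rho m n .gl + rho1 m n .gl (stdWord m n .gl) - rho1 m n .gl (wordL m n s)

open Classical in
/-- The sets `S_s`: `{ε_{m+1-i} - δ_i}_{i=1}^s` for `gl(m|n)`, `{δ_{n-i} - ε_{m-i}}_{i=0}^{s-1}` for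
`osp(2m|2n)`, `{ε_{m-i} - δ_{n-i}}_{i=0}^{s-1}` for `osp(2m+1|2n)` (indices from `1`). -/
noncomputable def isoS (m n : ℕ) (k : Kind) (s : ℕ) : Finset (Wt m n) :=
  match k with
  | .gl => (univ.filter fun p : Fin m × Fin n =>
      (p.1 : ℕ) + p.2 + 1 = m ∧ (p.2 : ℕ) < s).image fun p => eps p.1 - del p.2
  | .ospEven => (univ.filter fun p : Fin m × Fin n =>
      (p.1 : ℕ) + n = p.2 + m ∧ m ≤ p.1 + s).image fun p => del p.2 - eps p.1
  | .ospOdd => (univ.filter fun p : Fin m × Fin n =>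
      (p.1 : ℕ) + n = p.2 + m ∧ m ≤ p.1 + s).image fun p => eps p.1 - del p.2

end Roots

/-! ### Dominant weights -/

section Dominant

/-- The sign `(-1)^a`. -/
def sgn2 (a : ZMod 2) : ℂ := if a = 0 then 1 else -1

variable {I : Type} [Fintype I]

/-- `x` is homogeneous of parity `p`, when the basis vector indexed by `i` has parity `par i`. -/
def IsHomog (par : I → ZMod 2) (x : Matrix I I ℂ) (p : ZMod 2) : Prop :=
  ∀ i j, x i j ≠ 0 → par i + par j = p

/-- The superbracket of `x` of parity `p` and `y` of parity `q`. -/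
noncomputable def superBracket (p q : ZMod 2) (x y : Matrix I I ℂ) : Matrix I I ℂ :=
  x * y - sgn2 (p * q) • (y * x)

/-- The parity function of `ℂ^{a|b}` (or of `ℂ^{m|n}`). -/
def stdPar {A B : Type} : A ⊕ B → ZMod 2 := Sum.elim (fun _ => 0) (fun _ => 1)

/-- `π` is a representation of the Lie superalgebra `g` on `ℂ^{a|b}`, i.e. a homomorphism of Lie
superalgebras `g → gl(a|b)`. -/
structure IsRep (par : I → ZMod 2) (g : Submodule ℂ (Matrix I I ℂ)) {a b : ℕ}
    (π : g →ₗ[ℂ] Matrix (Fin a ⊕ Fin b) (Fin a ⊕ Fin b) ℂ) : Prop where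
  parity : ∀ (x : g) (p : ZMod 2), IsHomog par (x : Matrix I I ℂ) p → IsHomog stdPar (π x) p
  bracket : ∀ (p q : ZMod 2) (x y z : g), IsHomog par (x : Matrix I I ℂ) p →
    IsHomog par (y : Matrix I I ℂ) q → (z : Matrix I I ℂ) = superBracket p q (x : Matrix I I ℂ) y →
    π z = superBracket p q (π x) (π y)

/-- `π` has no graded invariant subspaces other than `0` and the whole space. -/
def IsIrred {g : Submodule ℂ (Matrix I I ℂ)} {a b : ℕ}
    (π : g →ₗ[ℂ] Matrix (Fin a ⊕ Fin b) (Fin a ⊕ Fin b) ℂ) : Prop :=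
  ∀ U : Submodule ℂ (Fin a ⊕ Fin b → ℂ),
    (∀ u ∈ U, (Sum.elim (fun i => u (Sum.inl i)) (fun _ => 0) : Fin a ⊕ Fin b → ℂ) ∈ U) →
    (∀ (x : g), ∀ u ∈ U, (π x).mulVec u ∈ U) → U = ⊥ ∨ U = ⊤

variable {m n : ℕ}

/-- The value of `μ ∈ 𝔥^*` on the element of `𝔥` with coordinates `t`. -/
def pair (μ : Wt m n) (t : Fin m ⊕ Fin n → ℂ) : ℂ := ∑ k, μ k * t k

/-- The element of the Cartan subalgebra with coordinates `t`: the diagonal matrix which acts on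
the basis vector indexed by `i` by its weight `wt i`. -/
def cartan [DecidableEq I] (wt : I → Wt m n) (t : Fin m ⊕ Fin n → ℂ) : Matrix I I ℂ :=
  Matrix.diagonal fun i => pair (wt i) t

/-- There is a finite-dimensional irreducible representation of `g` with highest weight `lam`,
with respect to the set of positive roots `P`; in other words `dim L(lam) < ∞`. -/
def HasFinDimSimple [DecidableEq I] (par : I → ZMod 2) (wt : I → Wt m n)
    (g : Submodule ℂ (Matrix I I ℂ)) (P : Finset (Wt m n)) (lam : Wt m n) : Prop :=
  ∃ (a b : ℕ) (π : g →ₗ[ℂ] Matrix (Fin a ⊕ Fin b) (Fin a ⊕ Fin b) ℂ)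
    (v : Fin a ⊕ Fin b → ℂ),
    IsRep par g π ∧ IsIrred π ∧ v ≠ 0 ∧
    (∀ (t : Fin m ⊕ Fin n → ℂ) (x : g), (x : Matrix I I ℂ) = cartan wt t →
      (π x).mulVec v = pair lam t • v) ∧
    (∀ α ∈ P, ∀ x : g,
      (∀ t, cartan wt t * (x : Matrix I I ℂ) - (x : Matrix I I ℂ) * cartan wt t =
        pair α t • (x : Matrix I I ℂ)) →
      (π x).mulVec v = 0)

/-- The orthosymplectic Lie superalgebra of the bilinear form with Gram matrix `B`: its elements `x`
satisfy `B(x v, w) + (-1)^{|x||v|} B(v, x w) = 0`.  The form being even, in the equation for two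
basis vectors indexed by `i` and `j` only the component of `x` of parity `par i + par j` occurs. -/
def osp (par : I → ZMod 2) (B : I → I → ℂ) : Submodule ℂ (Matrix I I ℂ) where
  carrier := {x | ∀ i j, ∑ k, x k i * B k j +
    sgn2 ((par i + par j) * par i) * ∑ k, B i k * x k j = 0}
  zero_mem' := by intro i j; simp
  add_mem' := by
    intro x y hx hy i j
    have h1 := hx i j
    have h2 := hy i j
    generalize sgn2 ((par i + par j) * par i) = c at h1 h2 ⊢
    simp only [Matrix.add_apply, add_mul, mul_add, Finset.sum_add_distrib]
    linear_combination h1 + h2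
  smul_mem' := by
    intro c x hx i j
    have h1 := hx i j
    have e1 : ∑ k, (c • x) k i * B k j = c * ∑ k, x k i * B k j := by
      rw [Finset.mul_sum]
      exact Finset.sum_congr rfl fun k _ => by simp [mul_assoc]
    have e2 : ∑ k, B i k * (c • x) k j = c * ∑ k, B i k * x k j := by
      rw [Finset.mul_sum]
      exact Finset.sum_congr rfl fun k _ => by simp; ring
    rw [e1, e2]
    linear_combination c * h1

/-- Index set of a basis of the natural module `ℂ^{2m|2n}` of `osp(2m|2n)`: the vector `(k, true)`
has weight `ε_i` or `δ_j`, and `(k, false)` has the opposite weight. -/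
abbrev EvenIdx (m n : ℕ) : Type := (Fin m ⊕ Fin n) × Bool

/-- Index set of a basis of the natural module `ℂ^{2m+1|2n}` of `osp(2m+1|2n)`: `none` is an even
vector of weight `0`. -/
abbrev OddIdx (m n : ℕ) : Type := Option (EvenIdx m n)

/-- Parities of the basis of `ℂ^{2m|2n}`. -/
def evenPar (x : EvenIdx m n) : ZMod 2 := stdPar x.1

/-- Weights of the basis of `ℂ^{2m|2n}`. -/
def evenWt (x : EvenIdx m n) : Wt m n :=
  if x.2 then Pi.single x.1 1 else -Pi.single x.1 1

/-- The even form on `ℂ^{2m|2n}`, symmetric on the even part and skew-symmetric on the odd part,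
which pairs the basis vectors of opposite weights. -/
def evenForm (x y : EvenIdx m n) : ℂ :=
  if x.1 = y.1 ∧ x.2 ≠ y.2 then (if x.1.isRight ∧ x.2 = false then -1 else 1) else 0

/-- Parities of the basis of `ℂ^{2m+1|2n}`. -/
def oddPar : OddIdx m n → ZMod 2
  | none => 0
  | some x => evenPar x

/-- Weights of the basis of `ℂ^{2m+1|2n}`. -/
def oddWt : OddIdx m n → Wt m n
  | none => 0
  | some x => evenWt x

/-- The form on `ℂ^{2m+1|2n}`. -/
def oddForm : OddIdx m n → OddIdx m n → ℂ
  | none, none => 1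
  | some x, some y => evenForm x y
  | _, _ => 0

/-- The integral weight `lam` is dominant, `lam ∈ Λ^+_{m|n}`: the irreducible module of highest
weight `lam` with respect to the base `Σ` is finite-dimensional. -/
def IsDominant (k : Kind) (lam : Fin m ⊕ Fin n → ℤ) : Prop :=
  match k with
  | .gl => HasFinDimSimple (I := Fin m ⊕ Fin n) stdPar (fun i => Pi.single i 1) ⊤
      (posRoots m n .gl) (toWt lam)
  | .ospEven => HasFinDimSimple evenPar evenWt (osp evenPar evenForm)
      (posRoots m n .ospEven) (toWt lam)
  | .ospOdd => HasFinDimSimple oddPar oddWt (osp oddPar oddForm)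
      (posRoots m n .ospOdd) (toWt lam)

end Dominant

/-! ### Equal rank subalgebras, tails, stability -/

section Tail

variable {m n : ℕ}

/-- The numbers `(p, q)` of the letters `ε`, `δ` of the equal rank subalgebras, i.e. of the
subalgebras `gl(s|s)` of `gl(m|n)`, `osp(2s+1|2s)` of `osp(2m+1|2n)`, `osp(2s|2s)` and
`osp(2s+2|2s)` of `osp(2m|2n)` which have a base contained in `Σ`. -/
def equalRank (m n : ℕ) (k : Kind) : Finset (ℕ × ℕ) :=
  (range (m + 1) ×ˢ range (n + 1)).filter fun r => r.1 = r.2 ∨ (k = .ospEven ∧ r.1 = r.2 + 1)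

/-- `α` is a combination of the letters of the equal rank subalgebra with numbers `(p, q)`: these are
the last `p` of the `ε_i`, and the first `q` of the `δ_j` for `gl`, the last `q` of the `δ_j` for
`osp`.  The roots with this property are the roots of the subalgebra. -/
def InSub (k : Kind) (r : ℕ × ℕ) (α : Wt m n) : Prop :=
  (∀ i : Fin m, α (Sum.inl i) ≠ 0 → m ≤ i + r.1) ∧
  (∀ j : Fin n, α (Sum.inr j) ≠ 0 → if k = .gl then (j : ℕ) < r.2 else n ≤ j + r.2)

/-- `lam` vanishes on `𝔥 ∩ [𝔤', 𝔤']`, where `𝔤'` is the equal rank subalgebra with numbers `r`: this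
space is spanned by the elements of `𝔥` dual to the roots of `𝔤'`. -/
def VanishesOn (k : Kind) (lam : Fin m ⊕ Fin n → ℤ) (r : ℕ × ℕ) : Prop :=
  ∀ α ∈ posRoots m n k, InSub k r α → form (toWt lam) α = 0

open Classical in
/-- The tail subalgebra `𝔤_λ`: the largest of the equal rank subalgebras `𝔤'` such that `lam`
vanishes on `𝔥 ∩ [𝔤', 𝔤']` (they form a chain, see `tailSub_isGreatest`). -/
noncomputable def tailSub (k : Kind) (lam : Fin m ⊕ Fin n → ℤ) : ℕ × ℕ :=
  ((equalRank m n k).filter (VanishesOn k lam)).sup id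

lemma tailSub_isGreatest (k : Kind) (lam : Fin m ⊕ Fin n → ℤ) :
    IsGreatest {r | r ∈ equalRank m n k ∧ VanishesOn k lam r} (tailSub k lam) := by
  classical
  constructor
  · have h0 : ((0, 0) : ℕ × ℕ) ∈ {r | r ∈ equalRank m n k ∧ VanishesOn k lam r} := by
      refine ⟨by simp [equalRank], ?_⟩
      intro α _ h
      have h1 : ∀ i : Fin m, α (Sum.inl i) = 0 := fun i => by
        by_contra hne
        have := h.1 i hne
        have := i.2
        simp at *
        omega
      have h2 : ∀ j : Fin n, α (Sum.inr j) = 0 := fun j => by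
        by_contra hne
        have := h.2 j hne
        have := j.2
        split_ifs at * <;> simp at * <;> omega
      simp [form, h1, h2]
    refine Finset.sup_mem {r | r ∈ equalRank m n k ∧ VanishesOn k lam r} h0 ?_ _ _ ?_
    · intro x hx y hy
      have hc : x ≤ y ∨ y ≤ x := by
        have h1 := hx.1
        have h2 := hy.1
        simp only [equalRank, mem_filter] at h1 h2
        simp only [Prod.le_def]
        omega
      rcases hc with hc | hc
      · rwa [sup_eq_right.2 hc]
      · rwa [sup_eq_left.2 hc]
    · intro r hr
      simpa using hr
  · intro r hr
    exact Finset.le_sup (f := id) (by simpa using hr)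

/-- `tail(λ)`, the defect of the tail subalgebra `𝔤_λ`. -/
noncomputable def tail (k : Kind) (lam : Fin m ⊕ Fin n → ℤ) : ℕ :=
  min (tailSub k lam).1 (tailSub k lam).2

/-- `S` is an iso-set: a basis of an isotropic subspace of `𝔥^*`. -/
def IsIsoSet (S : Finset (Wt m n)) : Prop :=
  LinearIndependent ℂ (fun β : S => (β : Wt m n)) ∧ ∀ β ∈ S, ∀ γ ∈ S, form β γ = 0

open Classical in
/-- The atypicality of `μ` with respect to the set `D` of odd roots: the maximal cardinality of an
iso-set in `D` which is orthogonal to `μ`. -/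
noncomputable def atyp (D : Finset (Wt m n)) (μ : Wt m n) : ℕ :=
  (D.powerset.filter fun S => IsIsoSet S ∧ ∀ β ∈ S, form μ β = 0).sup Finset.card

open Classical in
/-- Stability of a weight of `gl(m|n)`: for some equal rank subalgebra `gl(s|s)`, both `λ + ρ` and
its restriction to this subalgebra have atypicality `s`. -/
def IsStable (lam : Fin m ⊕ Fin n → ℤ) : Prop :=
  ∃ s : ℕ, (s, s) ∈ equalRank m n .gl ∧
    atyp ((oddRoots m n .gl).filter (InSub .gl (s, s))) (toWt lam + rho m n .gl) = s ∧
    atyp (oddRoots m n .gl) (toWt lam + rho m n .gl) = s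

open Classical in
/-- The number `t = t(λ)` in the `osp`-case.  For `osp(2m|2n)` the zero position of the weight diagram
of `λ` contains `>` for each coordinate `(λ+ρ|ε_i) = 0` and `<` for each `(λ+ρ|δ_j) = 0`; one
cancels the pairs `>,<` (which are the symbols `×`), and `t` is `0` if nothing is left and `2`
otherwise.  For `osp(2m+1|2n)`, `t = 1`. -/
noncomputable def tNum (k : Kind) (lam : Fin m ⊕ Fin n → ℤ) : ℕ :=
  match k with
  | .gl => 0
  | .ospEven =>
    if #{i : Fin m | form (toWt lam + rho m n .ospEven) (eps i) = 0} =
        #{j : Fin n | form (toWt lam + rho m n .ospEven) (del j) = 0} then 0 else 2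
  | .ospOdd => 1

end Tail

/-! ### Weyl group, Weyl denominator, Euler characters and Kac-Wakimoto terms -/

section Characters

/-- A signed permutation of the `ε_i` together with a signed permutation of the `δ_j`: the element
`((σ, a), (τ, b))` sends `ε_i` to `a_i ε_{σ i}` and `δ_j` to `b_j δ_{τ j}`. -/
abbrev SPerm (m n : ℕ) : Type :=
  (Equiv.Perm (Fin m) × (Fin m → ℤˣ)) × (Equiv.Perm (Fin n) × (Fin n → ℤˣ))

variable {m n : ℕ}

/-- The action of a signed permutation on `𝔥^*`. -/
def SPerm.act (w : SPerm m n) : Wt m n ≃+ Wt m n where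
  toFun μ := Sum.elim
    (fun i => ((w.1.2 (w.1.1.symm i) : ℤ) : ℂ) * μ (Sum.inl (w.1.1.symm i)))
    (fun j => ((w.2.2 (w.2.1.symm j) : ℤ) : ℂ) * μ (Sum.inr (w.2.1.symm j)))
  invFun μ := Sum.elim
    (fun i => ((w.1.2 i : ℤ) : ℂ) * μ (Sum.inl (w.1.1 i)))
    (fun j => ((w.2.2 j : ℤ) : ℂ) * μ (Sum.inr (w.2.1 j)))
  left_inv μ := by
    have key (u : ℤˣ) : ((u : ℤ) : ℂ) * ((u : ℤ) : ℂ) = 1 := by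
      rcases Int.units_eq_one_or u with h | h <;> simp [h]
    funext k
    rcases k with i | j <;> simp [← mul_assoc, key]
  right_inv μ := by
    have key (u : ℤˣ) : ((u : ℤ) : ℂ) * ((u : ℤ) : ℂ) = 1 := by
      rcases Int.units_eq_one_or u with h | h <;> simp [h]
    funext k
    rcases k with i | j <;> simp [← mul_assoc, key]
  map_add' μ ν := by
    funext k
    rcases k with i | j <;> simp [mul_add]

/-- The sign `sgn(w)` (the determinant of `w` on `𝔥^*`); it is `-1` on reflections. -/
def SPerm.sgn (w : SPerm m n) : ℤˣ :=
  Equiv.Perm.sign w.1.1 * (∏ i, w.1.2 i) * (Equiv.Perm.sign w.2.1 * ∏ j, w.2.2 j)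

/-- The Weyl group of `𝔤_0`: all permutations for `gl_m × gl_n`; all signed permutations for
`o_{2m+1} × sp_{2n}`; for `o_{2m} × sp_{2n}`, those which change an even number of signs of
the `ε_i`. -/
def weyl (m n : ℕ) : Kind → Finset (SPerm m n)
  | .gl => univ.filter fun w => w.1.2 = 1 ∧ w.2.2 = 1
  | .ospEven => univ.filter fun w => ∏ i, w.1.2 i = 1
  | .ospOdd => univ

/-- The field of fractions of the group ring `ℚ[𝔥^*]`; it contains the ring `𝓡` of the fractions
whose denominators are products of factors `1 ± e^{-α}`. -/
abbrev Frac (m n : ℕ) : Type := FractionRing (AddMonoidAlgebra ℚ (Wt m n))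

/-- The exponential `e^μ`. -/
noncomputable def ex (μ : Wt m n) : Frac m n :=
  algebraMap (AddMonoidAlgebra ℚ (Wt m n)) (Frac m n) (AddMonoidAlgebra.single μ 1)

/-- The automorphism of the field of fractions induced by `w`; it sends `e^μ` to `e^{w μ}`. -/
noncomputable def SPerm.actFrac (w : SPerm m n) : Frac m n ≃+* Frac m n :=
  IsFractionRing.ringEquivOfRingEquiv (AddMonoidAlgebra.domCongr ℚ ℚ w.act).toRingEquiv

/-- The operator `P ↦ ∑_{w ∈ W} sgn(w) w(P)`. -/
noncomputable def jW (k : Kind) (P : Frac m n) : Frac m n :=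
  ∑ w ∈ weyl m n k, ((w.sgn : ℤ) : Frac m n) * w.actFrac P

/-- The Weyl denominator `R = ∏_{α ∈ Δ_0^+} (1 - e^{-α}) / ∏_{α ∈ Δ_1^+} (1 + e^{-α})`. -/
noncomputable def denomR (m n : ℕ) (k : Kind) : Frac m n :=
  (∏ α ∈ posEven m n k, (1 - ex (-α))) / ∏ α ∈ posOdd m n k (stdWord m n k), (1 + ex (-α))

/-- The Kac-Wakimoto term `KW(μ, S)`. -/
noncomputable def KW (k : Kind) (μ : Wt m n) (S : Finset (Wt m n)) : Frac m n :=
  jW k (ex μ / ∏ β ∈ S, (1 + ex (-β)))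

open Classical in
/-- The Euler character `𝓔_λ`. -/
noncomputable def euler (k : Kind) (lam : Fin m ⊕ Fin n → ℤ) : Frac m n :=
  (denomR m n k)⁻¹ * ex (-rho m n k) *
    jW k (ex (toWt lam + rho m n k) /
      ∏ α ∈ (posOdd m n k (stdWord m n k)).filter (InSub k (tailSub k lam)), (1 + ex (-α)))

/-- The number `j_s` in the `osp`-case: `max(1, 2^{s-1} s!)` if `t = 0` and `2^s s!` if `t = 1, 2`.
(For `s = 0` the exponent is truncated to `0`, and the maximum is `1` as it should be.) -/
def jOsp (t s : ℕ) : ℕ :=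
  if t = 0 then max 1 (2 ^ (s - 1) * s.factorial) else 2 ^ s * s.factorial

/-- The number `j_s = (-1)^{[s/2]} s!` in the `gl`-case. -/
def jGl (s : ℕ) : ℤ := (-1) ^ (s / 2) * (s.factorial : ℤ)

end Characters

end SuperKW

open SuperKW

namespace SuperKW

open Finset

/-! ### Vandermonde and Cauchy determinants -/

section Determinants

variable {F : Type*} [Field F]

/-- The Vandermonde product `∏_{i<j} (u_i - u_j)`. -/
def descVand {n : ℕ} (u : Fin n → F) : F := ∏ i, ∏ j ∈ Ioi i, (u i - u j)

lemma descVand_eq_det {n : ℕ} (u : Fin n → F) :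
    descVand u = (Matrix.of fun i j : Fin n => u i ^ (Fin.rev j : ℕ)).det := by
  have h := Matrix.det_projVandermonde (fun _ => (1 : F)) u
  simp only [one_mul] at h
  rw [descVand, ← h]
  congr 1
  ext i j
  simp [Matrix.projVandermonde_apply]

lemma descVand_comp_perm {n : ℕ} (u : Fin n → F) (σ : Equiv.Perm (Fin n)) :
    descVand (fun i => u (σ i)) = (Equiv.Perm.sign σ : ℤ) * descVand u := by
  rw [descVand_eq_det, descVand_eq_det, ← Matrix.det_permute]
  rfl

lemma descVand_succ {n : ℕ} (u : Fin (n + 1) → F) :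
    descVand u = (∏ i : Fin n, (u 0 - u i.succ)) * descVand (fun i : Fin n => u i.succ) := by
  simp only [descVand]
  rw [Fin.prod_univ_succ, Fin.prod_Ioi_zero]
  congr 1
  refine Finset.prod_congr rfl fun i _ => ?_
  rw [Fin.prod_Ioi_succ]

/-- Determinant of the Cauchy matrix bordered by a column of ones, in terms of the
Cauchy determinant of smaller size. -/
lemma det_cauchy_border_aux {n : ℕ} (u : Fin (n + 1) → F) (v : Fin n → F)
    (h : ∀ i j, u i + v j ≠ 0) :
    (Matrix.of fun i j : Fin (n + 1) => Fin.cons (α := fun _ => F) 1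
        (fun j : Fin n => (u i + v j)⁻¹) j).det =
      (∏ i : Fin n, (u 0 - u i.succ)) * (∏ j : Fin n, (u 0 + v j)⁻¹) *
        (Matrix.of fun i j : Fin n => (u i.succ + v j)⁻¹).det := by
  set A : Matrix (Fin (n + 1)) (Fin (n + 1)) F := Matrix.of fun i j => Fin.cons (α := fun _ => F) 1
        (fun j : Fin n => (u i + v j)⁻¹) j with hA
  set B : Matrix (Fin (n + 1)) (Fin (n + 1)) F := Matrix.of fun i j =>
    A i j - (if i = 0 then 0 else 1) * A 0 j with hB
  have hAB : B.det = A.det := by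
    refine Matrix.det_eq_of_forall_row_eq_smul_add_const
      (fun i => if i = 0 then 0 else -1) 0 (by simp) ?_
    intro i j
    by_cases hi : i = 0 <;> simp [hB, hi, sub_eq_add_neg]
  rw [← hAB, Matrix.det_succ_column_zero, Fin.sum_univ_succ]
  have hz : ∀ i : Fin n, B i.succ 0 = 0 := by
    intro i; simp [hB, hA, Fin.succ_ne_zero]
  have h0 : B 0 0 = 1 := by simp [hB, hA]
  simp only [hz, h0, mul_zero, zero_mul, sum_const_zero, add_zero, Fin.val_zero, pow_zero, one_mul]
  have hM : B.submatrix (Fin.succAbove 0) Fin.succ =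
      Matrix.of fun i j : Fin n => (u 0 - u i.succ) *
        (Matrix.of fun i j : Fin n => (u 0 + v j)⁻¹ *
          (Matrix.of fun i j : Fin n => (u i.succ + v j)⁻¹) i j) i j := by
    ext i j
    have h1 := h i.succ j
    have h2 := h 0 j
    simp only [hB, hA, Matrix.submatrix_apply, Matrix.of_apply, Fin.succAbove_zero,
      Fin.succ_ne_zero, if_false, Fin.cons_succ, one_mul]
    field_simp
    ring
  rw [hM, Matrix.det_mul_column, Matrix.det_mul_row, mul_assoc]

/-- Cauchy's determinant. -/
theorem det_cauchy {n : ℕ} (u v : Fin n → F) (h : ∀ i j, u i + v j ≠ 0) :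
    (Matrix.of fun i j : Fin n => (u i + v j)⁻¹).det =
      descVand u * descVand v * ∏ i, ∏ j, (u i + v j)⁻¹ := by
  induction n with
  | zero => simp [descVand]
  | succ n ih =>
    set A : Matrix (Fin (n + 1)) (Fin (n + 1)) F := Matrix.of fun i j => (u i + v j)⁻¹ with hA
    set B : Matrix (Fin (n + 1)) (Fin (n + 1)) F := Matrix.of fun i j =>
      A i j - (if i = 0 then 0 else 1) * A 0 j with hB
    have hAB : B.det = A.det := by
      refine Matrix.det_eq_of_forall_row_eq_smul_add_const
        (fun i => if i = 0 then 0 else -1) 0 (by simp) ?_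
      intro i j
      by_cases hi : i = 0 <;> simp [hB, hi, sub_eq_add_neg]
    set C : Matrix (Fin (n + 1)) (Fin (n + 1)) F := Matrix.of fun j i =>
      Fin.cons (α := fun _ => F) 1 (fun i : Fin n => (v j + u i.succ)⁻¹) i with hC
    have hBC : B = Matrix.of fun i j => (Fin.cons (α := fun _ => F) 1
        (fun i : Fin n => u 0 - u i.succ) i) *
        (Matrix.of fun i j => (u 0 + v j)⁻¹ * C.transpose i j) i j := by
      ext i j
      have h2 := h 0 j
      refine Fin.cases ?_ (fun i => ?_) i
      · simp [hB, hA, hC]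
      · have h1 := h i.succ j
        have h1' : v j + u i.succ ≠ 0 := by rwa [add_comm]
        simp only [hB, hA, hC, Matrix.of_apply, Fin.succ_ne_zero, if_false, Fin.cons_succ, one_mul,
          Matrix.transpose_apply]
        rw [add_comm (v j)]
        field_simp
        ring
    rw [← hAB, hBC, Matrix.det_mul_column, Matrix.det_mul_row, Matrix.det_transpose, hC,
      det_cauchy_border_aux v (fun i : Fin n => u i.succ) (fun i j => by rw [add_comm]; exact h _ _)]
    have hT : (Matrix.of fun i j : Fin n => (v i.succ + u j.succ)⁻¹) =
        (Matrix.of fun i j : Fin n => (u i.succ + v j.succ)⁻¹).transpose := by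
      ext i j
      simp [add_comm]
    rw [hT, Matrix.det_transpose, ih _ _ (fun i j => h _ _), descVand_succ u, descVand_succ v]
    simp only [Fin.prod_univ_succ, Fin.cons_zero, Fin.cons_succ, one_mul, Finset.prod_mul_distrib,
      add_comm (v 0)]
    ring

/-- Cauchy's determinant, with a column of ones added. -/
theorem det_cauchy_border {n : ℕ} (u : Fin (n + 1) → F) (v : Fin n → F)
    (h : ∀ i j, u i + v j ≠ 0) :
    (Matrix.of fun i j : Fin (n + 1) => Fin.cons (α := fun _ => F) 1
        (fun j : Fin n => (u i + v j)⁻¹) j).det =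
      descVand u * descVand v * ∏ i, ∏ j, (u i + v j)⁻¹ := by
  rw [det_cauchy_border_aux u v h, det_cauchy _ _ (fun i j => h _ _), descVand_succ u,
    Fin.prod_univ_succ (fun i => ∏ j, (u i + v j)⁻¹)]
  ring

open Polynomial

/-- The determinant of the values of monic polynomials of degrees `n-1, …, 0`. -/
lemma det_eval_monic_rev {n : ℕ} (u : Fin n → F) (P : ℕ → F[X]) (hm : ∀ k, (P k).Monic)
    (hd : ∀ k, (P k).natDegree = k) :
    (Matrix.of fun i j : Fin n => (P (Fin.rev j)).eval (u i)).det = descVand u := by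
  have h := Matrix.det_eval_matrixOfPolynomials_eq_det_vandermonde u (fun j : Fin n => P j)
    (fun i => hd i) (fun i => hm i)
  have e1 : (Matrix.of fun i j : Fin n => (P (Fin.rev j)).eval (u i)) =
      (Matrix.of fun i j : Fin n => (P j).eval (u i)).submatrix id Fin.revPerm := by
    ext i j; simp
  have e2 : (Matrix.of fun i j : Fin n => u i ^ (Fin.rev j : ℕ)) =
      (Matrix.vandermonde u).submatrix id Fin.revPerm := by
    ext i j; simp [Matrix.vandermonde_apply]
  rw [e1, descVand_eq_det, e2, Matrix.det_permute', Matrix.det_permute', h]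

/-- Monic polynomials satisfying the recursion `P_{k+2} = X P_{k+1} - P_k` for `k ≥ 1`. -/
noncomputable def recPoly (c d : F) : ℕ → F[X]
  | 0 => 1
  | 1 => X + C c
  | 2 => X * (X + C c) - C d
  | k + 3 => X * recPoly c d (k + 2) - recPoly c d (k + 1)

lemma recPoly_monic_natDegree (c d : F) (k : ℕ) :
    (recPoly c d k).Monic ∧ (recPoly c d k).natDegree = k := by
  have key (A B : F[X]) (k : ℕ) (hA : A.Monic) (dA : A.natDegree = k + 1)
      (dB : B.natDegree ≤ k) : (X * A - B).Monic ∧ (X * A - B).natDegree = k + 2 := by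
    have h1 : (X * A).Monic := monic_X.mul hA
    have h2 : (X * A).natDegree = k + 2 := by
      rw [monic_X.natDegree_mul hA, natDegree_X, dA]; ring
    have h3 : B.degree < (X * A).degree := by
      refine lt_of_le_of_lt degree_le_natDegree ?_
      rw [degree_eq_natDegree h1.ne_zero, h2]
      exact_mod_cast by omega
    refine ⟨h1.sub_of_left h3, ?_⟩
    rw [natDegree_sub_eq_left_of_natDegree_lt (by omega), h2]
  induction k using Nat.strong_induction_on with
  | _ k ih =>
    match k with
    | 0 => simp [recPoly]
    | 1 => exact ⟨monic_X_add_C c, natDegree_X_add_C c⟩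
    | 2 => exact key _ _ 0 (monic_X_add_C c) (natDegree_X_add_C c) (by simp)
    | k + 3 =>
      have h1 := ih (k + 2) (by omega)
      have h2 := ih (k + 1) (by omega)
      exact key _ _ (k + 1) h1.1 h1.2 h2.2.le

/-- A sequence with the recursion of `recPoly` is given by the values of these polynomials. -/
lemma eq_mul_eval_recPoly (c d x r : F) (f : ℕ → F) (h0 : f 0 = r) (h1 : f 1 = (x + c) * r)
    (h2 : f 2 = (x * (x + c) - d) * r) (h3 : ∀ k, f (k + 3) = x * f (k + 2) - f (k + 1)) (k : ℕ) :
    f k = r * (recPoly c d k).eval x := by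
  induction k using Nat.strong_induction_on with
  | _ k ih =>
    match k with
    | 0 => simp [recPoly, h0]
    | 1 => simp [recPoly, h1, mul_comm]
    | 2 => simp [recPoly, h2, mul_comm]
    | k + 3 =>
      rw [h3, ih (k + 2) (by omega), ih (k + 1) (by omega)]
      simp only [recPoly, eval_sub, eval_mul, eval_X]
      ring

lemma det_mul_recPoly {n : ℕ} (c d : F) (u r : Fin n → F) :
    (Matrix.of fun i j : Fin n => r i * (recPoly c d (Fin.rev j)).eval (u i)).det =
      (∏ i, r i) * descVand u := by
  rw [← det_eval_monic_rev u _ (fun k => (recPoly_monic_natDegree c d k).1)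
    (fun k => (recPoly_monic_natDegree c d k).2), ← Matrix.det_mul_column]
  rfl

/-- Weyl denominator of type `B`. -/
lemma det_typeB {n : ℕ} (X : Fin n → F) (hX : ∀ i, X i ≠ 0) :
    (Matrix.of fun i j : Fin n => X i ^ (2 * (Fin.rev j : ℕ) + 1) -
        (X i)⁻¹ ^ (2 * (Fin.rev j : ℕ) + 1)).det =
      (∏ i, (X i - (X i)⁻¹)) * descVand (fun i => X i ^ 2 + (X i)⁻¹ ^ 2) := by
  rw [← det_mul_recPoly 1 1]
  congr 1
  ext i j
  have h := hX i
  refine eq_mul_eval_recPoly 1 1 (X i ^ 2 + (X i)⁻¹ ^ 2) (X i - (X i)⁻¹)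
    (fun k => X i ^ (2 * k + 1) - (X i)⁻¹ ^ (2 * k + 1)) (by simp) ?_ ?_ (fun k => ?_) _
  · simp only [Nat.reduceMul, Nat.reduceAdd]
    field_simp
    ring
  · simp only [Nat.reduceMul, Nat.reduceAdd]
    field_simp
    ring
  · have hz : X i * (X i)⁻¹ = 1 := mul_inv_cancel₀ h
    generalize (X i)⁻¹ = z at hz ⊢
    linear_combination
      -(X i ^ (2 * k + 3) - z ^ (2 * k + 3)) * (X i * z + 1) * hz

/-- Weyl denominator of type `C`. -/
lemma det_typeC {n : ℕ} (x : Fin n → F) (hx : ∀ i, x i ≠ 0) :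
    (Matrix.of fun i j : Fin n => x i ^ ((Fin.rev j : ℕ) + 1) -
        (x i)⁻¹ ^ ((Fin.rev j : ℕ) + 1)).det =
      (∏ i, (x i - (x i)⁻¹)) * descVand (fun i => x i + (x i)⁻¹) := by
  rw [← det_mul_recPoly 0 1]
  congr 1
  ext i j
  have h := hx i
  refine eq_mul_eval_recPoly 0 1 (x i + (x i)⁻¹) (x i - (x i)⁻¹)
    (fun k => x i ^ (k + 1) - (x i)⁻¹ ^ (k + 1)) (by simp) ?_ ?_ (fun k => ?_) _
  · simp only [Nat.reduceAdd]
    field_simp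
    ring
  · simp only [Nat.reduceAdd]
    field_simp
    ring
  · have hz : x i * (x i)⁻¹ = 1 := mul_inv_cancel₀ h
    generalize (x i)⁻¹ = z at hz ⊢
    linear_combination -(x i ^ (k + 2) - z ^ (k + 2)) * hz

/-- Weyl denominator of type `D`. -/
lemma det_typeD {n : ℕ} (x : Fin (n + 1) → F) (hx : ∀ i, x i ≠ 0) :
    (Matrix.of fun i j : Fin (n + 1) => x i ^ (Fin.rev j : ℕ) + (x i)⁻¹ ^ (Fin.rev j : ℕ)).det =
      2 * descVand (fun i => x i + (x i)⁻¹) := by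
  have hk (i : Fin (n + 1)) (k : ℕ) :
      (if k = 0 then 1 else x i ^ k + (x i)⁻¹ ^ k) =
        1 * (recPoly 0 2 k).eval (x i + (x i)⁻¹) := by
    have h := hx i
    refine eq_mul_eval_recPoly 0 2 (x i + (x i)⁻¹) 1
      (fun k => if k = 0 then 1 else x i ^ k + (x i)⁻¹ ^ k) (by simp) (by simp) ?_ (fun k => ?_) _
    all_goals
      simp [pow_add]
      field_simp
      ring
  have h1 := det_mul_recPoly 0 2 (fun i => x i + (x i)⁻¹) (fun _ : Fin (n + 1) => 1)
  simp only [Finset.prod_const_one, one_mul] at h1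
  rw [← h1]
  have h2 : (Matrix.of fun i j : Fin (n + 1) =>
        x i ^ (Fin.rev j : ℕ) + (x i)⁻¹ ^ (Fin.rev j : ℕ)) =
      Matrix.of fun i j : Fin (n + 1) => (if j = Fin.last n then 2 else 1) *
        (Matrix.of fun i j : Fin (n + 1) =>
          (recPoly 0 2 (Fin.rev j)).eval (x i + (x i)⁻¹)) i j := by
    ext i j
    have h3 := hk i (Fin.rev j)
    have h4 : (Fin.rev j : ℕ) = 0 ↔ j = Fin.last n := by
      rw [Fin.ext_iff, Fin.val_rev, Fin.val_last]; omega
    simp only [h4, one_mul] at h3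
    simp only [Matrix.of_apply, ← h3]
    split_ifs with h5
    · rw [h4.2 h5]; norm_num
    · simp
  rw [h2, Matrix.det_mul_row]
  simp

end Determinants

/-! ### Sums over signed permutations -/

section SignedSums

variable {F : Type*} [Field F]

lemma sum_units_int {M : Type*} [AddCommMonoid M] (h : ℤˣ → M) : ∑ c, h c = h 1 + h (-1) := by
  have : (univ : Finset ℤˣ) = {1, -1} := by decide
  rw [this, sum_pair (by decide)]

lemma sum_signs {ι : Type*} [Fintype ι] [DecidableEq ι] (h : ι → ℤˣ → F) :
    ∑ a : ι → ℤˣ, ∏ i, h i (a i) = ∏ i, ∑ c, h i c := by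
  rw [← Finset.sum_prod_piFinset, Fintype.piFinset_univ]

lemma two_mul_sum_even_signs {p : ℕ} (i₀ : Fin p) (f : (Fin p → ℤˣ) → F)
    (hf : ∀ a, f (Function.update a i₀ (-a i₀)) = f a) :
    2 * ∑ a ∈ univ.filter (fun a : Fin p → ℤˣ => ∏ i, a i = 1), f a = ∑ a, f a := by
  have hflip (a : Fin p → ℤˣ) : ∏ i, Function.update a i₀ (-a i₀) i = -∏ i, a i := by
    rw [Finset.prod_update_of_mem (mem_univ i₀), neg_mul]
    congr 1
    rw [← Finset.mul_prod_erase univ a (mem_univ i₀), Finset.sdiff_singleton_eq_erase]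
  have hinv (a : Fin p → ℤˣ) :
      Function.update (Function.update a i₀ (-a i₀)) i₀ (-Function.update a i₀ (-a i₀) i₀) = a := by
    simp
  rw [two_mul, ← Finset.sum_filter_add_sum_filter_not univ (fun a : Fin p → ℤˣ => ∏ i, a i = 1)]
  congr 1
  refine Finset.sum_nbij' (fun a => Function.update a i₀ (-a i₀))
    (fun a => Function.update a i₀ (-a i₀)) ?_ ?_ (fun a _ => hinv a) (fun a _ => hinv a)
    (fun a _ => (hf a).symm)
  · intro a ha
    simp only [mem_filter, mem_univ, true_and] at ha ⊢
    rw [hflip, ha]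
    decide
  · intro a ha
    simp only [mem_filter, mem_univ, true_and] at ha ⊢
    rw [hflip, (Int.units_eq_one_or _).resolve_left ha, neg_neg]

lemma sign_mul_self_cast {n : ℕ} (τ : Equiv.Perm (Fin n)) :
    (((Equiv.Perm.sign τ : ℤˣ) : ℤ) : F) * ((Equiv.Perm.sign τ : ℤˣ) : ℤ) = 1 := by
  rcases Int.units_eq_one_or (Equiv.Perm.sign τ) with h | h <;> simp [h]

/-- A double alternating sum, evaluated by Cauchy's determinant. -/
lemma sum_perm_cauchy {s : ℕ} (u v : Fin s → F) (h : ∀ i j, u i + v j ≠ 0) :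
    ∑ σ : Equiv.Perm (Fin s), ∑ τ : Equiv.Perm (Fin s),
      ((Equiv.Perm.sign σ : ℤ) : F) * ((Equiv.Perm.sign τ : ℤ) : F) * ∏ j, (u (σ j) + v (τ j))⁻¹ =
    s.factorial * (descVand u * descVand v * ∏ i, ∏ j, (u i + v j)⁻¹) := by
  rw [Finset.sum_comm]
  have key (τ : Equiv.Perm (Fin s)) : ∑ σ : Equiv.Perm (Fin s),
      ((Equiv.Perm.sign σ : ℤ) : F) * ((Equiv.Perm.sign τ : ℤ) : F) * ∏ j, (u (σ j) + v (τ j))⁻¹ =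
      descVand u * descVand v * ∏ i, ∏ j, (u i + v j)⁻¹ := by
    have h1 := det_cauchy u (fun j => v (τ j)) (fun i j => h _ _)
    rw [Matrix.det_apply', descVand_comp_perm] at h1
    simp only [Matrix.of_apply] at h1
    calc _ = ((Equiv.Perm.sign τ : ℤ) : F) * ∑ σ : Equiv.Perm (Fin s),
          ((Equiv.Perm.sign σ : ℤ) : F) * ∏ j, (u (σ j) + v (τ j))⁻¹ := by
            rw [mul_sum]; exact sum_congr rfl fun σ _ => by ring
      _ = _ := by
        rw [h1]
        have h2 : ∏ i, ∏ j, (u i + v (τ j))⁻¹ = ∏ i, ∏ j, (u i + v j)⁻¹ :=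
          prod_congr rfl fun i _ => Equiv.prod_comp τ (fun j => (u i + v j)⁻¹)
        rw [h2]
        linear_combination (descVand u * descVand v * ∏ i, ∏ j, (u i + v j)⁻¹) *
          sign_mul_self_cast (F := F) τ
  rw [sum_congr rfl fun τ _ => key τ, sum_const, card_univ, Fintype.card_perm, Fintype.card_fin,
    nsmul_eq_mul]

/-- A double alternating sum, evaluated by the Cauchy determinant with a column of ones. -/
lemma sum_perm_cauchy_border {s : ℕ} (u : Fin (s + 1) → F) (v : Fin s → F)
    (h : ∀ i j, u i + v j ≠ 0) :
    ∑ σ : Equiv.Perm (Fin (s + 1)), ∑ τ : Equiv.Perm (Fin s),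
      ((Equiv.Perm.sign σ : ℤ) : F) * ((Equiv.Perm.sign τ : ℤ) : F) *
        ∏ j : Fin s, (u (σ j.succ) + v (τ j))⁻¹ =
    s.factorial * (descVand u * descVand v * ∏ i, ∏ j, (u i + v j)⁻¹) := by
  rw [Finset.sum_comm]
  have key (τ : Equiv.Perm (Fin s)) : ∑ σ : Equiv.Perm (Fin (s + 1)),
      ((Equiv.Perm.sign σ : ℤ) : F) * ((Equiv.Perm.sign τ : ℤ) : F) *
        ∏ j : Fin s, (u (σ j.succ) + v (τ j))⁻¹ =
      descVand u * descVand v * ∏ i, ∏ j, (u i + v j)⁻¹ := by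
    have h1 := det_cauchy_border u (fun j => v (τ j)) (fun i j => h _ _)
    rw [Matrix.det_apply', descVand_comp_perm] at h1
    simp only [Matrix.of_apply, Fin.prod_univ_succ, Fin.cons_zero, Fin.cons_succ, one_mul] at h1
    calc _ = ((Equiv.Perm.sign τ : ℤ) : F) * ∑ σ : Equiv.Perm (Fin (s + 1)),
          ((Equiv.Perm.sign σ : ℤ) : F) * ∏ j : Fin s, (u (σ j.succ) + v (τ j))⁻¹ := by
            rw [mul_sum]; exact sum_congr rfl fun σ _ => by ring
      _ = _ := by
        rw [h1, ← Fin.prod_univ_succ (fun i => ∏ j, (u i + v (τ j))⁻¹)]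
        have h2 : ∏ i, ∏ j, (u i + v (τ j))⁻¹ = ∏ i, ∏ j, (u i + v j)⁻¹ :=
          prod_congr rfl fun i _ => Equiv.prod_comp τ (fun j => (u i + v j)⁻¹)
        rw [h2]
        linear_combination (descVand u * descVand v * ∏ i, ∏ j, (u i + v j)⁻¹) *
          sign_mul_self_cast (F := F) τ
  rw [sum_congr rfl fun τ _ => key τ, sum_const, card_univ, Fintype.card_perm, Fintype.card_fin,
    nsmul_eq_mul]

lemma prod_prod_perm {p q : ℕ} (σ : Equiv.Perm (Fin p)) (τ : Equiv.Perm (Fin q))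
    (f : Fin p → Fin q → F) : ∏ i, ∏ j, f (σ i) (τ j) = ∏ i, ∏ j, f i j := by
  rw [Equiv.prod_comp σ (fun i => ∏ j, f i (τ j))]
  exact prod_congr rfl fun i _ => Equiv.prod_comp τ (f i)

/-- Ring homomorphisms which act on given elements `X_i`, `Y_j` by signed permutations. -/
structure SignedAction {p q : ℕ} (φ : SPerm p q → F →+* F) (X : Fin p → F) (Y : Fin q → F) :
    Prop where
  map_left : ∀ g i, φ g (X i) = X (g.1.1 i) ^ (g.1.2 i : ℤ)
  map_right : ∀ g j, φ g (Y j) = Y (g.2.1 j) ^ (g.2.2 j : ℤ)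

lemma zpow_unit_add_inv (x : F) (c : ℤˣ) (k : ℕ) :
    (x ^ (c : ℤ)) ^ k + (x ^ (c : ℤ))⁻¹ ^ k = x ^ k + x⁻¹ ^ k := by
  rcases Int.units_eq_one_or c with h | h <;> simp [h, add_comm]

/-! #### General linear case -/

lemma sum_weyl_gl {p q : ℕ} {M : Type*} [AddCommMonoid M] (f : SPerm p q → M) :
    ∑ g ∈ weyl p q .gl, f g =
      ∑ σ : Equiv.Perm (Fin p), ∑ τ : Equiv.Perm (Fin q), f ((σ, 1), (τ, 1)) := by
  rw [← Fintype.sum_prod_type' (f := fun σ τ => f ((σ, 1), (τ, 1)))]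
  refine Finset.sum_nbij' (fun g => (g.1.1, g.2.1)) (fun x => ((x.1, 1), (x.2, 1))) ?_ ?_ ?_ ?_ ?_
  · simp
  · simp [weyl]
  · rintro ⟨⟨σ, a⟩, ⟨τ, b⟩⟩ h
    simp only [weyl, mem_filter, mem_univ, true_and] at h
    simp [h.1, h.2]
  · simp
  · rintro ⟨⟨σ, a⟩, ⟨τ, b⟩⟩ h
    simp only [weyl, mem_filter, mem_univ, true_and] at h
    simp [h.1, h.2]

lemma sum_gl_euler {s : ℕ} {φ : SPerm s s → F →+* F} {X Y : Fin s → F}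
    (hφ : SignedAction φ X Y) :
    ∑ g ∈ weyl s s .gl, ((g.sgn : ℤ) : F) * φ g ((∏ i, X i ^ ((Fin.rev i : ℕ) + 1)) *
        (∏ j, Y j ^ (Fin.rev j : ℕ)) * ∏ i, ∏ j, (X i + Y j)⁻¹) =
      (∏ i, X i) * (descVand X * descVand Y * ∏ i, ∏ j, (X i + Y j)⁻¹) := by
  rw [sum_weyl_gl, descVand_eq_det, descVand_eq_det, Matrix.det_apply', Matrix.det_apply',
    sum_mul_sum, sum_mul, mul_sum]
  refine sum_congr rfl fun σ _ => ?_
  rw [sum_mul, mul_sum]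
  refine sum_congr rfl fun τ _ => ?_
  simp only [map_mul, map_prod, map_pow, map_inv₀, map_add, hφ.map_left, hφ.map_right,
    Pi.one_apply, Units.val_one, zpow_one, Matrix.of_apply, SPerm.sgn, pow_succ, prod_mul_distrib,
    prod_const_one, mul_one, Equiv.prod_comp σ X, prod_prod_perm σ τ (fun i j => (X i + Y j)⁻¹)]
  push_cast
  ring

lemma sum_gl_kw {s : ℕ} {φ : SPerm s s → F →+* F} {X Y : Fin s → F}
    (hφ : SignedAction φ X Y) (h : ∀ i j, X i + Y j ≠ 0) :
    ∑ g ∈ weyl s s .gl, ((g.sgn : ℤ) : F) *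
        φ g (∏ j, X (Fin.rev j) * (X (Fin.rev j) + Y j)⁻¹) =
      ((Equiv.Perm.sign (Fin.revPerm : Equiv.Perm (Fin s)) : ℤ) : F) * s.factorial *
        ((∏ i, X i) * (descVand X * descVand Y * ∏ i, ∏ j, (X i + Y j)⁻¹)) := by
  have h1 := sum_perm_cauchy X Y h
  rw [sum_weyl_gl, ← Equiv.sum_comp (Equiv.mulRight (Fin.revPerm : Equiv.Perm (Fin s)))]
  calc _ = ((Equiv.Perm.sign (Fin.revPerm : Equiv.Perm (Fin s)) : ℤ) : F) * (∏ i, X i) *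
      ∑ σ : Equiv.Perm (Fin s), ∑ τ : Equiv.Perm (Fin s), ((Equiv.Perm.sign σ : ℤ) : F) *
        ((Equiv.Perm.sign τ : ℤ) : F) * ∏ j, (X (σ j) + Y (τ j))⁻¹ := by
        rw [mul_sum]
        refine sum_congr rfl fun σ _ => ?_
        rw [mul_sum]
        refine sum_congr rfl fun τ _ => ?_
        simp only [map_mul, map_prod, map_inv₀, map_add, hφ.map_left, hφ.map_right,
          Pi.one_apply, Units.val_one, zpow_one, SPerm.sgn, prod_mul_distrib,
          prod_const_one, mul_one, Equiv.coe_mulRight, Equiv.Perm.coe_mul, Function.comp_apply,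
          Fin.revPerm_apply, Fin.rev_rev, Equiv.prod_comp σ X]
        push_cast
        ring
    _ = _ := by rw [h1]; ring

/-! #### Odd orthosymplectic case -/

lemma sum_sperm {p q : ℕ} {M : Type*} [AddCommMonoid M] (f : SPerm p q → M) :
    ∑ g, f g = ∑ σ : Equiv.Perm (Fin p), ∑ τ : Equiv.Perm (Fin q), ∑ a : Fin p → ℤˣ,
      ∑ b : Fin q → ℤˣ, f ((σ, a), (τ, b)) := by
  rw [Fintype.sum_prod_type, Fintype.sum_prod_type]
  refine sum_congr rfl fun σ _ => ?_
  rw [Finset.sum_comm' (t' := univ) (s' := fun _ => univ) (by simp)]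
  rw [Fintype.sum_prod_type]
  refine sum_congr rfl fun τ _ => ?_
  rw [Finset.sum_comm]

lemma sum_signs_zpow {p : ℕ} (X : Fin p → F) (k : Fin p → ℕ) :
    ∑ a : Fin p → ℤˣ, (((∏ i, a i : ℤˣ) : ℤ) : F) * ∏ i, (X i ^ (a i : ℤ)) ^ k i =
      ∏ i, (X i ^ k i - (X i)⁻¹ ^ k i) := by
  have h := sum_signs (fun i (c : ℤˣ) => ((c : ℤ) : F) * (X i ^ (c : ℤ)) ^ k i)
  simp only [prod_mul_distrib] at h
  push_cast at h ⊢
  rw [h]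
  refine prod_congr rfl fun i _ => ?_
  simp [sub_eq_add_neg]

/-- The sum over a product of two groups of signed permutations of a product of monomials. -/
lemma sum_sperm_monomial {p q : ℕ} (X : Fin p → F) (Y : Fin q → F) (k : Fin p → ℕ)
    (l : Fin q → ℕ) :
    ∑ g : SPerm p q, ((g.sgn : ℤ) : F) * ((∏ i, (X (g.1.1 i) ^ (g.1.2 i : ℤ)) ^ k i) *
        ∏ j, (Y (g.2.1 j) ^ (g.2.2 j : ℤ)) ^ l j) =
      (Matrix.of fun i j => X i ^ k j - (X i)⁻¹ ^ k j).det *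
        (Matrix.of fun i j => Y i ^ l j - (Y i)⁻¹ ^ l j).det := by
  rw [sum_sperm, Matrix.det_apply', Matrix.det_apply', sum_mul_sum]
  refine sum_congr rfl fun σ _ => sum_congr rfl fun τ _ => ?_
  simp only [Matrix.of_apply]
  rw [← sum_signs_zpow (fun i => X (σ i)) k, ← sum_signs_zpow (fun j => Y (τ j)) l, mul_sum,
    sum_mul]
  refine sum_congr rfl fun a _ => ?_
  rw [mul_sum, mul_sum]
  refine sum_congr rfl fun b _ => ?_
  simp only [SPerm.sgn]
  push_cast
  ring

lemma sum_ospOdd_euler {s : ℕ} {φ : SPerm s s → F →+* F} {X Y : Fin s → F}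
    (hφ : SignedAction φ X Y) (hX : ∀ i, X i ≠ 0) (hY : ∀ j, Y j ≠ 0)
    (hY' : ∀ j, Y j + (Y j)⁻¹ ≠ 0) :
    ∑ g ∈ weyl s s .ospOdd, ((g.sgn : ℤ) : F) * φ g ((∏ i, X i ^ (2 * (Fin.rev i : ℕ) + 1)) *
        (∏ j, (Y j ^ 2) ^ ((Fin.rev j : ℕ) + 1)) *
        ((∏ j, (Y j + (Y j)⁻¹)⁻¹) *
          ∏ i, ∏ j, ((X i ^ 2 + (X i)⁻¹ ^ 2) + (Y j ^ 2 + (Y j)⁻¹ ^ 2))⁻¹)) =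
      (∏ i, (X i - (X i)⁻¹)) * (∏ j, (Y j - (Y j)⁻¹)) *
        (descVand (fun i => X i ^ 2 + (X i)⁻¹ ^ 2) * descVand (fun j => Y j ^ 2 + (Y j)⁻¹ ^ 2) *
          ∏ i, ∏ j, ((X i ^ 2 + (X i)⁻¹ ^ 2) + (Y j ^ 2 + (Y j)⁻¹ ^ 2))⁻¹) := by
  set D : F := (∏ j, (Y j + (Y j)⁻¹)⁻¹) *
          ∏ i, ∏ j, ((X i ^ 2 + (X i)⁻¹ ^ 2) + (Y j ^ 2 + (Y j)⁻¹ ^ 2))⁻¹ with hD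
  have hDinv (g : SPerm s s) : φ g D = D := by
    have h1 (x : F) (c : ℤˣ) := zpow_unit_add_inv x c 2
    have h2 (x : F) (c : ℤˣ) := zpow_unit_add_inv x c 1
    simp only [pow_one] at h2
    simp only [hD, map_mul, map_prod, map_inv₀, map_add, map_pow, hφ.map_left, hφ.map_right, h1, h2]
    rw [Equiv.prod_comp g.2.1 (fun j => (Y j + (Y j)⁻¹)⁻¹), prod_prod_perm g.1.1 g.2.1
      (fun i j => ((X i ^ 2 + (X i)⁻¹ ^ 2) + (Y j ^ 2 + (Y j)⁻¹ ^ 2))⁻¹)]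
  have hsum := sum_sperm_monomial X (fun j => Y j ^ 2) (fun i => 2 * (Fin.rev i : ℕ) + 1)
    (fun j => (Fin.rev j : ℕ) + 1)
  rw [det_typeB X hX, det_typeC _ (fun j => pow_ne_zero 2 (hY j))] at hsum
  calc _ = (∑ g : SPerm s s, ((g.sgn : ℤ) : F) *
      ((∏ i, (X (g.1.1 i) ^ (g.1.2 i : ℤ)) ^ (2 * (Fin.rev i : ℕ) + 1)) *
        ∏ j, ((Y (g.2.1 j) ^ 2) ^ (g.2.2 j : ℤ)) ^ ((Fin.rev j : ℕ) + 1))) * D := by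
        rw [sum_mul]
        refine sum_congr rfl fun g _ => ?_
        rw [map_mul, hDinv, ← mul_assoc]
        congr 2
        simp only [map_mul, map_prod, map_pow, hφ.map_left, hφ.map_right]
        congr 1
        refine prod_congr rfl fun j _ => ?_
        rw [← zpow_natCast _ 2, ← zpow_natCast _ 2, zpow_comm]
    _ = _ := by
      rw [hsum, hD]
      have h3 : (∏ j, (Y j ^ 2 - (Y j ^ 2)⁻¹)) * ∏ j, (Y j + (Y j)⁻¹)⁻¹ =
          ∏ j, (Y j - (Y j)⁻¹) := by
        rw [← prod_mul_distrib]
        refine prod_congr rfl fun j _ => ?_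
        rw [mul_inv_eq_iff_eq_mul₀ (hY' j), ← inv_pow]
        ring
      simp only [inv_pow] at *
      rw [← h3]
      ring

lemma ospOdd_sign_sum (X Y : F) (hX : X ≠ 0) (hY : Y ≠ 0)
    (h : (X ^ 2 + X⁻¹ ^ 2) + (Y ^ 2 + Y⁻¹ ^ 2) ≠ 0) :
    (∑ c : ℤˣ, ∑ d : ℤˣ, ((c : ℤ) : F) * ((d : ℤ) : F) *
      (X ^ (c : ℤ) * (Y ^ (d : ℤ))⁻¹ + Y ^ (d : ℤ) * (X ^ (c : ℤ))⁻¹)⁻¹) =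
      2 * (X - X⁻¹) * (Y - Y⁻¹) * ((X ^ 2 + X⁻¹ ^ 2) + (Y ^ 2 + Y⁻¹ ^ 2))⁻¹ := by
  have h1 : (X * Y⁻¹ + Y * X⁻¹) * (X * Y + X⁻¹ * Y⁻¹) =
      (X ^ 2 + X⁻¹ ^ 2) + (Y ^ 2 + Y⁻¹ ^ 2) := by
    field_simp
    ring
  have h2 : X * Y⁻¹ + Y * X⁻¹ ≠ 0 := fun h0 => h (by rw [← h1, h0, zero_mul])
  have h3 : X * Y + X⁻¹ * Y⁻¹ ≠ 0 := fun h0 => h (by rw [← h1, h0, mul_zero])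
  simp only [sum_units_int, Units.val_one, Units.val_neg, zpow_one, zpow_neg, inv_inv, Int.cast_one,
    Int.cast_neg]
  have e2 : X * Y + Y⁻¹ * X⁻¹ = X * Y + X⁻¹ * Y⁻¹ := by ring
  have e3 : X⁻¹ * Y⁻¹ + Y * X = X * Y + X⁻¹ * Y⁻¹ := by ring
  have e4 : X⁻¹ * Y + Y⁻¹ * X = X * Y⁻¹ + Y * X⁻¹ := by ring
  rw [e2, e3, e4, ← h1, mul_inv]
  have e5 : 2 * (X - X⁻¹) * (Y - Y⁻¹) =
      2 * ((X * Y + X⁻¹ * Y⁻¹) - (X * Y⁻¹ + Y * X⁻¹)) := by ring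
  rw [e5]
  generalize X * Y⁻¹ + Y * X⁻¹ = A at h2 ⊢
  generalize X * Y + X⁻¹ * Y⁻¹ = B at h3 ⊢
  field_simp
  ring

lemma sum_ospOdd_kw {s : ℕ} {φ : SPerm s s → F →+* F} {X Y : Fin s → F}
    (hφ : SignedAction φ X Y) (hX : ∀ i, X i ≠ 0) (hY : ∀ j, Y j ≠ 0)
    (h : ∀ i j, (X i ^ 2 + (X i)⁻¹ ^ 2) + (Y j ^ 2 + (Y j)⁻¹ ^ 2) ≠ 0) :
    ∑ g ∈ weyl s s .ospOdd, ((g.sgn : ℤ) : F) *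
        φ g (∏ i, (X i * (Y i)⁻¹ + Y i * (X i)⁻¹)⁻¹) =
      2 ^ s * s.factorial * ((∏ i, (X i - (X i)⁻¹)) * (∏ j, (Y j - (Y j)⁻¹)) *
        (descVand (fun i => X i ^ 2 + (X i)⁻¹ ^ 2) * descVand (fun j => Y j ^ 2 + (Y j)⁻¹ ^ 2) *
          ∏ i, ∏ j, ((X i ^ 2 + (X i)⁻¹ ^ 2) + (Y j ^ 2 + (Y j)⁻¹ ^ 2))⁻¹)) := by
  have h1 := sum_perm_cauchy (fun i => X i ^ 2 + (X i)⁻¹ ^ 2) (fun j => Y j ^ 2 + (Y j)⁻¹ ^ 2) h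
  have hw : weyl s s .ospOdd = univ := rfl
  rw [hw, sum_sperm]
  have key (σ τ : Equiv.Perm (Fin s)) : ∑ a : Fin s → ℤˣ, ∑ b : Fin s → ℤˣ,
      (((SPerm.sgn ((σ, a), (τ, b)) : ℤˣ) : ℤ) : F) *
        φ ((σ, a), (τ, b)) (∏ i, (X i * (Y i)⁻¹ + Y i * (X i)⁻¹)⁻¹) =
      2 ^ s * (∏ i, (X i - (X i)⁻¹)) * (∏ j, (Y j - (Y j)⁻¹)) *
      (((Equiv.Perm.sign σ : ℤ) : F) * ((Equiv.Perm.sign τ : ℤ) : F) *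
        ∏ j, ((X (σ j) ^ 2 + (X (σ j))⁻¹ ^ 2) + (Y (τ j) ^ 2 + (Y (τ j))⁻¹ ^ 2))⁻¹) := by
    have h2 := sum_signs (fun i (c : ℤˣ) => ∑ d : ℤˣ, ((c : ℤ) : F) * ((d : ℤ) : F) *
      (X (σ i) ^ (c : ℤ) * (Y (τ i) ^ (d : ℤ))⁻¹ + Y (τ i) ^ (d : ℤ) * (X (σ i) ^ (c : ℤ))⁻¹)⁻¹)
    rw [prod_congr rfl fun i _ => ospOdd_sign_sum (X (σ i)) (Y (τ i)) (hX _) (hY _) (h _ _)] at h2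
    simp only [prod_mul_distrib, prod_const, card_univ, Fintype.card_fin,
      Equiv.prod_comp σ (fun i => X i - (X i)⁻¹), Equiv.prod_comp τ (fun i => Y i - (Y i)⁻¹)] at h2
    calc _ = ((Equiv.Perm.sign σ : ℤ) : F) * ((Equiv.Perm.sign τ : ℤ) : F) *
        ∑ a : Fin s → ℤˣ, ∏ i, ∑ d : ℤˣ, ((a i : ℤ) : F) * ((d : ℤ) : F) *
        (X (σ i) ^ (a i : ℤ) * (Y (τ i) ^ (d : ℤ))⁻¹ +
          Y (τ i) ^ (d : ℤ) * (X (σ i) ^ (a i : ℤ))⁻¹)⁻¹ := by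
          rw [mul_sum]
          refine sum_congr rfl fun a _ => ?_
          have h3 := sum_signs (fun i (d : ℤˣ) => ((a i : ℤ) : F) * ((d : ℤ) : F) *
            (X (σ i) ^ (a i : ℤ) * (Y (τ i) ^ (d : ℤ))⁻¹ +
              Y (τ i) ^ (d : ℤ) * (X (σ i) ^ (a i : ℤ))⁻¹)⁻¹)
          rw [← h3, mul_sum]
          refine sum_congr rfl fun b _ => ?_
          simp only [map_mul, map_prod, map_inv₀, map_add, hφ.map_left, hφ.map_right, SPerm.sgn,
            prod_mul_distrib]
          push_cast
          ring
      _ = _ := by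
        rw [h2]
        ring
  simp_rw [key, ← mul_sum]
  rw [h1]
  ring

/-! #### Even orthosymplectic case -/

lemma sum_weyl_ospEven {p q : ℕ} {M : Type*} [AddCommMonoid M] (f : SPerm p q → M) :
    ∑ g ∈ weyl p q .ospEven, f g =
      ∑ σ : Equiv.Perm (Fin p), ∑ τ : Equiv.Perm (Fin q),
        ∑ a ∈ univ.filter (fun a : Fin p → ℤˣ => ∏ i, a i = 1),
          ∑ b : Fin q → ℤˣ, f ((σ, a), (τ, b)) := by
  have hw : weyl p q .ospEven = univ.filter fun w => ∏ i, w.1.2 i = 1 := rfl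
  rw [hw, sum_filter, sum_sperm]
  refine sum_congr rfl fun σ _ => sum_congr rfl fun τ _ => ?_
  rw [sum_filter]
  refine sum_congr rfl fun a _ => ?_
  by_cases h : ∏ i, a i = 1 <;> simp [h]

lemma sum_even_signs_zpow {p : ℕ} (x : Fin (p + 1) → F) (k : Fin (p + 1) → ℕ)
    (hk : k (Fin.last p) = 0) :
    2 * ∑ a ∈ univ.filter (fun a : Fin (p + 1) → ℤˣ => ∏ i, a i = 1),
      ∏ i, (x i ^ (a i : ℤ)) ^ k i = ∏ i, (x i ^ k i + (x i)⁻¹ ^ k i) := by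
  rw [two_mul_sum_even_signs (Fin.last p)]
  · rw [sum_signs (fun i (c : ℤˣ) => (x i ^ (c : ℤ)) ^ k i)]
    refine prod_congr rfl fun i _ => ?_
    simp
  · intro a
    refine prod_congr rfl fun i _ => ?_
    by_cases hi : i = Fin.last p
    · subst hi; simp [hk]
    · rw [Function.update_of_ne hi]

lemma sum_ospEven_euler [CharZero F] {p q : ℕ} {φ : SPerm (p + 1) q → F →+* F}
    {x : Fin (p + 1) → F} {y : Fin q → F}
    (hφ : SignedAction φ x y) (hx : ∀ i, x i ≠ 0) (hy : ∀ j, y j ≠ 0) :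
    ∑ g ∈ weyl (p + 1) q .ospEven, ((g.sgn : ℤ) : F) * φ g ((∏ i, x i ^ (Fin.rev i : ℕ)) *
        (∏ j, y j ^ ((Fin.rev j : ℕ) + 1)) *
          ∏ i, ∏ j, ((x i + (x i)⁻¹) + (y j + (y j)⁻¹))⁻¹) =
      (∏ j, (y j - (y j)⁻¹)) *
        (descVand (fun i => x i + (x i)⁻¹) * descVand (fun j => y j + (y j)⁻¹) *
          ∏ i, ∏ j, ((x i + (x i)⁻¹) + (y j + (y j)⁻¹))⁻¹) := by
  set D : F := ∏ i, ∏ j, ((x i + (x i)⁻¹) + (y j + (y j)⁻¹))⁻¹ with hD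
  have hDinv (g : SPerm (p + 1) q) : φ g D = D := by
    have h2 (x : F) (c : ℤˣ) := zpow_unit_add_inv x c 1
    simp only [pow_one] at h2
    simp only [hD, map_prod, map_inv₀, map_add, hφ.map_left, hφ.map_right, h2]
    rw [prod_prod_perm g.1.1 g.2.1 (fun i j => ((x i + (x i)⁻¹) + (y j + (y j)⁻¹))⁻¹)]
  have hd := det_typeD x hx
  have hc := det_typeC y hy
  rw [Matrix.det_apply'] at hd hc
  simp only [Matrix.of_apply] at hd hc
  refine mul_left_cancel₀ (two_ne_zero (α := F)) ?_
  calc _ = (∑ σ : Equiv.Perm (Fin (p + 1)), ((Equiv.Perm.sign σ : ℤ) : F) *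
        ∏ i, (x (σ i) ^ (Fin.rev i : ℕ) + (x (σ i))⁻¹ ^ (Fin.rev i : ℕ))) *
      (∑ τ : Equiv.Perm (Fin q), ((Equiv.Perm.sign τ : ℤ) : F) *
        ∏ j, (y (τ j) ^ ((Fin.rev j : ℕ) + 1) - (y (τ j))⁻¹ ^ ((Fin.rev j : ℕ) + 1))) * D := by
        rw [sum_weyl_ospEven, sum_mul_sum, sum_mul, mul_sum]
        refine sum_congr rfl fun σ _ => ?_
        rw [sum_mul, mul_sum]
        refine sum_congr rfl fun τ _ => ?_
        rw [← sum_even_signs_zpow (fun i => x (σ i)) (fun i => (Fin.rev i : ℕ)) (by simp),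
          ← sum_signs_zpow (fun j => y (τ j)) (fun j => (Fin.rev j : ℕ) + 1)]
        simp only [mul_sum, sum_mul]
        rw [Finset.sum_comm]
        refine sum_congr rfl fun b _ => sum_congr rfl fun a ha => ?_
        have ha' : ∏ i, a i = 1 := by simpa using ha
        rw [map_mul, hDinv]
        simp only [map_mul, map_prod, map_pow, hφ.map_left, hφ.map_right, SPerm.sgn, ha', mul_one]
        push_cast
        ring
    _ = _ := by
      rw [hd, hc]
      ring

lemma ospEven_sign_sum (x y : F) (hx : x ≠ 0) (hy : y ≠ 0) (c : ℤˣ)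
    (h : (x + x⁻¹) + (y + y⁻¹) ≠ 0) :
    (∑ d : ℤˣ, ((d : ℤ) : F) * (1 + x ^ (c : ℤ) * (y ^ (d : ℤ))⁻¹)⁻¹) =
      (y - y⁻¹) * ((x + x⁻¹) + (y + y⁻¹))⁻¹ := by
  have key (z : F) (hz : z ≠ 0) (h : (z + z⁻¹) + (y + y⁻¹) ≠ 0) :
      (1 + z * y⁻¹)⁻¹ - (1 + z * y)⁻¹ = (y - y⁻¹) * ((z + z⁻¹) + (y + y⁻¹))⁻¹ := by
    have h1 : (1 + z * y⁻¹) * (1 + z * y) = z * ((z + z⁻¹) + (y + y⁻¹)) := by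
      field_simp
      ring
    have h2 : 1 + z * y⁻¹ ≠ 0 := fun h0 => by
      rw [h0, zero_mul] at h1; exact (mul_ne_zero hz h) h1.symm
    have h3 : 1 + z * y ≠ 0 := fun h0 => by
      rw [h0, mul_zero] at h1; exact (mul_ne_zero hz h) h1.symm
    have h4 : (z + z⁻¹) + (y + y⁻¹) = (1 + z * y⁻¹) * (1 + z * y) * z⁻¹ := by
      rw [h1]; field_simp
    rw [h4, inv_sub_inv h2 h3, mul_inv, inv_inv, div_eq_mul_inv]
    ring
  have h5 := key (x ^ (c : ℤ)) (zpow_ne_zero _ hx)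
  have h6 := zpow_unit_add_inv x c 1
  simp only [pow_one] at h6
  rw [h6] at h5
  simp only [sum_units_int, Units.val_one, Units.val_neg, zpow_one, zpow_neg, inv_inv, Int.cast_one,
    Int.cast_neg, one_mul, neg_mul]
  rw [← h5 h, sub_eq_add_neg]

lemma sum_ospEven_kw [CharZero F] {p q : ℕ} {φ : SPerm (p + 1) q → F →+* F}
    {x : Fin (p + 1) → F} {y : Fin q → F}
    (hφ : SignedAction φ x y) (hx : ∀ i, x i ≠ 0) (hy : ∀ j, y j ≠ 0)
    (h : ∀ i j, (x i + (x i)⁻¹) + (y j + (y j)⁻¹) ≠ 0) (κ : Fin q → Fin (p + 1)) (N : F)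
    (hκ : ∑ σ : Equiv.Perm (Fin (p + 1)), ∑ τ : Equiv.Perm (Fin q),
      ((Equiv.Perm.sign σ : ℤ) : F) * ((Equiv.Perm.sign τ : ℤ) : F) *
        ∏ j, ((x (σ (κ j)) + (x (σ (κ j)))⁻¹) + (y (τ j) + (y (τ j))⁻¹))⁻¹ = N) :
    ∑ g ∈ weyl (p + 1) q .ospEven, ((g.sgn : ℤ) : F) *
        φ g (∏ j, (1 + x (κ j) * (y j)⁻¹)⁻¹) = 2 ^ p * ((∏ j, (y j - (y j)⁻¹)) * N) := by
  refine mul_left_cancel₀ (two_ne_zero (α := F)) ?_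
  rw [sum_weyl_ospEven, ← hκ]
  simp only [mul_sum]
  refine sum_congr rfl fun σ _ => sum_congr rfl fun τ _ => ?_
  have h1 (a : Fin (p + 1) → ℤˣ) (ha : ∏ i, a i = 1) : ∑ b : Fin q → ℤˣ,
      2 * ((((SPerm.sgn ((σ, a), (τ, b)) : ℤˣ) : ℤ) : F) *
        φ ((σ, a), (τ, b)) (∏ j, (1 + x (κ j) * (y j)⁻¹)⁻¹)) =
      2 * (((Equiv.Perm.sign σ : ℤ) : F) * ((Equiv.Perm.sign τ : ℤ) : F) *
        ((∏ j, (y j - (y j)⁻¹)) *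
          ∏ j, ((x (σ (κ j)) + (x (σ (κ j)))⁻¹) + (y (τ j) + (y (τ j))⁻¹))⁻¹)) := by
    have h2 := sum_signs (fun j (d : ℤˣ) => ((d : ℤ) : F) *
      (1 + x (σ (κ j)) ^ (a (κ j) : ℤ) * (y (τ j) ^ (d : ℤ))⁻¹)⁻¹)
    rw [prod_congr rfl fun j _ => ospEven_sign_sum (x (σ (κ j))) (y (τ j)) (hx _) (hy _)
      (a (κ j)) (h _ _), prod_mul_distrib, Equiv.prod_comp τ (fun j => y j - (y j)⁻¹)] at h2
    rw [← h2, mul_sum, mul_sum]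
    refine sum_congr rfl fun b _ => ?_
    simp only [map_mul, map_prod, map_inv₀, map_add, map_one, hφ.map_left, hφ.map_right, SPerm.sgn,
      prod_mul_distrib, ha]
    push_cast
    ring
  rw [sum_congr rfl fun a ha => h1 a (by simpa using ha), ← mul_sum,
    two_mul_sum_even_signs 0 _ (fun _ => rfl), sum_const, card_univ, Fintype.card_fun,
    Fintype.card_fin, Fintype.card_units_int, nsmul_eq_mul]
  push_cast
  ring

end SignedSums

/-! ### Exponentials and alternating sums -/

section Exponentials

variable {m n : ℕ}

instance : CharZero (Frac m n) := algebraRat.charZero (Frac m n)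

lemma ex_add (μ ν : Wt m n) : ex (μ + ν) = ex μ * ex ν := by
  simp only [ex]
  rw [← map_mul, AddMonoidAlgebra.single_mul_single, one_mul]

@[simp] lemma ex_zero : ex (0 : Wt m n) = 1 := by
  simp only [ex]
  rw [← AddMonoidAlgebra.one_def, map_one]

lemma ex_ne_zero (μ : Wt m n) : ex μ ≠ 0 := by
  intro h
  have h1 := ex_add μ (-μ)
  rw [add_neg_cancel, ex_zero, h, zero_mul] at h1
  exact one_ne_zero h1

lemma ex_neg (μ : Wt m n) : ex (-μ) = (ex μ)⁻¹ := by
  refine eq_inv_of_mul_eq_one_left ?_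
  rw [← ex_add, neg_add_cancel, ex_zero]

lemma ex_sub (μ ν : Wt m n) : ex (μ - ν) = ex μ * (ex ν)⁻¹ := by
  rw [sub_eq_add_neg, ex_add, ex_neg]

lemma ex_sum {ι : Type*} (t : Finset ι) (f : ι → Wt m n) : ex (∑ i ∈ t, f i) = ∏ i ∈ t, ex (f i) := by
  classical
  induction t using Finset.induction_on with
  | empty => simp
  | insert a t ha ih => rw [sum_insert ha, prod_insert ha, ex_add, ih]

lemma ex_injective : Function.Injective (ex : Wt m n → Frac m n) := by
  intro μ ν h
  have h1 := IsFractionRing.injective (AddMonoidAlgebra ℚ (Wt m n)) (Frac m n) h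
  exact (AddMonoidAlgebra.single_left_inj one_ne_zero).1 h1

lemma one_add_ex_ne_zero (μ : Wt m n) : 1 + ex μ ≠ 0 := by
  intro h
  have h0 : algebraMap (AddMonoidAlgebra ℚ (Wt m n)) (Frac m n)
      (AddMonoidAlgebra.single 0 1 + AddMonoidAlgebra.single μ 1) =
        algebraMap (AddMonoidAlgebra ℚ (Wt m n)) (Frac m n) 0 := by
    rw [map_add, map_zero, ← h, ← ex_zero]
    rfl
  have h1 := IsFractionRing.injective (AddMonoidAlgebra ℚ (Wt m n)) (Frac m n) h0
  have h2 := congrArg (fun f : AddMonoidAlgebra ℚ (Wt m n) => f.coeff 0) h1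
  by_cases hμ : μ = 0
  · simp [hμ] at h2
  · simp [hμ] at h2

lemma one_sub_ex_ne_zero {μ : Wt m n} (hμ : μ ≠ 0) : 1 - ex μ ≠ 0 := by
  intro h
  rw [sub_eq_zero, ← ex_zero] at h
  exact hμ (ex_injective h).symm

lemma actFrac_ex (w : SPerm m n) (μ : Wt m n) : w.actFrac (ex μ) = ex (w.act μ) := by
  simp only [SPerm.actFrac, ex]
  rw [IsFractionRing.ringEquivOfRingEquiv_algebraMap]
  congr 1
  exact AddMonoidAlgebra.domCongr_single (R := ℚ) (A := ℚ) w.act μ 1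

/-- The composition of signed permutations. -/
def SPerm.comp (w g : SPerm m n) : SPerm m n :=
  ((w.1.1 * g.1.1, fun i => w.1.2 (g.1.1 i) * g.1.2 i),
    (w.2.1 * g.2.1, fun j => w.2.2 (g.2.1 j) * g.2.2 j))

lemma SPerm.act_comp (w g : SPerm m n) (μ : Wt m n) :
    (w.comp g).act μ = w.act (g.act μ) := by
  funext k
  rcases k with i | j <;> simp [SPerm.act, SPerm.comp, Equiv.Perm.mul_def, mul_assoc]

lemma ringHom_ext_ex {A : Type*} [Field A] (f g : Frac m n →+* A) (h : ∀ μ, f (ex μ) = g (ex μ)) :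
    f = g := by
  refine IsLocalization.ringHom_ext (nonZeroDivisors (AddMonoidAlgebra ℚ (Wt m n))) ?_
  refine AddMonoidAlgebra.ringHom_ext ?_ ?_
  · intro r
    have h1 : f.comp ((algebraMap (AddMonoidAlgebra ℚ (Wt m n)) (Frac m n)).comp
        (AddMonoidAlgebra.singleZeroRingHom (R := ℚ) (M := Wt m n))) =
        g.comp ((algebraMap (AddMonoidAlgebra ℚ (Wt m n)) (Frac m n)).comp
        (AddMonoidAlgebra.singleZeroRingHom (R := ℚ) (M := Wt m n))) := Subsingleton.elim _ _
    exact congrArg (fun φ : ℚ →+* A => φ r) h1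
  · intro μ
    exact h μ

lemma SPerm.actFrac_comp (w g : SPerm m n) (P : Frac m n) :
    (w.comp g).actFrac P = w.actFrac (g.actFrac P) := by
  have h : ((w.comp g).actFrac : Frac m n →+* Frac m n) =
      (w.actFrac : Frac m n →+* Frac m n).comp (g.actFrac : Frac m n →+* Frac m n) := by
    refine ringHom_ext_ex _ _ fun μ => ?_
    simp only [RingHom.coe_coe, RingHom.comp_apply, actFrac_ex, SPerm.act_comp]
  exact congrArg (fun φ : Frac m n →+* Frac m n => φ P) h

lemma SPerm.sgn_comp (w g : SPerm m n) : (w.comp g).sgn = w.sgn * g.sgn := by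
  simp only [SPerm.sgn, SPerm.comp, Equiv.Perm.sign_mul, prod_mul_distrib,
    Equiv.prod_comp g.1.1 w.1.2, Equiv.prod_comp g.2.1 w.2.2]
  ac_rfl

lemma SPerm.comp_mem_weyl {k : Kind} {w g : SPerm m n} (hw : w ∈ weyl m n k)
    (hg : g ∈ weyl m n k) : w.comp g ∈ weyl m n k := by
  cases k with
  | gl =>
    simp only [weyl, mem_filter, mem_univ, true_and] at *
    simp only [SPerm.comp, hw.1, hw.2, hg.1, hg.2]
    constructor <;> rfl
  | ospEven =>
    simp only [weyl, mem_filter, mem_univ, true_and] at *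
    simp only [SPerm.comp, prod_mul_distrib, Equiv.prod_comp g.1.1 w.1.2, hw, hg, one_mul]
  | ospOdd => exact mem_univ _

lemma SPerm.comp_left_injective (g : SPerm m n) :
    Function.Injective fun w : SPerm m n => w.comp g := by
  rintro ⟨⟨σ, a⟩, ⟨τ, b⟩⟩ ⟨⟨σ', a'⟩, ⟨τ', b'⟩⟩ h
  simp only [SPerm.comp, Prod.mk.injEq, mul_left_inj] at h
  obtain ⟨⟨h1, h2⟩, ⟨h3, h4⟩⟩ := h
  refine Prod.ext (Prod.ext h1 ?_) (Prod.ext h3 ?_)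
  · funext i
    simpa using congrFun h2 (g.1.1.symm i)
  · funext j
    simpa using congrFun h4 (g.2.1.symm j)

/-- The alternating sum is multiplied by the sign, if the argument is moved by the Weyl group. -/
lemma jW_actFrac {k : Kind} {g : SPerm m n} (hg : g ∈ weyl m n k) (P : Frac m n) :
    jW k (((g.sgn : ℤ) : Frac m n) * g.actFrac P) = jW k P := by
  simp only [jW]
  refine Finset.sum_nbij (fun w => w.comp g) (fun w hw => SPerm.comp_mem_weyl hw hg)
    ((SPerm.comp_left_injective g).injOn) ?_ ?_
  · exact Finset.surjOn_of_injOn_of_card_le _ (fun w hw => SPerm.comp_mem_weyl hw hg)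
      ((SPerm.comp_left_injective g).injOn) le_rfl
  · intro w _
    rw [SPerm.actFrac_comp, SPerm.sgn_comp, map_mul, map_intCast]
    push_cast
    ring

lemma jW_sum {ι : Type*} (k : Kind) (t : Finset ι) (f : ι → Frac m n) :
    jW k (∑ i ∈ t, f i) = ∑ i ∈ t, jW k (f i) := by
  simp only [jW, map_sum, mul_sum]
  rw [Finset.sum_comm]

lemma jW_intCast_mul (k : Kind) (c : ℤ) (P : Frac m n) : jW k ((c : Frac m n) * P) = c * jW k P := by
  simp only [jW, mul_sum, map_mul, map_intCast]
  exact sum_congr rfl fun w _ => by ring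

variable {p q : ℕ}

/-- Signed permutations of some of the `ε_i` and `δ_j`, as signed permutations of all of them. -/
noncomputable def SPerm.embed (e : Fin p ↪ Fin m) (f : Fin q ↪ Fin n) (g : SPerm p q) :
    SPerm m n :=
  ((g.1.1.viaFintypeEmbedding e, Function.extend e g.1.2 1),
    (g.2.1.viaFintypeEmbedding f, Function.extend f g.2.2 1))

lemma prod_extend_one {M : Type*} [CommMonoid M] (e : Fin p ↪ Fin m) (a : Fin p → M) :
    ∏ i, Function.extend e a 1 i = ∏ i, a i := by
  classical
  rw [← Finset.prod_subset (Finset.subset_univ (univ.map e)), prod_map]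
  · exact prod_congr rfl fun i _ => e.injective.extend_apply _ _ _
  · intro i _ hi
    rw [Function.extend_apply' _ _ _ (fun ⟨a, ha⟩ => hi (mem_map.2 ⟨a, mem_univ _, ha⟩))]
    rfl

lemma SPerm.sgn_embed (e : Fin p ↪ Fin m) (f : Fin q ↪ Fin n) (g : SPerm p q) :
    (g.embed e f).sgn = g.sgn := by
  simp only [SPerm.sgn, SPerm.embed, Equiv.Perm.viaFintypeEmbedding_sign, prod_extend_one]

lemma SPerm.embed_mem_weyl {k : Kind} (e : Fin p ↪ Fin m) (f : Fin q ↪ Fin n) {g : SPerm p q}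
    (hg : g ∈ weyl p q k) : g.embed e f ∈ weyl m n k := by
  have h1 {p m : ℕ} (e : Fin p ↪ Fin m) : Function.extend e (1 : Fin p → ℤˣ) 1 = 1 := by
    funext i
    by_cases h : ∃ a, e a = i
    · obtain ⟨a, rfl⟩ := h
      rw [e.injective.extend_apply]; rfl
    · rw [Function.extend_apply' _ _ _ h]
  cases k with
  | gl =>
    simp only [weyl, mem_filter, mem_univ, true_and] at *
    simp only [SPerm.embed, hg.1, hg.2, h1, and_self]
  | ospEven =>
    simp only [weyl, mem_filter, mem_univ, true_and] at *
    simp only [SPerm.embed, prod_extend_one, hg]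
  | ospOdd => exact mem_univ _

lemma SPerm.act_single_inl (w : SPerm m n) (r : ℂ) (i : Fin m) :
    w.act (r • eps i) = ((w.1.2 i : ℤ) : ℂ) • r • eps (w.1.1 i) := by
  funext k
  rcases k with l | l
  · by_cases h : l = w.1.1 i
    · subst h; simp [SPerm.act, eps]
    · have h' : w.1.1.symm l ≠ i := fun h'' => h (by rw [← h'']; simp)
      simp [SPerm.act, eps, h, h']
  · simp [SPerm.act, eps]

lemma SPerm.act_single_inr (w : SPerm m n) (r : ℂ) (j : Fin n) :
    w.act (r • del j) = ((w.2.2 j : ℤ) : ℂ) • r • del (w.2.1 j) := by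
  funext k
  rcases k with l | l
  · simp [SPerm.act, del]
  · by_cases h : l = w.2.1 j
    · subst h; simp [SPerm.act, del]
    · have h' : w.2.1.symm l ≠ j := fun h'' => h (by rw [← h'']; simp)
      simp [SPerm.act, del, h, h']

lemma ex_unit_smul (c : ℤˣ) (μ : Wt m n) : ex (((c : ℤ) : ℂ) • μ) = ex μ ^ (c : ℤ) := by
  rcases Int.units_eq_one_or c with h | h <;> simp [h, ex_neg]

/-- The embedded signed permutations act on the exponentials of multiples of the `ε_i`, `δ_j`. -/
lemma signedAction_embed (e : Fin p ↪ Fin m) (f : Fin q ↪ Fin n) (r : ℂ) :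
    SignedAction (fun g : SPerm p q => ((g.embed e f).actFrac : Frac m n →+* Frac m n))
      (fun i => ex (r • eps (e i))) (fun j => ex (r • del (f j))) where
  map_left g i := by
    simp only [RingHom.coe_coe]
    rw [actFrac_ex, SPerm.act_single_inl, ex_unit_smul]
    simp only [SPerm.embed, e.injective.extend_apply, Equiv.Perm.viaFintypeEmbedding_apply_image]
  map_right g j := by
    simp only [RingHom.coe_coe]
    rw [actFrac_ex, SPerm.act_single_inr, ex_unit_smul]
    simp only [SPerm.embed, f.injective.extend_apply, Equiv.Perm.viaFintypeEmbedding_apply_image]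

/-- A weight which is zero on the moved coordinates, or constant where no signs occur,
is fixed. -/
lemma SPerm.act_embed_eq_self (e : Fin p ↪ Fin m) (f : Fin q ↪ Fin n) (g : SPerm p q)
    (ν : Wt m n) (c d : ℂ) (he : ∀ i, ν (Sum.inl (e i)) = c) (hf : ∀ j, ν (Sum.inr (f j)) = d)
    (hc : c = 0 ∨ g.1.2 = 1) (hd : d = 0 ∨ g.2.2 = 1) :
    (g.embed e f).act ν = ν := by
  have key {p m : ℕ} (e : Fin p ↪ Fin m) (σ : Equiv.Perm (Fin p)) (a : Fin p → ℤˣ)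
      (ν : Fin m → ℂ) (c : ℂ) (he : ∀ i, ν (e i) = c) (hc : c = 0 ∨ a = 1) (i : Fin m) :
      (((Function.extend e a 1 ((σ.viaFintypeEmbedding e).symm i) : ℤˣ) : ℤ) : ℂ) *
        ν ((σ.viaFintypeEmbedding e).symm i) = ν i := by
    obtain ⟨l, rfl⟩ := (σ.viaFintypeEmbedding e).surjective i
    rw [Equiv.symm_apply_apply]
    by_cases h : ∃ a, e a = l
    · obtain ⟨t, rfl⟩ := h
      rw [e.injective.extend_apply, Equiv.Perm.viaFintypeEmbedding_apply_image, he, he]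
      rcases hc with h | h <;> simp [h]
    · rw [Function.extend_apply' _ _ _ h, Equiv.Perm.viaFintypeEmbedding_apply_notMem_range]
      · simp
      · exact h
  funext k
  rcases k with i | j
  · exact key e g.1.1 g.1.2 (fun i => ν (Sum.inl i)) c he hc i
  · exact key f g.2.1 g.2.2 (fun j => ν (Sum.inr j)) d hf hd j

lemma weyl_nonempty (p q : ℕ) (k : Kind) : (weyl p q k).Nonempty := by
  refine ⟨((1, 1), (1, 1)), ?_⟩
  cases k <;> simp [weyl]

/-- An identity between alternating sums over the Weyl group of a subalgebra implies one for the
whole Weyl group. -/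
lemma jW_eq_of_sum_embed {k : Kind} (e : Fin p ↪ Fin m) (f : Fin q ↪ Fin n) (ν : Wt m n)
    (hν : ∀ g ∈ weyl p q k, (g.embed e f).act ν = ν) (c : Frac m n) (hc : ∃ z : ℤ, (z : Frac m n) = c)
    (P Q : Frac m n)
    (h : c * ∑ g ∈ weyl p q k, ((g.sgn : ℤ) : Frac m n) * (g.embed e f).actFrac P =
      ∑ g ∈ weyl p q k, ((g.sgn : ℤ) : Frac m n) * (g.embed e f).actFrac Q) :
    c * jW k (ex ν * P) = jW k (ex ν * Q) := by
  obtain ⟨c, rfl⟩ := hc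
  have hsum (P : Frac m n) : ((weyl p q k).card : Frac m n) * jW k (ex ν * P) =
      jW k (ex ν * ∑ g ∈ weyl p q k, ((g.sgn : ℤ) : Frac m n) * (g.embed e f).actFrac P) := by
    have h1 : ∀ g ∈ weyl p q k, jW k (ex ν * (((g.sgn : ℤ) : Frac m n) *
        (g.embed e f).actFrac P)) = jW k (ex ν * P) := by
      intro g hg
      rw [← jW_actFrac (SPerm.embed_mem_weyl e f hg) (ex ν * P), map_mul, actFrac_ex, hν g hg,
        SPerm.sgn_embed]
      congr 1
      ring
    rw [mul_sum, jW_sum, sum_congr rfl h1, sum_const, nsmul_eq_mul]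
  have hcard : ((weyl p q k).card : Frac m n) ≠ 0 :=
    Nat.cast_ne_zero.2 (Finset.card_ne_zero.2 (weyl_nonempty p q k))
  refine mul_left_cancel₀ hcard ?_
  rw [hsum Q, ← h, mul_left_comm, hsum P, ← jW_intCast_mul]
  congr 1
  ring

end Exponentials

/-! ### Words and roots -/

section Words

lemma count_take_flatten_replicate {x y : Letter} (hxy : x ≠ y) (N k : ℕ) :
    (((List.replicate N [x, y]).flatten.take k).count x = min ((k + 1) / 2) N) ∧
    (((List.replicate N [x, y]).flatten.take k).count y = min (k / 2) N) := by
  induction N generalizing k with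
  | zero => simp
  | succ N ih =>
    rw [List.replicate_succ, List.flatten_cons]
    match k with
    | 0 => simp
    | 1 => simp [hxy]
    | k + 2 =>
      obtain ⟨h1, h2⟩ := ih k
      simp only [List.cons_append, List.nil_append, List.take_succ_cons, List.count_cons, h1, h2,
        beq_self_eq_true, if_true, beq_iff_eq, hxy, hxy.symm, if_false]
      omega

variable {m n : ℕ}

lemma precedes_stdWord_gl (i : Fin m) (j : Fin n) : Precedes (stdWord m n .gl) i j := by
  refine ⟨m, ?_, ?_⟩ <;> simp [stdWord, List.count_replicate]

lemma precedes_stdWord_ospEven (i : Fin m) (j : Fin n) :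
    Precedes (stdWord m n .ospEven) i j ↔ (i : ℕ) + n < j + m := by
  have hi := i.2
  have hj := j.2
  have hc := fun N k => count_take_flatten_replicate (x := .del) (y := .eps) (by decide) N k
  simp only [Precedes, stdWord, List.take_append, List.count_append, List.take_replicate,
    List.count_replicate, List.length_append, List.length_replicate, (hc _ _).1, (hc _ _).2]
  simp only [beq_self_eq_true, if_true, beq_iff_eq, reduceCtorEq, if_false]
  constructor
  · rintro ⟨k, h1, h2⟩
    omega
  · intro h
    by_cases hB : (i : ℕ) < m - n
    · exact ⟨i + 1, by omega, by omega⟩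
    · exact ⟨(n - m) + (m - n) + 2 * (i - (m - n) + 1), by omega, by omega⟩

lemma precedes_stdWord_ospOdd (i : Fin m) (j : Fin n) :
    Precedes (stdWord m n .ospOdd) i j ↔ (i : ℕ) + n ≤ j + m := by
  have hi := i.2
  have hj := j.2
  have hc := fun N k => count_take_flatten_replicate (x := .eps) (y := .del) (by decide) N k
  simp only [Precedes, stdWord, List.take_append, List.count_append, List.take_replicate,
    List.count_replicate, List.length_append, List.length_replicate, (hc _ _).1, (hc _ _).2]
  simp only [beq_self_eq_true, if_true, beq_iff_eq, reduceCtorEq, if_false]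
  constructor
  · rintro ⟨k, h1, h2⟩
    omega
  · intro h
    by_cases hB : (i : ℕ) < m - n
    · exact ⟨i + 1, by omega, by omega⟩
    · exact ⟨(n - m) + (m - n) + 2 * (i - (m - n)) + 1, by omega, by omega⟩

lemma precedes_wordL {s : ℕ} (hm : s ≤ m) (hn : s ≤ n) (i : Fin m) (j : Fin n) :
    Precedes (wordL m n s) i j ↔ (i : ℕ) + s ≤ m + j := by
  have hi := i.2
  have hj := j.2
  have hc := fun N k => count_take_flatten_replicate (x := .eps) (y := .del) (by decide) N k
  have hl (N : ℕ) : (List.replicate N [Letter.eps, Letter.del]).flatten.length = N * 2 := by simp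
  simp only [Precedes, wordL, List.take_append, List.count_append, List.take_replicate,
    List.count_replicate, List.length_append, List.length_replicate, (hc _ _).1, (hc _ _).2, hl]
  simp only [beq_self_eq_true, if_true, beq_iff_eq, reduceCtorEq, if_false]
  constructor
  · rintro ⟨k, h1, h2⟩
    omega
  · intro h
    by_cases hB : (i : ℕ) < m - s
    · exact ⟨i + 1, by omega, by omega⟩
    · exact ⟨(m - s) + 2 * (i - (m - s)) + 1, by omega, by omega⟩

end Words

section RootSums

variable {m n : ℕ}

@[simp] lemma eps_inl (i l : Fin m) : (eps i : Wt m n) (Sum.inl l) = if l = i then 1 else 0 := by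
  simp [eps, Pi.single_apply]

@[simp] lemma eps_inr (i : Fin m) (l : Fin n) : (eps i : Wt m n) (Sum.inr l) = 0 := by
  simp [eps]

@[simp] lemma del_inl (j : Fin n) (l : Fin m) : (del j : Wt m n) (Sum.inl l) = 0 := by
  simp [del]

@[simp] lemma del_inr (j l : Fin n) : (del j : Wt m n) (Sum.inr l) = if l = j then 1 else 0 := by
  simp [del, Pi.single_apply]

open Classical in
/-- The positive one of the two odd roots `±(ε_i - δ_j)`, for the base encoded by `w`. -/
noncomputable def diffRoot (w : List Letter) (i : Fin m) (j : Fin n) : Wt m n :=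
  if Precedes w i j then eps i - del j else del j - eps i

open Classical in
lemma diffRoot_inl (w : List Letter) (i l : Fin m) (j : Fin n) :
    diffRoot w i j (Sum.inl l) = if l = i then (if Precedes w i j then 1 else -1) else 0 := by
  by_cases h : l = i <;> by_cases h' : Precedes w i j <;> simp [diffRoot, h, h']

open Classical in
lemma diffRoot_inr (w : List Letter) (i : Fin m) (j l : Fin n) :
    diffRoot w i j (Sum.inr l) = if l = j then (if Precedes w i j then -1 else 1) else 0 := by
  by_cases h : l = j <;> by_cases h' : Precedes w i j <;> simp [diffRoot, h, h']

lemma diffRoot_inl_ne_zero (w : List Letter) (i l : Fin m) (j : Fin n) :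
    diffRoot w i j (Sum.inl l) ≠ 0 ↔ l = i := by
  rw [diffRoot_inl]
  split_ifs with h <;> simp [h]

lemma diffRoot_inr_ne_zero (w : List Letter) (i : Fin m) (j l : Fin n) :
    diffRoot w i j (Sum.inr l) ≠ 0 ↔ l = j := by
  rw [diffRoot_inr]
  split_ifs with h <;> simp [h]

lemma diffRoot_injective (w : List Letter) :
    Function.Injective fun x : Fin m × Fin n => diffRoot w x.1 x.2 := by
  rintro ⟨i, j⟩ ⟨i', j'⟩ h
  have h1 := (diffRoot_inl_ne_zero w i i j).2 rfl
  have h2 := (diffRoot_inr_ne_zero w i j j).2 rfl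
  simp only at h
  rw [h] at h1 h2
  rw [diffRoot_inl_ne_zero] at h1
  rw [diffRoot_inr_ne_zero] at h2
  rw [h1, h2]

lemma sumRoot_injective :
    Function.Injective fun x : Fin m × Fin n => (eps x.1 + del x.2 : Wt m n) := by
  rintro ⟨i, j⟩ ⟨i', j'⟩ h
  have h1 := congrFun h (Sum.inl i)
  have h2 := congrFun h (Sum.inr j)
  simp at h1 h2
  rw [h1, h2]

lemma eps_injective : Function.Injective (eps : Fin m → Wt m n) := by
  intro i i' h
  simpa using congrFun h (Sum.inl i)

lemma del_injective : Function.Injective (del : Fin n → Wt m n) := by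
  intro i i' h
  simpa using congrFun h (Sum.inr i)

lemma diffRoot_ne_sumRoot (w : List Letter) (i i' : Fin m) (j j' : Fin n) :
    diffRoot w i j ≠ eps i' + del j' := by
  intro h
  have h1 := (diffRoot_inl_ne_zero w i i j).2 rfl
  have h2 := (diffRoot_inr_ne_zero w i j j).2 rfl
  have h3 := diffRoot_inl w i i j
  have h4 := diffRoot_inr w i j j
  rw [h] at h1 h2 h3 h4
  simp at h1 h2
  subst h1 h2
  simp at h3 h4
  by_cases hp : Precedes w i j
  · have := h4 hp
    norm_num at this
  · have := h3 hp
    norm_num at this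

@[to_additive]
lemma prod_posOdd_gl {M : Type*} [CommMonoid M] (w : List Letter) (f : Wt m n → M) :
    ∏ α ∈ posOdd m n .gl w, f α = ∏ x : Fin m × Fin n, f (diffRoot w x.1 x.2) := by
  simp only [posOdd]
  rw [prod_image]
  · rfl
  · exact (diffRoot_injective w).injOn

@[to_additive]
lemma prod_posOdd_ospEven {M : Type*} [CommMonoid M] (w : List Letter) (f : Wt m n → M) :
    ∏ α ∈ posOdd m n .ospEven w, f α =
      (∏ x : Fin m × Fin n, f (diffRoot w x.1 x.2)) * ∏ x : Fin m × Fin n, f (eps x.1 + del x.2) := by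
  simp only [posOdd]
  rw [prod_union, prod_image, prod_image sumRoot_injective.injOn]
  · rfl
  · exact (diffRoot_injective w).injOn
  · rw [disjoint_left]
    intro α h1 h2
    rw [mem_image] at h1 h2
    obtain ⟨x, -, rfl⟩ := h1
    obtain ⟨y, -, h⟩ := h2
    exact diffRoot_ne_sumRoot w _ _ _ _ h.symm

@[to_additive]
lemma prod_posOdd_ospOdd {M : Type*} [CommMonoid M] (w : List Letter) (f : Wt m n → M) :
    ∏ α ∈ posOdd m n .ospOdd w, f α =
      (∏ x : Fin m × Fin n, f (diffRoot w x.1 x.2)) * (∏ x : Fin m × Fin n, f (eps x.1 + del x.2)) *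
        ∏ j, f (del j) := by
  have h0 : posOdd m n .ospOdd w = posOdd m n .ospEven w ∪
      univ.image (fun j : Fin n => (del j : Wt m n)) := by
    ext α; simp [posOdd]
  rw [h0, prod_union, prod_posOdd_ospEven, prod_image]
  · exact fun _ _ _ _ h => del_injective h
  rw [disjoint_left]
  intro α h1 h2
  simp only [posOdd, mem_union, mem_image, mem_univ, true_and] at h1 h2
  obtain ⟨j, rfl⟩ := h2
  rcases h1 with ⟨x, h⟩ | ⟨x, h⟩
  · have h1 := (diffRoot_inl_ne_zero w x.1 x.1 x.2).2 rfl
    refine h1 ?_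
    rw [diffRoot, h]
    simp
  · have h1 := congrFun h (Sum.inl x.1)
    simp at h1

lemma eps_sub_injOn :
    Set.InjOn (fun x : Fin m × Fin m => (eps x.1 - eps x.2 : Wt m n))
      (univ.filter fun x : Fin m × Fin m => x.1 < x.2) := by
  rintro ⟨i, i'⟩ hi ⟨k, k'⟩ hk h
  have h1 := congrFun h (Sum.inl i)
  have h2 := congrFun h (Sum.inl i')
  simp at h1 h2 hi hk
  grind

lemma del_sub_injOn :
    Set.InjOn (fun x : Fin n × Fin n => (del x.1 - del x.2 : Wt m n))
      (univ.filter fun x : Fin n × Fin n => x.1 < x.2) := by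
  rintro ⟨i, i'⟩ hi ⟨k, k'⟩ hk h
  have h1 := congrFun h (Sum.inr i)
  have h2 := congrFun h (Sum.inr i')
  simp at h1 h2 hi hk
  grind

lemma eps_add_injOn :
    Set.InjOn (fun x : Fin m × Fin m => (eps x.1 + eps x.2 : Wt m n))
      (univ.filter fun x : Fin m × Fin m => x.1 < x.2) := by
  rintro ⟨i, i'⟩ hi ⟨k, k'⟩ hk h
  have h1 := congrFun h (Sum.inl i)
  have h2 := congrFun h (Sum.inl i')
  simp at h1 h2 hi hk
  grind

lemma del_add_injOn :
    Set.InjOn (fun x : Fin n × Fin n => (del x.1 + del x.2 : Wt m n))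
      (univ.filter fun x : Fin n × Fin n => x.1 < x.2) := by
  rintro ⟨i, i'⟩ hi ⟨k, k'⟩ hk h
  have h1 := congrFun h (Sum.inr i)
  have h2 := congrFun h (Sum.inr i')
  simp at h1 h2 hi hk
  grind

lemma sum_posEven_ospEven {M : Type*} [AddCommMonoid M] (f : Wt m n → M) :
    ∑ α ∈ posEven m n .ospEven, f α =
      ∑ x ∈ univ.filter (fun x : Fin m × Fin m => x.1 < x.2), f (eps x.1 - eps x.2) +
      ∑ x ∈ univ.filter (fun x : Fin n × Fin n => x.1 < x.2), f (del x.1 - del x.2) +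
      ∑ x ∈ univ.filter (fun x : Fin m × Fin m => x.1 < x.2), f (eps x.1 + eps x.2) +
      ∑ x ∈ univ.filter (fun x : Fin n × Fin n => x.1 < x.2), f (del x.1 + del x.2) +
      ∑ j, f ((2 : ℂ) • del j) := by
  simp only [posEven]
  rw [sum_union, sum_union, sum_union, sum_union, sum_image eps_sub_injOn, sum_image del_sub_injOn,
    sum_image eps_add_injOn, sum_image del_add_injOn, sum_image]
  · intro j _ j' _ h
    simpa using congrFun h (Sum.inr j)
  all_goals
    rw [disjoint_left]
    intro α h1 h2
    simp only [mem_union, mem_image, mem_filter, mem_univ, true_and, Prod.exists] at h1 h2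
  · obtain ⟨i, i', hi, rfl⟩ := h1
    obtain ⟨k, k', hk, h⟩ := h2
    have h1 := congrFun h (Sum.inl i)
    simp [hi.ne] at h1
  · obtain ⟨k, k', hk, rfl⟩ := h2
    rcases h1 with ⟨i, i', hi, h⟩ | ⟨i, i', hi, h⟩
    · have h1 := congrFun h (Sum.inl i')
      simp [hi.ne'] at h1
      grind
    · have h1 := congrFun h (Sum.inl k)
      simp [hk.ne] at h1
  · obtain ⟨k, k', hk, rfl⟩ := h2
    rcases h1 with (⟨i, i', hi, h⟩ | ⟨i, i', hi, h⟩) | ⟨i, i', hi, h⟩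
    · have h1 := congrFun h (Sum.inr k)
      simp [hk.ne] at h1
    · have h1 := congrFun h (Sum.inr i')
      simp [hi.ne'] at h1
      grind
    · have h1 := congrFun h (Sum.inr k)
      simp [hk.ne] at h1
  · obtain ⟨k, rfl⟩ := h2
    rcases h1 with ((⟨i, i', hi, h⟩ | ⟨i, i', hi, h⟩) | ⟨i, i', hi, h⟩) | ⟨i, i', hi, h⟩
    · have h1 := congrFun h (Sum.inr k)
      simp at h1
    · have h1 := congrFun h (Sum.inr i')
      simp [hi.ne'] at h1
      grind
    · have h1 := congrFun h (Sum.inr k)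
      simp at h1
    · have h1 := congrFun h (Sum.inr i)
      simp [hi.ne] at h1
      grind

lemma sum_posEven_ospOdd {M : Type*} [AddCommMonoid M] (f : Wt m n → M) :
    ∑ α ∈ posEven m n .ospOdd, f α =
      ∑ α ∈ posEven m n .ospEven, f α + ∑ i, f (eps i) := by
  have h0 : posEven m n .ospOdd = posEven m n .ospEven ∪
      univ.image (fun i : Fin m => (eps i : Wt m n)) := by
    ext α; simp [posEven]
  rw [h0, sum_union, sum_image]
  · exact fun _ _ _ _ h => eps_injective h
  rw [disjoint_left]
  intro α h1 h2
  simp only [posEven, mem_union, mem_image, mem_filter, mem_univ, true_and, Prod.exists] at h1 h2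
  obtain ⟨k, rfl⟩ := h2
  rcases h1 with (((⟨i, i', hi, h⟩ | ⟨i, i', hi, h⟩) | ⟨i, i', hi, h⟩) | ⟨i, i', hi, h⟩) | ⟨i, h⟩
  · have h1 := congrFun h (Sum.inl i')
    simp [hi.ne'] at h1
    grind
  · have h1 := congrFun h (Sum.inl k)
    simp at h1
  · have h1 := congrFun h (Sum.inl i)
    have h2 := congrFun h (Sum.inl i')
    simp [hi.ne, hi.ne'] at h1 h2
    grind
  · have h1 := congrFun h (Sum.inl k)
    simp at h1
  · have h1 := congrFun h (Sum.inl k)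
    simp at h1

lemma card_fin_ge (N t : ℕ) : #{j : Fin N | t ≤ (j : ℕ)} = N - t := by
  have h : (univ.filter fun j : Fin N => t ≤ (j : ℕ)).map Fin.valEmbedding = Ico t N := by
    ext x
    simp only [mem_map, mem_filter, mem_univ, true_and, Fin.valEmbedding_apply, mem_Ico]
    constructor
    · rintro ⟨j, h1, rfl⟩; exact ⟨h1, j.2⟩
    · rintro ⟨h1, h2⟩; exact ⟨⟨x, h2⟩, h1, rfl⟩
  rw [← card_map Fin.valEmbedding, h, Nat.card_Ico]

lemma sum_pairs_eq {N : ℕ} (i : Fin N) :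
    ∑ x ∈ univ.filter (fun x : Fin N × Fin N => x.1 < x.2), (if i = x.1 then (1 : ℂ) else 0) =
      ((N - 1 - i : ℕ) : ℂ) := by
  have h := card_fin_ge N (i + 1)
  rw [sum_filter, Fintype.sum_prod_type, Finset.sum_eq_single i]
  · rw [Nat.sub_sub, Nat.add_comm 1, ← h, Finset.card_filter]
    push_cast
    refine sum_congr rfl fun j _ => ?_
    simp only [Fin.lt_def, Nat.succ_le_iff, if_true]
  · intro b _ hb
    simp [hb.symm]
  · simp

lemma half_sum_posEven_ospEven_inl (i : Fin m) :
    ((1 / 2 : ℂ) • ∑ α ∈ posEven m n .ospEven, α) (Sum.inl i) = ((m - 1 - i : ℕ) : ℂ) := by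
  rw [sum_posEven_ospEven, ← sum_pairs_eq i]
  simp only [Pi.smul_apply, Pi.add_apply, Finset.sum_apply, Pi.sub_apply, eps_inl, del_inl,
    sub_self, add_zero, sum_const_zero, smul_eq_mul, mul_zero]
  rw [← sum_add_distrib, mul_sum]
  exact sum_congr rfl fun x _ => by ring

lemma half_sum_posEven_ospEven_inr (j : Fin n) :
    ((1 / 2 : ℂ) • ∑ α ∈ posEven m n .ospEven, α) (Sum.inr j) = ((n - j : ℕ) : ℂ) := by
  have h0 : n - j = (n - 1 - j) + 1 := by omega
  rw [sum_posEven_ospEven, h0, Nat.cast_add, ← sum_pairs_eq j]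
  simp only [Pi.smul_apply, Pi.add_apply, Finset.sum_apply, Pi.sub_apply, eps_inr, del_inr,
    sub_self, add_zero, zero_add, sum_const_zero, smul_eq_mul]
  rw [← sum_add_distrib, mul_add, mul_sum]
  congr 1
  · exact sum_congr rfl fun x _ => by ring
  · simp

open Classical in
lemma rho1_ospEven_inl (w : List Letter) (i : Fin m) :
    rho1 m n .ospEven w (Sum.inl i) = #{j : Fin n | Precedes w i j} := by
  rw [rho1, sum_posOdd_ospEven]
  simp only [Pi.smul_apply, Pi.add_apply, Finset.sum_apply, diffRoot_inl, eps_inl, del_inl,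
    add_zero, smul_eq_mul]
  rw [← sum_add_distrib, Fintype.sum_prod_type, Finset.sum_eq_single i, mul_sum, card_filter]
  · push_cast
    refine sum_congr rfl fun j _ => ?_
    by_cases h : Precedes w i j <;> simp [h]
    norm_num
  · intro b _ hb
    simp [hb.symm]
  · simp

open Classical in
lemma rho1_ospEven_inr (w : List Letter) (j : Fin n) :
    rho1 m n .ospEven w (Sum.inr j) = #{i : Fin m | ¬ Precedes w i j} := by
  rw [rho1, sum_posOdd_ospEven]
  simp only [Pi.smul_apply, Pi.add_apply, Finset.sum_apply, diffRoot_inr, eps_inr, del_inr,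
    zero_add, smul_eq_mul]
  rw [← sum_add_distrib, Fintype.sum_prod_type_right, Finset.sum_eq_single j, mul_sum, card_filter]
  · push_cast
    refine sum_congr rfl fun i _ => ?_
    by_cases h : Precedes w i j <;> simp [h]
    norm_num
  · intro b _ hb
    simp [hb.symm]
  · simp

lemma rho1_ospOdd (w : List Letter) :
    rho1 m n .ospOdd w = rho1 m n .ospEven w + (1 / 2 : ℂ) • ∑ j, del j := by
  rw [rho1, rho1, sum_posOdd_ospEven, sum_posOdd_ospOdd, smul_add]

lemma rho_ospEven_inl (i : Fin m) :
    rho m n .ospEven (Sum.inl i) = ((m - 1 - i - n : ℕ) : ℂ) := by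
  have h : #{j : Fin n | (i : ℕ) + n < j + m} = n - (i + n + 1 - m) := by
    rw [← card_fin_ge]
    congr 1
    ext j
    simp only [mem_filter, mem_univ, true_and]
    omega
  simp only [rho, Pi.sub_apply]
  rw [half_sum_posEven_ospEven_inl, rho1_ospEven_inl]
  simp only [precedes_stdWord_ospEven]
  rw [h, sub_eq_iff_eq_add, ← Nat.cast_add]
  congr 1
  omega

lemma rho_ospEven_inr (j : Fin n) :
    rho m n .ospEven (Sum.inr j) = ((n - j - m : ℕ) : ℂ) := by
  have h : #{i : Fin m | ¬ ((i : ℕ) + n < j + m)} = m - (j + m - n) := by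
    rw [← card_fin_ge]
    congr 1
    ext i
    simp only [mem_filter, mem_univ, true_and]
    omega
  simp only [rho, Pi.sub_apply]
  rw [half_sum_posEven_ospEven_inr, rho1_ospEven_inr]
  simp only [precedes_stdWord_ospEven]
  rw [h, sub_eq_iff_eq_add, ← Nat.cast_add]
  congr 1
  omega

lemma rho_ospOdd_inl (i : Fin m) (hi : m ≤ i + n) :
    rho m n .ospOdd (Sum.inl i) = -(1 / 2) := by
  have h : #{j : Fin n | (i : ℕ) + n ≤ j + m} = n - (i + n - m) := by
    rw [← card_fin_ge]
    congr 1
    ext j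
    simp only [mem_filter, mem_univ, true_and]
    omega
  have h2 : n - (i + n - m) = (m - 1 - i) + 1 := by omega
  have h3 := half_sum_posEven_ospEven_inl (n := n) i
  simp only [rho, Pi.sub_apply, rho1_ospOdd, sum_posEven_ospOdd, smul_add, Pi.add_apply]
  rw [h3, rho1_ospEven_inl]
  simp only [precedes_stdWord_ospOdd, Pi.smul_apply, Finset.sum_apply, eps_inl, del_inl]
  rw [h, h2]
  push_cast
  simp
  ring

lemma rho_ospOdd_inr (j : Fin n) (hj : n ≤ j + m) :
    rho m n .ospOdd (Sum.inr j) = 1 / 2 := by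
  have h : #{i : Fin m | ¬ ((i : ℕ) + n ≤ j + m)} = m - (j + m + 1 - n) := by
    rw [← card_fin_ge]
    congr 1
    ext i
    simp only [mem_filter, mem_univ, true_and]
    omega
  have h2 : n - j = (m - (j + m + 1 - n)) + 1 := by omega
  have h3 := half_sum_posEven_ospEven_inr (m := m) j
  simp only [rho, Pi.sub_apply, rho1_ospOdd, sum_posEven_ospOdd, smul_add, Pi.add_apply]
  rw [h3, rho1_ospEven_inr]
  simp only [precedes_stdWord_ospOdd, Pi.smul_apply, Finset.sum_apply, eps_inr, del_inr]
  rw [h, h2]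
  push_cast
  simp
  ring

end RootSums

/-! ### Products over the roots of equal rank subalgebras -/

section Sub

variable {m n p q : ℕ}

/-- The embedding of the last `p` indices. -/
def lastEmb (h : p ≤ m) : Fin p ↪ Fin m where
  toFun i := ⟨i + (m - p), by omega⟩
  inj' i j hij := by
    simp only [Fin.mk.injEq] at hij
    exact Fin.ext (by omega)

@[simp] lemma val_lastEmb (h : p ≤ m) (i : Fin p) : (lastEmb h i : ℕ) = i + (m - p) := rfl

lemma mem_range_lastEmb (h : p ≤ m) (i : Fin m) : i ∈ Set.range (lastEmb h) ↔ m ≤ i + p := by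
  constructor
  · rintro ⟨k, rfl⟩
    rw [val_lastEmb]
    omega
  · intro hi
    exact ⟨⟨i - (m - p), by omega⟩, Fin.ext (by rw [val_lastEmb]; simp only; omega)⟩

lemma mem_range_castLEEmb (h : p ≤ m) (i : Fin m) :
    i ∈ Set.range (Fin.castLEEmb h) ↔ (i : ℕ) < p := by
  constructor
  · rintro ⟨k, rfl⟩
    simp
  · intro hi
    exact ⟨⟨i, hi⟩, by ext; simp⟩

open Classical in
lemma prod_ite_mem_range {M : Type*} [CommMonoid M] (e : Fin p ↪ Fin m) (F : Fin m → M) :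
    ∏ i, (if i ∈ Set.range e then F i else 1) = ∏ i, F (e i) := by
  rw [← prod_filter, ← prod_map univ e F]
  congr 1
  ext i
  simp

open Classical in
lemma prod_ite_mem_range_prod {M : Type*} [CommMonoid M] (e : Fin p ↪ Fin m) (f : Fin q ↪ Fin n)
    (F : Fin m → Fin n → M) :
    ∏ x : Fin m × Fin n, (if x.1 ∈ Set.range e ∧ x.2 ∈ Set.range f then F x.1 x.2 else 1) =
      ∏ i, ∏ j, F (e i) (f j) := by
  rw [Fintype.prod_prod_type, ← prod_ite_mem_range e (fun i => ∏ j, F i (f j))]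
  refine prod_congr rfl fun i _ => ?_
  rw [← prod_ite_mem_range f (F i)]
  by_cases h : i ∈ Set.range e
  · simp only [h, true_and, if_true]
  · simp only [h, false_and, if_false, prod_const_one]

lemma inSub_iff {k : Kind} {r : ℕ × ℕ} {α : Wt m n} {i : Fin m} {j : Fin n}
    (h1 : ∀ l, α (Sum.inl l) ≠ 0 ↔ l = i) (h2 : ∀ l, α (Sum.inr l) ≠ 0 ↔ l = j) :
    InSub k r α ↔ m ≤ i + r.1 ∧ if k = .gl then (j : ℕ) < r.2 else n ≤ j + r.2 := by
  simp only [InSub, h1, h2, forall_eq]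

lemma sumRoot_inl_ne_zero (i l : Fin m) (j : Fin n) :
    (eps i + del j : Wt m n) (Sum.inl l) ≠ 0 ↔ l = i := by simp

lemma sumRoot_inr_ne_zero (i : Fin m) (j l : Fin n) :
    (eps i + del j : Wt m n) (Sum.inr l) ≠ 0 ↔ l = j := by simp

open Classical in
lemma prod_sub_gl {M : Type*} [CommMonoid M] (hp : p ≤ m) (hq : q ≤ n) (w : List Letter)
    (F : Wt m n → M) :
    ∏ α ∈ (posOdd m n .gl w).filter (InSub .gl (p, q)), F α =
      ∏ i, ∏ j, F (diffRoot w (lastEmb hp i) (Fin.castLEEmb hq j)) := by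
  rw [prod_filter, prod_posOdd_gl, ← prod_ite_mem_range_prod (lastEmb hp) (Fin.castLEEmb hq)
    (fun i j => F (diffRoot w i j))]
  refine prod_congr rfl fun x _ => ?_
  rw [inSub_iff (fun l => diffRoot_inl_ne_zero w x.1 l x.2)
    (fun l => diffRoot_inr_ne_zero w x.1 x.2 l)]
  simp only [mem_range_lastEmb, mem_range_castLEEmb, if_true]

open Classical in
lemma prod_sub_ospEven {M : Type*} [CommMonoid M] (hp : p ≤ m) (hq : q ≤ n) (w : List Letter)
    (F : Wt m n → M) :
    ∏ α ∈ (posOdd m n .ospEven w).filter (InSub .ospEven (p, q)), F α =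
      ∏ i, ∏ j, F (diffRoot w (lastEmb hp i) (lastEmb hq j)) *
        F (eps (lastEmb hp i) + del (lastEmb hq j)) := by
  rw [prod_filter, prod_posOdd_ospEven, ← prod_mul_distrib,
    ← prod_ite_mem_range_prod (lastEmb hp) (lastEmb hq)
    (fun i j => F (diffRoot w i j) * F (eps i + del j))]
  refine prod_congr rfl fun x _ => ?_
  rw [inSub_iff (fun l => diffRoot_inl_ne_zero w x.1 l x.2)
    (fun l => diffRoot_inr_ne_zero w x.1 x.2 l), inSub_iff (fun l => sumRoot_inl_ne_zero x.1 l x.2)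
    (fun l => sumRoot_inr_ne_zero x.1 x.2 l)]
  simp only [mem_range_lastEmb]
  by_cases h : m ≤ x.1 + p ∧ n ≤ x.2 + q <;> simp [h]

open Classical in
lemma prod_sub_ospOdd {M : Type*} [CommMonoid M] (hp : p ≤ m) (hq : q ≤ n) (w : List Letter)
    (F : Wt m n → M) :
    ∏ α ∈ (posOdd m n .ospOdd w).filter (InSub .ospOdd (p, q)), F α =
      (∏ i, ∏ j, F (diffRoot w (lastEmb hp i) (lastEmb hq j)) *
        F (eps (lastEmb hp i) + del (lastEmb hq j))) * ∏ j, F (del (lastEmb hq j)) := by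
  rw [prod_filter, prod_posOdd_ospOdd, ← prod_mul_distrib,
    ← prod_ite_mem_range_prod (lastEmb hp) (lastEmb hq)
    (fun i j => F (diffRoot w i j) * F (eps i + del j)),
    ← prod_ite_mem_range (lastEmb hq) (fun j => F (del j))]
  congr 1
  · refine prod_congr rfl fun x _ => ?_
    rw [inSub_iff (fun l => diffRoot_inl_ne_zero w x.1 l x.2)
      (fun l => diffRoot_inr_ne_zero w x.1 x.2 l),
      inSub_iff (fun l => sumRoot_inl_ne_zero x.1 l x.2)
      (fun l => sumRoot_inr_ne_zero x.1 x.2 l)]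
    simp only [mem_range_lastEmb]
    by_cases h : m ≤ x.1 + p ∧ n ≤ x.2 + q <;> simp [h]
  · refine prod_congr rfl fun j _ => ?_
    simp only [mem_range_lastEmb]
    simp [InSub]

lemma prod_isoS_ospEven {M : Type*} [CommMonoid M] {s : ℕ} (hm : s ≤ m) (hn : s ≤ n)
    (F : Wt m n → M) :
    ∏ β ∈ isoS m n .ospEven s, F β = ∏ j, F (del (lastEmb hn j) - eps (lastEmb hm j)) := by
  simp only [isoS]
  rw [prod_image]
  · symm
    refine Finset.prod_bij (fun j _ => (lastEmb hm j, lastEmb hn j)) ?_ ?_ ?_ (fun _ _ => rfl)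
    · intro j _
      simp only [mem_filter, mem_univ, true_and, val_lastEmb]
      omega
    · intro j _ j' _ h
      exact (lastEmb hm).injective (Prod.ext_iff.1 h).1
    · rintro ⟨i, j⟩ h
      simp only [mem_filter, mem_univ, true_and] at h
      refine ⟨⟨i - (m - s), by omega⟩, mem_univ _, ?_⟩
      ext <;> simp only [val_lastEmb] <;> omega
  · rintro ⟨i, j⟩ _ ⟨i', j'⟩ _ h
    have h1 := congrFun h (Sum.inl i)
    have h2 := congrFun h (Sum.inr j)
    simp at h1 h2
    rw [h1, h2]

lemma prod_isoS_ospOdd {M : Type*} [CommMonoid M] {s : ℕ} (hm : s ≤ m) (hn : s ≤ n)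
    (F : Wt m n → M) :
    ∏ β ∈ isoS m n .ospOdd s, F β = ∏ j, F (eps (lastEmb hm j) - del (lastEmb hn j)) := by
  simp only [isoS]
  rw [prod_image]
  · symm
    refine Finset.prod_bij (fun j _ => (lastEmb hm j, lastEmb hn j)) ?_ ?_ ?_ (fun _ _ => rfl)
    · intro j _
      simp only [mem_filter, mem_univ, true_and, val_lastEmb]
      omega
    · intro j _ j' _ h
      exact (lastEmb hm).injective (Prod.ext_iff.1 h).1
    · rintro ⟨i, j⟩ h
      simp only [mem_filter, mem_univ, true_and] at h
      refine ⟨⟨i - (m - s), by omega⟩, mem_univ _, ?_⟩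
      ext <;> simp only [val_lastEmb] <;> omega
  · rintro ⟨i, j⟩ _ ⟨i', j'⟩ _ h
    have h1 := congrFun h (Sum.inl i)
    have h2 := congrFun h (Sum.inr j)
    simp at h1 h2
    rw [h1, h2]

lemma prod_isoS_gl {M : Type*} [CommMonoid M] {s : ℕ} (hm : s ≤ m) (hn : s ≤ n)
    (F : Wt m n → M) :
    ∏ β ∈ isoS m n .gl s, F β =
      ∏ j, F (eps (lastEmb hm (Fin.rev j)) - del (Fin.castLEEmb hn j)) := by
  simp only [isoS]
  rw [prod_image]
  · symm
    refine Finset.prod_bij (fun j _ => (lastEmb hm (Fin.rev j), Fin.castLEEmb hn j)) ?_ ?_ ?_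
      (fun _ _ => rfl)
    · intro j _
      simp only [mem_filter, mem_univ, true_and, val_lastEmb, Fin.val_rev, Fin.castLEEmb_apply,
        Fin.val_castLE]
      omega
    · intro j _ j' _ h
      exact (Fin.castLEEmb hn).injective (Prod.ext_iff.1 h).2
    · rintro ⟨i, j⟩ h
      simp only [mem_filter, mem_univ, true_and] at h
      refine ⟨⟨j, by omega⟩, mem_univ _, ?_⟩
      ext <;> simp only [val_lastEmb, Fin.val_rev, Fin.castLEEmb_apply, Fin.val_castLE]
      omega
  · rintro ⟨i, j⟩ _ ⟨i', j'⟩ _ h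
    have h1 := congrFun h (Sum.inl i)
    have h2 := congrFun h (Sum.inr j)
    simp at h1 h2
    rw [h1, h2]

open Classical in
lemma odd_pair_factor (w : List Letter) (i : Fin m) (j : Fin n) :
    (1 + ex (-diffRoot w i j)) * (1 + ex (-(eps i + del j))) =
      ((ex (eps i) + (ex (eps i))⁻¹) + (ex (del j) + (ex (del j))⁻¹)) *
        (if Precedes w i j then ex (eps i) else ex (del j))⁻¹ := by
  have h1 := ex_ne_zero (eps i : Wt m n)
  have h2 := ex_ne_zero (del j : Wt m n)
  by_cases h : Precedes w i j
  · simp only [diffRoot, h, if_true, neg_sub, neg_add, ex_sub, ex_add, ex_neg]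
    field_simp
    ring
  · simp only [diffRoot, h, if_false, neg_sub, neg_add, ex_sub, ex_add, ex_neg]
    field_simp
    ring

lemma ex_eps_add_ex_del_ne_zero (i : Fin m) (j : Fin n) :
    (ex (eps i) + (ex (eps i))⁻¹) + (ex (del j) + (ex (del j))⁻¹) ≠ (0 : Frac m n) := by
  intro h
  have h1 := odd_pair_factor [] i j
  rw [h, zero_mul] at h1
  exact mul_ne_zero (one_add_ex_ne_zero _) (one_add_ex_ne_zero _) h1

lemma prod_prod_ite_pow {F : Type*} [CommMonoid F] (c : Fin p → Fin q → Prop)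
    [∀ i j, Decidable (c i j)] (x : Fin p → F) (y : Fin q → F) :
    ∏ i, ∏ j, (if c i j then x i else y j) =
      (∏ i, x i ^ #{j | c i j}) * ∏ j, y j ^ #{i | ¬ c i j} := by
  have h (i : Fin p) (j : Fin q) : (if c i j then x i else y j) =
      (if c i j then x i else 1) * (if ¬ c i j then y j else 1) := by
    by_cases hc : c i j <;> simp [hc]
  simp_rw [h, prod_mul_distrib]
  rw [prod_comm (f := fun i j => if ¬ c i j then y j else 1)]
  congr 1 <;>
  · refine prod_congr rfl fun i _ => ?_
    rw [prod_ite, prod_const, prod_const_one, mul_one]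

/-! ### The identities for the equal rank subalgebras -/

open Classical in
lemma inv_prod_sub_ospEven (hp : p ≤ m) (hq : q ≤ n) (hqp : q ≤ p) (hpq : p ≤ q + 1) :
    (∏ α ∈ (posOdd m n .ospEven (stdWord m n .ospEven)).filter (InSub .ospEven (p, q)),
      (1 + ex (-α)))⁻¹ =
    (∏ i, ex (eps (lastEmb hp i)) ^ (Fin.rev i : ℕ)) *
      (∏ j, ex (del (lastEmb hq j)) ^ ((Fin.rev j : ℕ) + 1)) *
      ∏ i, ∏ j, ((ex (eps (lastEmb hp i)) + (ex (eps (lastEmb hp i)))⁻¹) +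
        (ex (del (lastEmb hq j)) + (ex (del (lastEmb hq j)))⁻¹) : Frac m n)⁻¹ := by
  rw [prod_sub_ospEven hp hq]
  simp_rw [odd_pair_factor, precedes_stdWord_ospEven, prod_mul_distrib, prod_inv_distrib,
    mul_inv, inv_inv]
  rw [prod_prod_ite_pow, mul_comm]
  congr 2
  · refine prod_congr rfl fun i _ => ?_
    congr 1
    have h1 := card_fin_ge q (i + q + 1 - p)
    have h2 : (Fin.rev i : ℕ) = q - (i + q + 1 - p) := by rw [Fin.val_rev]; omega
    rw [h2, ← h1]
    congr 1
    ext j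
    simp only [mem_filter, mem_univ, true_and]
    rw [val_lastEmb, val_lastEmb]
    omega
  · refine prod_congr rfl fun j _ => ?_
    congr 1
    have h1 := card_fin_ge p (j + p - q)
    have h2 : (Fin.rev j : ℕ) + 1 = p - (j + p - q) := by rw [Fin.val_rev]; omega
    rw [h2, ← h1]
    congr 1
    ext i
    simp only [mem_filter, mem_univ, true_and]
    rw [val_lastEmb, val_lastEmb]
    omega

open Classical in
theorem jW_sub_ospEven (hp : p ≤ m) (hq : q ≤ n) (hqp : q ≤ p) (hpq : p ≤ q + 1) (hq0 : 1 ≤ q)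
    (ν : Wt m n) (h1 : ∀ i : Fin m, m ≤ i + p → ν (Sum.inl i) = 0)
    (h2 : ∀ j : Fin n, n ≤ j + q → ν (Sum.inr j) = 0) :
    ((2 ^ (p - 1) * q.factorial : ℕ) : Frac m n) * jW .ospEven (ex ν /
      ∏ α ∈ (posOdd m n .ospEven (stdWord m n .ospEven)).filter (InSub .ospEven (p, q)),
        (1 + ex (-α))) = KW .ospEven ν (isoS m n .ospEven q) := by
  obtain ⟨p, rfl⟩ : ∃ p', p = p' + 1 := ⟨p - 1, by omega⟩
  have hφ := signedAction_embed (lastEmb hp) (lastEmb hq) 1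
  simp only [one_smul] at hφ
  have hν : ∀ g ∈ weyl (p + 1) q .ospEven, (g.embed (lastEmb hp) (lastEmb hq)).act ν = ν :=
    fun g _ => SPerm.act_embed_eq_self _ _ g ν 0 0
      (fun i => h1 _ ((mem_range_lastEmb hp _).1 ⟨i, rfl⟩))
      (fun j => h2 _ ((mem_range_lastEmb hq _).1 ⟨j, rfl⟩)) (Or.inl rfl) (Or.inl rfl)
  rw [KW, div_eq_mul_inv, div_eq_mul_inv, inv_prod_sub_ospEven hp hq hqp hpq]
  have hx (i : Fin (p + 1)) := ex_ne_zero (eps (lastEmb hp i) : Wt m n)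
  have hy (j : Fin q) := ex_ne_zero (del (lastEmb hq j) : Wt m n)
  have hxy (i : Fin (p + 1)) (j : Fin q) := ex_eps_add_ex_del_ne_zero (lastEmb hp i) (lastEmb hq j)
  obtain ⟨κ, hκ, hN⟩ : ∃ κ : Fin q → Fin (p + 1),
      (∀ j, lastEmb hp (κ j) = lastEmb (hqp.trans hp) j) ∧
      ∑ σ : Equiv.Perm (Fin (p + 1)), ∑ τ : Equiv.Perm (Fin q),
        ((Equiv.Perm.sign σ : ℤ) : Frac m n) * ((Equiv.Perm.sign τ : ℤ) : Frac m n) *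
          ∏ j, ((ex (eps (lastEmb hp (σ (κ j)))) + (ex (eps (lastEmb hp (σ (κ j)))))⁻¹) +
            (ex (del (lastEmb hq (τ j))) + (ex (del (lastEmb hq (τ j))))⁻¹))⁻¹ =
        q.factorial * (descVand (fun i => ex (eps (lastEmb hp i)) + (ex (eps (lastEmb hp i)))⁻¹) *
          descVand (fun j => ex (del (lastEmb hq j)) + (ex (del (lastEmb hq j)))⁻¹) *
          ∏ i, ∏ j, ((ex (eps (lastEmb hp i)) + (ex (eps (lastEmb hp i)))⁻¹) +
            (ex (del (lastEmb hq j)) + (ex (del (lastEmb hq j)))⁻¹))⁻¹) := by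
    rcases (by omega : q = p + 1 ∨ q = p) with rfl | rfl
    · exact ⟨id, fun j => rfl, sum_perm_cauchy
        (fun i => ex (eps (lastEmb hp i)) + (ex (eps (lastEmb hp i)))⁻¹)
        (fun j => ex (del (lastEmb hq j)) + (ex (del (lastEmb hq j)))⁻¹) hxy⟩
    · refine ⟨Fin.succ, fun j => ?_, sum_perm_cauchy_border
        (fun i => ex (eps (lastEmb hp i)) + (ex (eps (lastEmb hp i)))⁻¹)
        (fun j => ex (del (lastEmb hq j)) + (ex (del (lastEmb hq j)))⁻¹) hxy⟩
      ext
      simp only [val_lastEmb, Fin.val_succ]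
      omega
  have hQ : (∏ β ∈ isoS m n .ospEven q, (1 + ex (-β)))⁻¹ =
      ∏ j, (1 + ex (eps (lastEmb hp (κ j))) * (ex (del (lastEmb hq j)))⁻¹)⁻¹ := by
    rw [prod_isoS_ospEven (hqp.trans hp) hq, prod_inv_distrib]
    simp only [neg_sub, ex_sub, hκ]
  rw [hQ]
  refine jW_eq_of_sum_embed (lastEmb hp) (lastEmb hq) ν hν _ ⟨_, Int.cast_natCast _⟩ _ _ ?_
  have hE := sum_ospEven_euler hφ hx hy
  have hK := sum_ospEven_kw hφ hx hy hxy κ _ hN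
  simp only [RingHom.coe_coe] at hE hK
  rw [hE, hK]
  push_cast
  ring

open Classical in
theorem jW_sub_ospOdd {s : ℕ} (hp : s ≤ m) (hq : s ≤ n)
    (ν : Wt m n) (h1 : ∀ i : Fin m, m ≤ i + s → ν (Sum.inl i) = -(1 / 2))
    (h2 : ∀ j : Fin n, n ≤ j + s → ν (Sum.inr j) = 1 / 2) :
    ((2 ^ s * s.factorial : ℕ) : Frac m n) * jW .ospOdd (ex ν /
      ∏ α ∈ (posOdd m n .ospOdd (stdWord m n .ospOdd)).filter (InSub .ospOdd (s, s)),
        (1 + ex (-α))) = KW .ospOdd ν (isoS m n .ospOdd s) := by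
  have hφ := signedAction_embed (lastEmb hp) (lastEmb hq) (1 / 2)
  set X : Fin s → Frac m n := fun i => ex ((1 / 2 : ℂ) • eps (lastEmb hp i)) with hXdef
  set Y : Fin s → Frac m n := fun j => ex ((1 / 2 : ℂ) • del (lastEmb hq j)) with hYdef
  have hX2 (i : Fin s) : ex (eps (lastEmb hp i)) = X i ^ 2 := by
    rw [hXdef, sq, ← ex_add, ← add_smul]
    norm_num
  have hY2 (j : Fin s) : ex (del (lastEmb hq j)) = Y j ^ 2 := by
    rw [hYdef, sq, ← ex_add, ← add_smul]
    norm_num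
  have hX (i : Fin s) : X i ≠ 0 := ex_ne_zero _
  have hY (j : Fin s) : Y j ≠ 0 := ex_ne_zero _
  have hY1 (j : Fin s) : 1 + (Y j ^ 2)⁻¹ ≠ 0 := by
    rw [← hY2, ← ex_neg]; exact one_add_ex_ne_zero _
  have hY' (j : Fin s) : Y j + (Y j)⁻¹ = Y j * (1 + (Y j ^ 2)⁻¹) := by
    have := hY j
    field_simp
  have hY'' (j : Fin s) : Y j + (Y j)⁻¹ ≠ 0 := by
    rw [hY' j]; exact mul_ne_zero (hY j) (hY1 j)
  have hXY (i j : Fin s) : (X i ^ 2 + (X i)⁻¹ ^ 2) + (Y j ^ 2 + (Y j)⁻¹ ^ 2) ≠ 0 := by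
    rw [inv_pow, inv_pow, ← hX2, ← hY2]
    exact ex_eps_add_ex_del_ne_zero _ _
  set ρ' : Wt m n := ∑ j, (1 / 2 : ℂ) • del (lastEmb hq j) - ∑ i, (1 / 2 : ℂ) • eps (lastEmb hp i)
    with hρ'
  have hexρ' : ex ρ' = (∏ j, Y j) * (∏ i, X i)⁻¹ := by
    rw [hρ', ex_sub, ex_sum, ex_sum]
  have hν : ∀ g ∈ weyl s s .ospOdd, (g.embed (lastEmb hp) (lastEmb hq)).act (ν - ρ') = ν - ρ' := by
    refine fun g _ => SPerm.act_embed_eq_self _ _ g (ν - ρ') 0 0 (fun i => ?_) (fun j => ?_)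
      (Or.inl rfl) (Or.inl rfl)
    · have h3 := h1 _ ((mem_range_lastEmb hp _).1 ⟨i, rfl⟩)
      simp [hρ', h3]
    · have h3 := h2 _ ((mem_range_lastEmb hq _).1 ⟨j, rfl⟩)
      simp [hρ', h3]
  have hP : ex ρ' * (∏ α ∈ (posOdd m n .ospOdd (stdWord m n .ospOdd)).filter
        (InSub .ospOdd (s, s)), (1 + ex (-α)))⁻¹ =
      (∏ i, X i ^ (2 * (Fin.rev i : ℕ) + 1)) *
        (∏ j, (Y j ^ 2) ^ ((Fin.rev j : ℕ) + 1)) *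
        ((∏ j, (Y j + (Y j)⁻¹)⁻¹) *
          ∏ i, ∏ j, ((X i ^ 2 + (X i)⁻¹ ^ 2) + (Y j ^ 2 + (Y j)⁻¹ ^ 2))⁻¹) := by
    have hcx (i : Fin s) : #{j : Fin s | ((lastEmb hp i : Fin m) : ℕ) + n ≤ (lastEmb hq j : Fin n) + m} =
        (Fin.rev i : ℕ) + 1 := by
      have h3 := card_fin_ge s i
      have h4 : (Fin.rev i : ℕ) + 1 = s - i := by rw [Fin.val_rev]; omega
      rw [h4, ← h3]
      congr 1
      ext j
      simp only [mem_filter, mem_univ, true_and]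
      rw [val_lastEmb, val_lastEmb]
      omega
    have hcy (j : Fin s) : #{i : Fin s | ¬ ((lastEmb hp i : Fin m) : ℕ) + n ≤ (lastEmb hq j : Fin n) + m} =
        (Fin.rev j : ℕ) := by
      have h3 := card_fin_ge s (j + 1)
      have h4 : (Fin.rev j : ℕ) = s - (j + 1) := by rw [Fin.val_rev]
      rw [h4, ← h3]
      congr 1
      ext i
      simp only [mem_filter, mem_univ, true_and]
      rw [val_lastEmb, val_lastEmb]
      omega
    rw [prod_sub_ospOdd hp hq, hexρ']
    simp_rw [odd_pair_factor, precedes_stdWord_ospOdd, prod_mul_distrib, prod_inv_distrib,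
      mul_inv, inv_inv, ex_neg]
    rw [prod_prod_ite_pow]
    simp_rw [hcx, hcy, hX2, hY2]
    have e1 : ∏ i, (X i ^ 2) ^ ((Fin.rev i : ℕ) + 1) =
        (∏ i, X i) * ∏ i, X i ^ (2 * (Fin.rev i : ℕ) + 1) := by
      rw [← prod_mul_distrib]
      exact prod_congr rfl fun i _ => by ring
    have e2 : ∏ j, (Y j + (Y j)⁻¹) = (∏ j, Y j) * ∏ j, (1 + (Y j ^ 2)⁻¹) := by
      rw [← prod_mul_distrib]
      exact prod_congr rfl fun j _ => hY' j
    have e3 : ∏ j, (Y j ^ 2) ^ ((Fin.rev j : ℕ) + 1) =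
        (∏ j, Y j) * (∏ j, Y j) * ∏ j, (Y j ^ 2) ^ (Fin.rev j : ℕ) := by
      rw [← prod_mul_distrib, ← prod_mul_distrib]
      exact prod_congr rfl fun j _ => by ring
    rw [e1, e2, e3]
    have e4 : ∏ i, X i ≠ 0 := prod_ne_zero_iff.2 fun i _ => hX i
    have e5 : ∏ j, Y j ≠ 0 := prod_ne_zero_iff.2 fun j _ => hY j
    have e6 : ∏ j, (1 + (Y j ^ 2)⁻¹) ≠ 0 := prod_ne_zero_iff.2 fun j _ => hY1 j
    simp only [inv_pow]
    generalize ∏ i, ∏ j, (X i ^ 2 + (X i ^ 2)⁻¹ + (Y j ^ 2 + (Y j ^ 2)⁻¹)) = D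
    generalize ∏ j, (1 + (Y j ^ 2)⁻¹) = A at *
    generalize ∏ j, Y j = B at *
    generalize ∏ j, X j = C at *
    rw [mul_inv]
    field_simp
  have hQ : ex ρ' * (∏ β ∈ isoS m n .ospOdd s, (1 + ex (-β)))⁻¹ =
      ∏ i, (X i * (Y i)⁻¹ + Y i * (X i)⁻¹)⁻¹ := by
    rw [prod_isoS_ospOdd hp hq, hexρ', ← prod_inv_distrib, ← prod_inv_distrib, ← prod_mul_distrib,
      ← prod_mul_distrib]
    refine prod_congr rfl fun i _ => ?_
    rw [neg_sub, ex_sub, hX2, hY2]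
    have h3 := hX i
    have h4 := hY i
    have h5 : X i * (Y i)⁻¹ + Y i * (X i)⁻¹ =
        (1 + Y i ^ 2 * (X i ^ 2)⁻¹) * (Y i * (X i)⁻¹)⁻¹ := by
      field_simp
    rw [h5, mul_inv, inv_inv, mul_comm]
  have hν' : ex ν = ex (ν - ρ') * ex ρ' := by rw [← ex_add, sub_add_cancel]
  rw [KW, div_eq_mul_inv, div_eq_mul_inv, hν', mul_assoc, mul_assoc, hP, hQ]
  refine jW_eq_of_sum_embed (lastEmb hp) (lastEmb hq) (ν - ρ') hν _ ⟨_, Int.cast_natCast _⟩ _ _ ?_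
  have hE := sum_ospOdd_euler hφ hX hY hY''
  have hK := sum_ospOdd_kw hφ hX hY hXY
  simp only [RingHom.coe_coe] at hE hK
  rw [hE, hK]
  push_cast
  ring

end Sub

section GeneralLinear

variable {m n : ℕ}

lemma sign_revPerm (s : ℕ) :
    Equiv.Perm.sign (Fin.revPerm : Equiv.Perm (Fin s)) = (-1) ^ (s / 2) := by
  have h1 : Equiv.Perm.sign (Fin.revPerm : Equiv.Perm (Fin s)) = ∏ j : Fin s, (-1) ^ (j : ℕ) := by
    rw [Equiv.Perm.sign_eq_prod_prod_Iio]
    refine prod_congr rfl fun j _ => ?_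
    rw [← Fin.card_Iio j, ← prod_const]
    refine prod_congr rfl fun i hi => ?_
    rw [mem_Iio] at hi
    rw [if_neg]
    simpa using hi.le
  rw [h1, Fin.prod_univ_eq_prod_range (fun j => (-1 : ℤˣ) ^ j)]
  clear h1
  induction s with
  | zero => simp
  | succ s ih =>
    rw [prod_range_succ, ih, ← pow_add]
    rcases Nat.even_or_odd' s with ⟨k, rfl | rfl⟩
    · have e1 : 2 * k / 2 + 2 * k = k + 2 * k := by omega
      have e2 : (2 * k + 1) / 2 = k := by omega
      rw [e1, e2, pow_add, pow_mul]
      simp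
    · have e1 : (2 * k + 1) / 2 + (2 * k + 1) = (k + 1) + 2 * k := by omega
      have e2 : (2 * k + 1 + 1) / 2 = k + 1 := by omega
      rw [e1, e2, pow_add _ (k + 1), pow_mul]
      simp

lemma form_eps (μ : Wt m n) (i : Fin m) : form μ (eps i) = μ (Sum.inl i) := by
  simp [form]

lemma form_del (μ : Wt m n) (j : Fin n) : form μ (del j) = -μ (Sum.inr j) := by
  simp [form]

lemma form_add_right (μ α β : Wt m n) : form μ (α + β) = form μ α + form μ β := by
  simp only [form, Pi.add_apply, mul_add, sum_add_distrib]
  ring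

lemma form_sub_right (μ α β : Wt m n) : form μ (α - β) = form μ α - form μ β := by
  simp only [form, Pi.sub_apply, mul_sub, sum_sub_distrib]
  ring

lemma diffRoot_stdWord_gl (i : Fin m) (j : Fin n) :
    diffRoot (stdWord m n .gl) i j = eps i - del j := by
  simp [diffRoot, precedes_stdWord_gl]

lemma diffRoot_mem_posRoots (k : Kind) (i : Fin m) (j : Fin n) :
    diffRoot (stdWord m n k) i j ∈ posRoots m n k := by
  refine mem_union_right _ ?_
  cases k with
  | gl => exact mem_image.2 ⟨(i, j), mem_univ _, rfl⟩
  | ospEven => exact mem_union_left _ (mem_image.2 ⟨(i, j), mem_univ _, rfl⟩)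
  | ospOdd =>
    exact mem_union_left _ (mem_union_left _ (mem_image.2 ⟨(i, j), mem_univ _, rfl⟩))

lemma sumRoot_mem_posRoots {k : Kind} (hk : k ≠ .gl) (i : Fin m) (j : Fin n) :
    eps i + del j ∈ posRoots m n k := by
  refine mem_union_right _ ?_
  cases k with
  | gl => exact absurd rfl hk
  | ospEven => exact mem_union_right _ (mem_image.2 ⟨(i, j), mem_univ _, rfl⟩)
  | ospOdd =>
    exact mem_union_left _ (mem_union_right _ (mem_image.2 ⟨(i, j), mem_univ _, rfl⟩))

lemma VanishesOn.gl_eq {lam : Fin m ⊕ Fin n → ℤ} {r : ℕ × ℕ} (h : VanishesOn .gl lam r)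
    {i : Fin m} {j : Fin n} (hi : m ≤ i + r.1) (hj : (j : ℕ) < r.2) :
    (lam (Sum.inl i) : ℂ) = -lam (Sum.inr j) := by
  have h1 := h _ (diffRoot_mem_posRoots .gl i j)
    ((inSub_iff (fun l => diffRoot_inl_ne_zero _ i l j)
      (fun l => diffRoot_inr_ne_zero _ i j l)).2 ⟨hi, by simpa using hj⟩)
  rw [diffRoot_stdWord_gl, form_sub_right, form_eps, form_del] at h1
  simp only [toWt] at h1
  linear_combination h1

open Classical in
lemma rhoL_eq (s : ℕ) : rhoL m n s = rho m n .gl + ∑ x : Fin m × Fin n,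
    if Precedes (wordL m n s) x.1 x.2 then 0 else (eps x.1 - del x.2 : Wt m n) := by
  rw [rhoL, rho1, rho1, sum_posOdd_gl, sum_posOdd_gl, add_sub_assoc, ← smul_sub,
    ← sum_sub_distrib, smul_sum]
  congr 1
  refine sum_congr rfl fun x _ => ?_
  rw [diffRoot_stdWord_gl, diffRoot]
  split_ifs
  · simp
  · module

lemma card_fin_lt (N t : ℕ) (h : t ≤ N) : #{j : Fin N | (j : ℕ) < t} = t := by
  have h1 := card_filter_add_card_filter_not (s := (univ : Finset (Fin N))) (fun j => t ≤ (j : ℕ))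
  rw [card_fin_ge, card_univ, Fintype.card_fin] at h1
  simp only [not_le] at h1
  omega

lemma rhoL_inl {s : ℕ} (hm : s ≤ m) (hn : s ≤ n) (i : Fin m) (hi : m ≤ i + s) :
    rhoL m n s (Sum.inl i) = s := by
  classical
  rw [rhoL_eq]
  simp only [precedes_wordL hm hn, Pi.add_apply, Finset.sum_apply]
  rw [Fintype.sum_prod_type, Finset.sum_eq_single i]
  · have h1 := card_fin_lt n (i + s - m) (by omega)
    have h2 : ∑ j : Fin n, (if (i : ℕ) + s ≤ m + j then (0 : Wt m n) else eps i - del j)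
        (Sum.inl i) = ((i + s - m : ℕ) : ℂ) := by
      rw [← h1, card_filter]
      push_cast
      refine sum_congr rfl fun j _ => ?_
      by_cases h : (i : ℕ) + s ≤ m + j
      · rw [if_pos h, if_neg (by omega)]; rfl
      · rw [if_neg h, if_pos (by omega)]; simp
    simp only
    rw [h2, Nat.cast_sub hi]
    simp only [rho, Sum.elim_inl]
    push_cast
    ring
  · intro b _ hb
    refine sum_eq_zero fun j _ => ?_
    split_ifs <;> simp [hb.symm]
  · simp

lemma rhoL_inr {s : ℕ} (hm : s ≤ m) (hn : s ≤ n) (j : Fin n) (hj : (j : ℕ) < s) :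
    rhoL m n s (Sum.inr j) = -s := by
  classical
  rw [rhoL_eq]
  simp only [precedes_wordL hm hn, Pi.add_apply, Finset.sum_apply]
  rw [Fintype.sum_prod_type_right, Finset.sum_eq_single j]
  · have h1 := card_fin_ge m (m + j + 1 - s)
    have h2 : ∑ i : Fin m, (if (i : ℕ) + s ≤ m + j then (0 : Wt m n) else eps i - del j)
        (Sum.inr j) = -((m - (m + j + 1 - s) : ℕ) : ℂ) := by
      rw [← h1, card_filter]
      push_cast
      rw [← sum_neg_distrib]
      refine sum_congr rfl fun i _ => ?_
      by_cases h : (i : ℕ) + s ≤ m + j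
      · rw [if_pos h, if_neg (by omega)]; simp
      · rw [if_neg h, if_pos (by omega)]; simp
    have h3 : m - (m + j + 1 - s) = s - (j + 1) := by omega
    simp only
    rw [h2, h3, Nat.cast_sub (by omega)]
    simp only [rho, Sum.elim_inr]
    push_cast
    ring
  · intro b _ hb
    refine sum_eq_zero fun j _ => ?_
    split_ifs <;> simp [hb.symm]
  · simp

open Classical in
lemma ex_rho_sub_rhoL {s : ℕ} (hm : s ≤ m) (hn : s ≤ n) :
    ex (rho m n .gl - rhoL m n s) = ∏ i : Fin s, ∏ j : Fin s, if i ≤ j then 1 else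
      ex (del (Fin.castLEEmb hn j)) * (ex (eps (lastEmb hm i)))⁻¹ := by
  have h0 : rho m n .gl - rhoL m n s = ∑ x : Fin m × Fin n,
      if (x.1 : ℕ) + s ≤ m + x.2 then 0 else (del x.2 - eps x.1 : Wt m n) := by
    rw [rhoL_eq, sub_add_cancel_left, ← sum_neg_distrib]
    refine sum_congr rfl fun x _ => ?_
    simp only [precedes_wordL hm hn]
    split_ifs <;> simp
  rw [h0, ex_sum]
  have h1 := prod_ite_mem_range_prod (lastEmb hm) (Fin.castLEEmb hn)
    (fun i j => ex (if (i : ℕ) + s ≤ m + j then 0 else (del j - eps i : Wt m n)))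
  have h2 : ∏ x : Fin m × Fin n, ex (if (x.1 : ℕ) + s ≤ m + x.2 then 0
      else (del x.2 - eps x.1 : Wt m n)) = ∏ x : Fin m × Fin n,
      (if x.1 ∈ Set.range (lastEmb hm) ∧ x.2 ∈ Set.range (Fin.castLEEmb hn) then
        ex (if (x.1 : ℕ) + s ≤ m + x.2 then 0 else (del x.2 - eps x.1 : Wt m n)) else 1) := by
    refine prod_congr rfl fun x _ => ?_
    simp only [mem_range_lastEmb, mem_range_castLEEmb]
    split_ifs with h3 h4 h4
    · rfl
    · simp
    · rfl
    · omega
  rw [h2, h1]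
  refine prod_congr rfl fun i _ => prod_congr rfl fun j _ => ?_
  have h3 : ((lastEmb hm i : Fin m) : ℕ) + s ≤ m + (Fin.castLEEmb hn j : Fin n) ↔ i ≤ j := by
    rw [val_lastEmb, Fin.castLEEmb_apply, Fin.val_castLE, Fin.le_def]
    omega
  simp only [h3]
  split_ifs
  · simp
  · rw [ex_sub]

open Classical in
theorem jW_sub_gl {s : ℕ} (hp : s ≤ m) (hq : s ≤ n) {lam : Fin m ⊕ Fin n → ℤ}
    (hV : VanishesOn .gl lam (s, s)) :
    (jGl s : Frac m n) * jW .gl (ex (toWt lam + rho m n .gl) /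
      ∏ α ∈ (posOdd m n .gl (stdWord m n .gl)).filter (InSub .gl (s, s)),
        (1 + ex (-α))) = KW .gl (toWt lam + rhoL m n s) (isoS m n .gl s) := by
  have hφ := signedAction_embed (m := m) (n := n) (lastEmb hp) (Fin.castLEEmb hq) 1
  simp only [one_smul] at hφ
  set X : Fin s → Frac m n := fun i => ex (eps (lastEmb hp i)) with hXdef
  set Y : Fin s → Frac m n := fun j => ex (del (Fin.castLEEmb hq j)) with hYdef
  have hX (i : Fin s) : X i ≠ 0 := ex_ne_zero _
  have hXY' (i j : Fin s) : X i + Y j = X i * (1 + ex (-(eps (lastEmb hp i) -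
      del (Fin.castLEEmb hq j)))) := by
    have := hX i
    rw [neg_sub, ex_sub]
    simp only [hXdef, hYdef] at *
    field_simp
  have hXY (i j : Fin s) : X i + Y j ≠ 0 := by
    rw [hXY']
    exact mul_ne_zero (hX i) (one_add_ex_ne_zero _)
  set ν := toWt lam + rhoL m n s with hνdef
  have hν : ∀ g ∈ weyl s s .gl, (g.embed (lastEmb hp) (Fin.castLEEmb hq)).act ν = ν := by
    intro g hg
    simp only [weyl, mem_filter, mem_univ, true_and] at hg
    have hi (i : Fin s) : m ≤ lastEmb hp i + s := (mem_range_lastEmb hp _).1 ⟨i, rfl⟩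
    have hj (j : Fin s) : (Fin.castLEEmb hq j : ℕ) < s := (mem_range_castLEEmb hq _).1 ⟨j, rfl⟩
    rcases Nat.eq_zero_or_pos s with rfl | hs
    · exact SPerm.act_embed_eq_self _ _ g ν 0 0 (fun i => i.elim0) (fun j => j.elim0)
        (Or.inr hg.1) (Or.inr hg.2)
    · refine SPerm.act_embed_eq_self _ _ g ν (-lam (Sum.inr (Fin.castLEEmb hq ⟨0, hs⟩)) + s)
        (-lam (Sum.inl (lastEmb hp ⟨0, hs⟩)) - s) (fun i => ?_) (fun j => ?_)
        (Or.inr hg.1) (Or.inr hg.2)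
      · rw [hνdef, Pi.add_apply, rhoL_inl hp hq _ (hi i), toWt, hV.gl_eq (hi i) (hj ⟨0, hs⟩)]
      · rw [hνdef, Pi.add_apply, rhoL_inr hp hq _ (hj j), toWt, hV.gl_eq (hi ⟨0, hs⟩) (hj j)]
        ring
  have hP : ex (rho m n .gl - rhoL m n s) *
      (∏ α ∈ (posOdd m n .gl (stdWord m n .gl)).filter (InSub .gl (s, s)), (1 + ex (-α)))⁻¹ =
      (∏ i, X i ^ ((Fin.rev i : ℕ) + 1)) * (∏ j, Y j ^ (Fin.rev j : ℕ)) *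
        ∏ i, ∏ j, (X i + Y j)⁻¹ := by
    have hcx (i : Fin s) : #{j : Fin s | i ≤ j} = (Fin.rev i : ℕ) + 1 := by
      have h3 := card_fin_ge s i
      have h4 : (Fin.rev i : ℕ) + 1 = s - i := by rw [Fin.val_rev]; omega
      rw [h4, ← h3]
      rfl
    have hcy (j : Fin s) : #{i : Fin s | ¬ i ≤ j} = (Fin.rev j : ℕ) := by
      have h3 := card_fin_ge s (j + 1)
      have h4 : (Fin.rev j : ℕ) = s - (j + 1) := by rw [Fin.val_rev]
      rw [h4, ← h3]
      congr 1
      ext i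
      simp only [mem_filter, mem_univ, true_and, Fin.le_def]
      omega
    have h5 := prod_prod_ite_pow (fun i j : Fin s => i ≤ j) X Y
    simp only [hcx, hcy] at h5
    rw [← h5, ex_rho_sub_rhoL hp hq, prod_sub_gl hp hq, ← prod_inv_distrib, ← prod_mul_distrib,
      ← prod_mul_distrib]
    refine prod_congr rfl fun i _ => ?_
    rw [← prod_inv_distrib, ← prod_mul_distrib, ← prod_mul_distrib]
    refine prod_congr rfl fun j _ => ?_
    rw [hXY', diffRoot_stdWord_gl, mul_inv, ← mul_assoc]
    congr 1
    have := hX i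
    split_ifs
    · rw [mul_inv_cancel₀ this]
    · rfl
  have hQ : (∏ β ∈ isoS m n .gl s, (1 + ex (-β)))⁻¹ =
      ∏ j, X (Fin.rev j) * (X (Fin.rev j) + Y j)⁻¹ := by
    rw [prod_isoS_gl hp hq, ← prod_inv_distrib]
    refine prod_congr rfl fun j _ => ?_
    rw [hXY', mul_inv, mul_inv_cancel_left₀ (hX _)]
  have hν' : ex (toWt lam + rho m n .gl) = ex ν * ex (rho m n .gl - rhoL m n s) := by
    rw [← ex_add]
    congr 1
    rw [hνdef]
    abel
  rw [KW, div_eq_mul_inv, div_eq_mul_inv, hν', mul_assoc, hP, hQ]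
  refine jW_eq_of_sum_embed (lastEmb hp) (Fin.castLEEmb hq) ν hν _ ⟨jGl s, rfl⟩ _ _ ?_
  have hE := sum_gl_euler hφ
  have hK := sum_gl_kw hφ hXY
  simp only [RingHom.coe_coe] at hE hK
  rw [hE, hK, sign_revPerm, jGl]
  push_cast
  ring

end GeneralLinear

/-! ### Vanishing on equal rank subalgebras -/

section Vanishing

variable {m n : ℕ}

lemma VanishesOn.osp_eq_zero {k : Kind} (hk : k ≠ .gl) {lam : Fin m ⊕ Fin n → ℤ} {r : ℕ × ℕ}
    (h : VanishesOn k lam r) {i : Fin m} {j : Fin n} (hi : m ≤ i + r.1) (hj : n ≤ j + r.2) :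
    lam (Sum.inl i) = 0 ∧ lam (Sum.inr j) = 0 := by
  have h1 := h _ (diffRoot_mem_posRoots k i j)
    ((inSub_iff (fun l => diffRoot_inl_ne_zero _ i l j)
      (fun l => diffRoot_inr_ne_zero _ i j l)).2 ⟨hi, by simpa [hk] using hj⟩)
  have h2 := h _ (sumRoot_mem_posRoots hk i j)
    ((inSub_iff (fun l => sumRoot_inl_ne_zero i l j)
      (fun l => sumRoot_inr_ne_zero i j l)).2 ⟨hi, by simpa [hk] using hj⟩)
  rw [form_add_right, form_eps, form_del] at h2
  have h3 : (lam (Sum.inl i) : ℂ) + lam (Sum.inr j) = 0 := by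
    simp only [diffRoot] at h1
    split_ifs at h1 <;> rw [form_sub_right, form_eps, form_del] at h1 <;>
      simp only [toWt] at h1
    · linear_combination h1
    · linear_combination -h1
  simp only [toWt] at h2
  have h4 : lam (Sum.inl i) + lam (Sum.inr j) = 0 := by exact_mod_cast h3
  have h5 : lam (Sum.inl i) + -lam (Sum.inr j) = 0 := by exact_mod_cast h2
  constructor <;> omega

lemma vanishesOn_osp {k : Kind} (hk : k ≠ .gl) {lam : Fin m ⊕ Fin n → ℤ} {r : ℕ × ℕ}
    (h1 : ∀ i : Fin m, m ≤ i + r.1 → lam (Sum.inl i) = 0)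
    (h2 : ∀ j : Fin n, n ≤ j + r.2 → lam (Sum.inr j) = 0) : VanishesOn k lam r := by
  intro α _ hα
  simp only [InSub, hk, if_false] at hα
  rw [form, sum_eq_zero, sum_eq_zero, sub_zero]
  · intro j _
    by_cases h : α (Sum.inr j) = 0
    · rw [h, mul_zero]
    · simp [toWt, h2 j (hα.2 j h)]
  · intro i _
    by_cases h : α (Sum.inl i) = 0
    · rw [h, mul_zero]
    · simp [toWt, h1 i (hα.1 i h)]

end Vanishing

/-! ### Highest weights of finite-dimensional modules of `osp(2m|2n)` -/

section HighestWeights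

attribute [local instance] LieRing.ofAssociativeRing

/-- The highest weights of finite-dimensional representations of `sl₂` are natural numbers. -/
lemma exists_nat_of_sl2 {J : Type*} [Fintype J] [DecidableEq J] {E F H : Matrix J J ℂ}
    (hEF : E * F - F * E = H) (hHE : H * E - E * H = (2 : ℂ) • E)
    (hHF : H * F - F * H = -((2 : ℂ) • F)) {v : J → ℂ} (hv : v ≠ 0) {μ : ℂ}
    (hμ : H.mulVec v = μ • v) (hE : E.mulVec v = 0) : ∃ N : ℕ, μ = N := by
  by_cases hH : H = 0
  · refine ⟨0, ?_⟩
    rw [hH, Matrix.zero_mulVec] at hμ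
    simpa using (smul_eq_zero.1 hμ.symm).resolve_right hv
  · let toEnd : Matrix J J ℂ → Module.End ℂ (J → ℂ) := fun A => Matrix.toLin' A
    have hlie (A B : Matrix J J ℂ) : ⁅toEnd A, toEnd B⁆ = toEnd (A * B - B * A) := by
      refine LinearMap.ext fun w => ?_
      simp [toEnd, Ring.lie_def, Matrix.mulVec_mulVec]
    have t : IsSl2Triple (toEnd H) (toEnd E) (toEnd F) := by
      refine ⟨fun h => hH (Matrix.toLin'.injective (h.trans (map_zero _).symm)), ?_, ?_, ?_⟩
      · rw [hlie, hEF]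
      · rw [hlie, hHE]
        refine LinearMap.ext fun w => ?_
        simp [toEnd, two_smul]
      · rw [hlie, hHF]
        refine LinearMap.ext fun w => ?_
        simp [toEnd, two_smul]
    have P : t.HasPrimitiveVectorWith v μ := ⟨hv, hμ, hE⟩
    exact P.exists_nat

section Rep

variable {I : Type} [Fintype I] {par : I → ZMod 2} {g : Submodule ℂ (Matrix I I ℂ)} {a b : ℕ}
  {π : g →ₗ[ℂ] Matrix (Fin a ⊕ Fin b) (Fin a ⊕ Fin b) ℂ}

lemma IsRep.map_commutator (h : IsRep par g π) {q : ZMod 2} (x y z : g)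
    (hx : IsHomog par (x : Matrix I I ℂ) 0) (hy : IsHomog par (y : Matrix I I ℂ) q)
    (hz : (x : Matrix I I ℂ) * y - (y : Matrix I I ℂ) * x = z) :
    π x * π y - π y * π x = π z := by
  rw [h.bracket 0 q x y z hx hy]
  · simp [superBracket, sgn2]
  · rw [← hz]
    simp [superBracket, sgn2]

lemma IsRep.map_anticommutator (h : IsRep par g π) (x y z : g)
    (hx : IsHomog par (x : Matrix I I ℂ) 1) (hy : IsHomog par (y : Matrix I I ℂ) 1)
    (hz : (x : Matrix I I ℂ) * y + (y : Matrix I I ℂ) * x = z) :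
    π x * π y + π y * π x = π z := by
  rw [h.bracket 1 1 x y z hx hy]
  · simp [superBracket, sgn2]
  · rw [← hz]
    simp [superBracket, sgn2]

/-- The value of a weight of a primitive vector on the coroot of an even root. -/
lemma IsRep.exists_nat_of_primitive (h : IsRep par g π) (e f c : g)
    (he : IsHomog par (e : Matrix I I ℂ) 0) (hf : IsHomog par (f : Matrix I I ℂ) 0)
    (hc : IsHomog par (c : Matrix I I ℂ) 0)
    (hef : (e : Matrix I I ℂ) * f - (f : Matrix I I ℂ) * e = c)
    (hce : (c : Matrix I I ℂ) * e - (e : Matrix I I ℂ) * c = (2 : ℂ) • (e : Matrix I I ℂ))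
    (hcf : (c : Matrix I I ℂ) * f - (f : Matrix I I ℂ) * c = -((2 : ℂ) • (f : Matrix I I ℂ)))
    {v : Fin a ⊕ Fin b → ℂ} (hv : v ≠ 0) {μ : ℂ} (hμ : (π c).mulVec v = μ • v)
    (hev : (π e).mulVec v = 0) : ∃ N : ℕ, μ = N := by
  refine exists_nat_of_sl2 (h.map_commutator e f c he hf hef) ?_ ?_ hv hμ hev
  · rw [h.map_commutator c e ((2 : ℂ) • e) hc he hce, map_smul]
  · rw [h.map_commutator c f (-((2 : ℂ) • f)) hc hf hcf, map_neg, map_smul]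

end Rep

variable {m n : ℕ}

/-- The basis vector of the opposite weight. -/
def opp (x : EvenIdx m n) : EvenIdx m n := (x.1, !x.2)

@[simp] lemma opp_opp (x : EvenIdx m n) : opp (opp x) = x := by simp [opp]

lemma opp_injective : Function.Injective (opp : EvenIdx m n → EvenIdx m n) :=
  Function.LeftInverse.injective opp_opp

lemma evenForm_eq_zero {x y : EvenIdx m n} (h : y ≠ opp x) : evenForm x y = 0 := by
  rw [evenForm, if_neg]
  rintro ⟨h1, h2⟩
  refine h (Prod.ext h1.symm ?_)
  simp only [opp]
  cases hx : x.2 <;> cases hy : y.2 <;> simp_all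

lemma mem_osp_iff (x : Matrix (EvenIdx m n) (EvenIdx m n) ℂ) :
    x ∈ osp (evenPar (m := m) (n := n)) evenForm ↔ ∀ i j, x (opp j) i * evenForm (opp j) j +
      sgn2 ((evenPar i + evenPar j) * evenPar i) * (evenForm i (opp i) * x (opp i) j) = 0 := by
  have h1 (i j : EvenIdx m n) : ∑ k, x k i * evenForm k j = x (opp j) i * evenForm (opp j) j := by
    refine sum_eq_single _ (fun k _ hk => ?_) (by simp)
    rw [evenForm_eq_zero, mul_zero]
    intro h
    exact hk (by rw [h, opp_opp])
  have h2 (i j : EvenIdx m n) : ∑ k, evenForm i k * x k j = evenForm i (opp i) * x (opp i) j := by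
    refine sum_eq_single _ (fun k _ hk => ?_) (by simp)
    rw [evenForm_eq_zero hk, zero_mul]
  simp only [← h1, ← h2]
  rfl

/-- The matrix `E_{kl} + c E_{-l,-k}`. -/
def rootVec (c : ℂ) (k l : EvenIdx m n) : Matrix (EvenIdx m n) (EvenIdx m n) ℂ :=
  Matrix.single k l 1 + Matrix.single (opp l) (opp k) c

lemma rootVec_mem_osp {c : ℂ} {k l : EvenIdx m n} (hkl : l ≠ opp k)
    (h1 : evenForm k (opp k) + sgn2 ((evenPar l + evenPar k) * evenPar l) *
      (evenForm l (opp l) * c) = 0)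
    (h2 : c * evenForm (opp l) l + sgn2 ((evenPar k + evenPar l) * evenPar k) *
      evenForm (opp k) k = 0) :
    rootVec c k l ∈ osp (evenPar (m := m) (n := n)) evenForm := by
  have hp (x : EvenIdx m n) : evenPar (opp x) = evenPar x := rfl
  have ho (x y : EvenIdx m n) : x = opp y ↔ opp x = y :=
    ⟨fun h => by rw [h, opp_opp], fun h => by rw [← h, opp_opp]⟩
  rw [mem_osp_iff]
  intro i j
  simp only [rootVec, Matrix.add_apply, Matrix.single_apply]
  by_cases h3 : l = i ∧ k = opp j
  · obtain ⟨rfl, rfl⟩ := h3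
    rw [opp_opp, hp] at *
    have h4 : ¬ opp l = opp j := fun h => hkl (opp_injective h)
    have h5 : ¬ opp j = opp l := fun h => h4 h.symm
    have h6 : ¬ (j = l) := fun h => hkl h.symm
    simp only [h4, h5, h6, and_true, if_true, if_false, false_and, and_false,
      add_zero, zero_add, one_mul]
    exact h1
  · by_cases h4 : l = j ∧ k = opp i
    · obtain ⟨rfl, rfl⟩ := h4
      rw [opp_opp, hp] at *
      have h5 : ¬ opp i = opp l := fun h => hkl (opp_injective h.symm)
      have h6 : ¬ (l = i) := hkl
      have h7 : ¬ opp l = opp i := fun h => h5 h.symm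
      simp only [h5, h6, h7, and_self, if_true, if_false, false_and, add_zero,
        zero_add, mul_one]
      exact h2
    · have e1 : ¬ (k = opp j ∧ l = i) := fun h => h3 ⟨h.2, h.1⟩
      have e2 : ¬ (opp l = opp j ∧ opp k = i) := fun h =>
        h4 ⟨opp_injective h.1, ((ho _ _).2 h.2)⟩
      have e3 : ¬ (k = opp i ∧ l = j) := fun h => h4 ⟨h.2, h.1⟩
      have e4 : ¬ (opp l = opp i ∧ opp k = j) := fun h =>
        h3 ⟨opp_injective h.1, ((ho _ _).2 h.2)⟩
      simp only [e1, e2, e3, e4, if_false]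
      ring

lemma pair_evenWt (x : EvenIdx m n) (t : Fin m ⊕ Fin n → ℂ) :
    pair (evenWt x) t = if x.2 then t x.1 else -t x.1 := by
  unfold evenWt pair
  split_ifs <;> simp [Pi.single_apply]

lemma pair_opp (x : EvenIdx m n) (t : Fin m ⊕ Fin n → ℂ) :
    pair (evenWt (opp x)) t = -pair (evenWt x) t := by
  rw [pair_evenWt, pair_evenWt]
  cases h : x.2 <;> simp [opp, h]

lemma cartan_mem_osp (t : Fin m ⊕ Fin n → ℂ) :
    cartan evenWt t ∈ osp (evenPar (m := m) (n := n)) evenForm := by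
  rw [mem_osp_iff]
  intro i j
  simp only [cartan, Matrix.diagonal_apply]
  by_cases h : j = opp i
  · subst h
    have h0 : evenPar i + evenPar (opp i) = 0 := by
      have : evenPar (opp i) = evenPar i := rfl
      rw [this]
      exact CharTwo.add_self_eq_zero _
    rw [h0, opp_opp, pair_opp]
    simp only [zero_mul, sgn2, if_true]
    ring
  · have h1 : ¬ opp j = i := fun h' => h (by rw [← h', opp_opp])
    have h2 : ¬ opp i = j := fun h' => h h'.symm
    simp [h1, h2]

lemma isHomog_cartan (t : Fin m ⊕ Fin n → ℂ) :
    IsHomog (evenPar (m := m) (n := n)) (cartan evenWt t) 0 := by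
  intro i j h
  have : i = j := by
    by_contra hne
    exact h (by simp [cartan, hne])
  rw [this]
  exact CharTwo.add_self_eq_zero _

lemma isHomog_rootVec (c : ℂ) (k l : EvenIdx m n) {p : ZMod 2} (hp : evenPar k + evenPar l = p) :
    IsHomog (evenPar (m := m) (n := n)) (rootVec c k l) p := by
  intro i j h
  simp only [rootVec, Matrix.add_apply, Matrix.single_apply] at h
  by_cases h1 : k = i ∧ l = j
  · rw [← h1.1, ← h1.2, hp]
  · by_cases h2 : opp l = i ∧ opp k = j
    · rw [← h2.1, ← h2.2, ← hp, add_comm]; rfl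
    · simp [h1, h2] at h

lemma cartan_commutator_single (t : Fin m ⊕ Fin n → ℂ) (k l : EvenIdx m n) (c : ℂ) :
    cartan evenWt t * Matrix.single k l c - Matrix.single k l c * cartan evenWt t =
      (pair (evenWt k) t - pair (evenWt l) t) • Matrix.single k l c := by
  ext i j
  simp only [cartan, Matrix.sub_apply, Matrix.diagonal_mul, Matrix.mul_diagonal,
    Matrix.smul_apply, Matrix.single_apply, smul_eq_mul]
  by_cases h : k = i ∧ l = j
  · rw [if_pos h, ← h.1, ← h.2]; ring
  · rw [if_neg h]; ring

lemma cartan_commutator_rootVec (t : Fin m ⊕ Fin n → ℂ) (k l : EvenIdx m n) (c : ℂ) :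
    cartan evenWt t * rootVec c k l - rootVec c k l * cartan evenWt t =
      (pair (evenWt k) t - pair (evenWt l) t) • rootVec c k l := by
  have h1 := cartan_commutator_single t k l 1
  have h2 := cartan_commutator_single t (opp l) (opp k) c
  rw [pair_opp, pair_opp] at h2
  rw [rootVec, mul_add, add_mul, smul_add, ← h1]
  have h3 : (-pair (evenWt l) t - -pair (evenWt k) t) = pair (evenWt k) t - pair (evenWt l) t := by
    ring
  rw [h3] at h2
  rw [← h2]
  abel

end HighestWeights

section Dominance

variable {m n : ℕ}

lemma single_commutator_eq_cartan {k l : EvenIdx m n} (h2 : l ≠ opp k) :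
    rootVec (-1) k l * rootVec (-1) l k - rootVec (-1) l k * rootVec (-1) k l =
      Matrix.single k k 1 - Matrix.single l l 1 - Matrix.single (opp k) (opp k) 1 +
        Matrix.single (opp l) (opp l) (1 : ℂ) := by
  have h3 : opp k ≠ l := h2.symm
  have h4 : opp l ≠ k := fun h => h2 (by rw [← h, opp_opp])
  have h5 : k ≠ opp l := h4.symm
  simp only [rootVec, mul_add, add_mul, Matrix.single_mul_single_same]
  rw [Matrix.single_mul_single_of_ne _ _ _ _ h2, Matrix.single_mul_single_of_ne _ _ _ _ h3,
    Matrix.single_mul_single_of_ne _ _ _ _ h4, Matrix.single_mul_single_of_ne _ _ _ _ h5]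
  simp only [mul_one, neg_mul_neg]
  abel

lemma cartan_sub_eq (k l : EvenIdx m n) :
    cartan evenWt (evenWt k - evenWt l) =
      Matrix.single k k 1 - Matrix.single l l 1 - Matrix.single (opp k) (opp k) 1 +
        Matrix.single (opp l) (opp l) (1 : ℂ) := by
  have key (i k : EvenIdx m n) : (if i.2 then evenWt k i.1 else -evenWt k i.1) =
      (if k = i then (1 : ℂ) else 0) - if opp k = i then 1 else 0 := by
    obtain ⟨i, b⟩ := i
    obtain ⟨k, c⟩ := k
    by_cases h : k = i
    · subst h
      cases b <;> cases c <;> simp [evenWt, opp]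
    · have h' : i ≠ k := fun h' => h h'.symm
      cases b <;> cases c <;> simp [evenWt, opp, h, h']
  ext i j
  by_cases hij : i = j
  · subst hij
    have h1 := key i k
    have h2 := key i l
    simp only [cartan, Matrix.diagonal_apply_eq, pair_evenWt, Matrix.add_apply, Matrix.sub_apply,
      Matrix.single_apply, and_self, Pi.sub_apply]
    split_ifs at h1 h2 ⊢ <;> linear_combination h1 - h2
  · have h0 (x : EvenIdx m n) : ¬ (x = i ∧ x = j) := fun h => hij (h.1.symm.trans h.2)
    simp [cartan, hij, h0]

lemma pair_sub_sub (k l : EvenIdx m n) (μ : Wt m n) :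
    pair μ (evenWt k - evenWt l) = pair (evenWt k) μ - pair (evenWt l) μ := by
  simp only [pair, Pi.sub_apply, mul_sub, sum_sub_distrib, mul_comm]

/-- The integrality of a dominant weight for the even root `wt k - wt l` which is not long. -/
lemma IsDominant.exists_nat_even {lam : Fin m ⊕ Fin n → ℤ} (h : IsDominant .ospEven lam)
    {s t : Fin m ⊕ Fin n} {b : Bool} (hst : s ≠ t) (hpar : s.isRight = t.isRight)
    (hb : s.isRight = true → b = true)
    (hα : evenWt (s, true) - evenWt (t, b) ∈ posRoots m n .ospEven) :
    ∃ N : ℕ, lam s - (if b then lam t else -lam t) = N := by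
  obtain ⟨a, b', π, v, hrep, -, hv, hcartan, hpos⟩ := h
  set k : EvenIdx m n := (s, true) with hk
  set l : EvenIdx m n := (t, b) with hl
  have hkl : k ≠ l := fun h => hst (congrArg Prod.fst h)
  have hlk : l ≠ opp k := fun h => hst (congrArg Prod.fst h).symm
  have hkl' : k ≠ opp l := fun h => hst (congrArg Prod.fst h)
  have hpk : evenPar k = evenPar l := by
    rcases s with i | i <;> rcases t with j | j <;> simp at hpar <;> rfl
  have hp0 : evenPar k + evenPar l = 0 := by rw [hpk]; exact CharTwo.add_self_eq_zero _
  have hp0' : evenPar l + evenPar k = 0 := by rw [hpk]; exact CharTwo.add_self_eq_zero _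
  have f1 : evenForm k (opp k) = 1 := by simp [evenForm, opp, hk]
  have f2 : evenForm l (opp l) = 1 := by
    rcases t with j | j
    · simp [evenForm, opp, hl]
    · have : b = true := hb (by rw [hpar]; rfl)
      simp [evenForm, opp, hl, this]
  have f3 : evenForm (opp k) k = evenForm (opp l) l := by
    rcases s with i | i <;> rcases t with j | j <;> simp at hpar
    · simp [evenForm, opp, hk, hl]
    · have : b = true := hb rfl
      simp [evenForm, opp, hk, hl, this]
  have he : rootVec (-1) k l ∈ osp (evenPar (m := m) (n := n)) evenForm := by
    refine rootVec_mem_osp hlk ?_ ?_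
    · rw [f1, f2, hp0']; simp [sgn2]
    · rw [f3, hp0]; simp [sgn2]
  have hf : rootVec (-1) l k ∈ osp (evenPar (m := m) (n := n)) evenForm := by
    refine rootVec_mem_osp hkl' ?_ ?_
    · rw [f1, f2, hp0]; simp [sgn2]
    · rw [f3, hp0']; simp [sgn2]
  have hαα : pair (evenWt k) (evenWt k - evenWt l) - pair (evenWt l) (evenWt k - evenWt l) = 2 := by
    have hts : t ≠ s := hst.symm
    rw [pair_evenWt, pair_evenWt]
    cases b <;> simp [hk, hl, evenWt, hst, hts] <;> norm_num
  obtain ⟨N, hN⟩ := hrep.exists_nat_of_primitive ⟨_, he⟩ ⟨_, hf⟩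
    ⟨_, cartan_mem_osp (evenWt k - evenWt l)⟩ (isHomog_rootVec _ _ _ hp0)
    (isHomog_rootVec _ _ _ hp0') (isHomog_cartan _)
    ((single_commutator_eq_cartan hlk).trans (cartan_sub_eq k l).symm)
    (by rw [cartan_commutator_rootVec, hαα])
    (by rw [cartan_commutator_rootVec, ← neg_smul]; congr 1; linear_combination -hαα)
    hv (hcartan (evenWt k - evenWt l) _ rfl)
    (hpos _ hα _ fun t => by
      rw [cartan_commutator_rootVec]
      congr 1
      simp only [pair, Pi.sub_apply, sub_mul, sum_sub_distrib])
  refine ⟨N, ?_⟩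
  rw [pair_sub_sub, pair_evenWt, pair_evenWt] at hN
  have hN' : ((lam s - (if b then lam t else -lam t) : ℤ) : ℂ) = ((N : ℤ) : ℂ) := by
    push_cast
    rw [← hN]
    cases b <;> simp [hk, hl, toWt]
  exact_mod_cast hN'

/-! The root vectors of the long roots `±2δ_j`. -/

lemma single_mem_osp (j : Fin n) (b : Bool) :
    Matrix.single ((Sum.inr j, b) : EvenIdx m n) (Sum.inr j, !b) (1 : ℂ) ∈
      osp (evenPar (m := m) (n := n)) evenForm := by
  rw [mem_osp_iff]
  intro x y
  simp only [Matrix.single_apply]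
  by_cases h : x = ((Sum.inr j, !b) : EvenIdx m n)
  · by_cases h' : y = ((Sum.inr j, !b) : EvenIdx m n)
    · subst h h'
      have h0 : evenPar ((Sum.inr j, !b) : EvenIdx m n) + evenPar ((Sum.inr j, !b) : EvenIdx m n)
        = 0 := CharTwo.add_self_eq_zero _
      rw [h0]
      cases b <;> simp [opp, evenForm, sgn2]
    · have h1 : ¬ ((Sum.inr j, b) : EvenIdx m n) = opp y := fun h2 =>
        h' (by rw [← opp_opp y, ← h2]; rfl)
      have h3 : ¬ ((Sum.inr j, !b) : EvenIdx m n) = y := fun h2 => h' h2.symm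
      simp [h1, h3]
  · have h1 : ¬ ((Sum.inr j, b) : EvenIdx m n) = opp x := fun h2 =>
      h (by rw [← opp_opp x, ← h2]; rfl)
    have h3 : ¬ ((Sum.inr j, !b) : EvenIdx m n) = x := fun h2 => h h2.symm
    simp [h1, h3]

lemma isHomog_single (j : Fin n) (b c : Bool) :
    IsHomog (evenPar (m := m) (n := n))
      (Matrix.single ((Sum.inr j, b) : EvenIdx m n) (Sum.inr j, c) (1 : ℂ)) 0 := by
  intro x y h
  rw [Matrix.single_apply] at h
  have h1 : ((Sum.inr j, b) : EvenIdx m n) = x ∧ ((Sum.inr j, c) : EvenIdx m n) = y := by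
    by_contra h2
    exact h (if_neg h2)
  rw [← h1.1, ← h1.2]
  exact CharTwo.add_self_eq_zero _

lemma cartan_del_eq (j : Fin n) :
    cartan evenWt (del j : Wt m n) =
      Matrix.single ((Sum.inr j, true) : EvenIdx m n) (Sum.inr j, true) 1 -
        Matrix.single ((Sum.inr j, false) : EvenIdx m n) (Sum.inr j, false) (1 : ℂ) := by
  ext x y
  by_cases hxy : x = y
  · subst hxy
    obtain ⟨x, c⟩ := x
    simp only [cartan, Matrix.diagonal_apply_eq, pair_evenWt, Matrix.sub_apply,
      Matrix.single_apply, and_self, del, Pi.single_apply]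
    by_cases h : x = Sum.inr j
    · subst h; cases c <;> simp
    · have h' : ¬ Sum.inr j = x := fun h' => h h'.symm
      simp [h, h']
  · have h0 (z : EvenIdx m n) : ¬ (z = x ∧ z = y) := fun h => hxy (h.1.symm.trans h.2)
    simp [cartan, hxy, h0]

/-- A primitive vector for the long root `2δ_j` has non-negative integral weight. -/
lemma IsRep.exists_nat_long {a b : ℕ}
    {π : osp (evenPar (m := m) (n := n)) evenForm →ₗ[ℂ] Matrix (Fin a ⊕ Fin b) (Fin a ⊕ Fin b) ℂ}
    (h : IsRep evenPar (osp (evenPar (m := m) (n := n)) evenForm) π) (j : Fin n)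
    {v : Fin a ⊕ Fin b → ℂ} (hv : v ≠ 0) {μ : ℂ}
    (hμ : (π ⟨_, cartan_mem_osp (del j)⟩).mulVec v = μ • v)
    (he : (π ⟨_, single_mem_osp j true⟩).mulVec v = 0) : ∃ N : ℕ, μ = N := by
  refine h.exists_nat_of_primitive ⟨_, single_mem_osp j true⟩ ⟨_, single_mem_osp j false⟩ _
    (isHomog_single _ _ _) (isHomog_single _ _ _) (isHomog_cartan _) ?_ ?_ ?_ hv hμ he
  · simp only [Bool.not_true, Bool.not_false, Matrix.single_mul_single_same, mul_one]
    rw [cartan_del_eq]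
  · simp only
    rw [cartan_commutator_single, pair_evenWt, pair_evenWt]
    congr 1
    simp [del]
    norm_num
  · simp only
    rw [cartan_commutator_single, pair_evenWt, pair_evenWt, ← neg_smul]
    congr 1
    simp [del]
    norm_num

lemma pair_del_right (μ : Wt m n) (j : Fin n) : pair μ (del j) = μ (Sum.inr j) := by
  simp [pair, del, Pi.single_apply]

lemma two_del_mem_posRoots (j : Fin n) : (2 : ℂ) • del j ∈ posRoots m n .ospEven := by
  refine mem_union_left _ ?_
  simp [posEven]

lemma long_root_weight (j : Fin n) (t : Fin m ⊕ Fin n → ℂ) :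
    cartan evenWt t * Matrix.single ((Sum.inr j, true) : EvenIdx m n) (Sum.inr j, !true) (1 : ℂ) -
      Matrix.single ((Sum.inr j, true) : EvenIdx m n) (Sum.inr j, !true) (1 : ℂ) * cartan evenWt t =
      pair ((2 : ℂ) • del j) t •
        Matrix.single ((Sum.inr j, true) : EvenIdx m n) (Sum.inr j, !true) (1 : ℂ) := by
  rw [cartan_commutator_single, pair_evenWt, pair_evenWt]
  congr 1
  simp [pair, del, Pi.single_apply]
  ring

lemma IsDominant.inr_nonneg {lam : Fin m ⊕ Fin n → ℤ} (h : IsDominant .ospEven lam) (j : Fin n) :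
    0 ≤ lam (Sum.inr j) := by
  obtain ⟨a, b', π, v, hrep, -, hv, hcartan, hpos⟩ := h
  obtain ⟨N, hN⟩ := hrep.exists_nat_long j hv (hcartan (del j) _ rfl)
    (hpos _ (two_del_mem_posRoots j) _ (long_root_weight j))
  rw [pair_del_right] at hN
  have : lam (Sum.inr j) = (N : ℤ) := by rw [toWt] at hN; exact_mod_cast hN
  omega

lemma eps_sub_mem_posRoots {i i' : Fin m} (h : i < i') :
    (eps i - eps i' : Wt m n) ∈ posRoots m n .ospEven := by
  refine mem_union_left _ ?_
  simp only [posEven, mem_union, mem_image, mem_filter, mem_univ, true_and]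
  exact Or.inl (Or.inl (Or.inl (Or.inl ⟨(i, i'), h, rfl⟩)))

lemma eps_add_mem_posRoots {i i' : Fin m} (h : i < i') :
    (eps i + eps i' : Wt m n) ∈ posRoots m n .ospEven := by
  refine mem_union_left _ ?_
  simp only [posEven, mem_union, mem_image, mem_filter, mem_univ, true_and]
  exact Or.inl (Or.inl (Or.inr ⟨(i, i'), h, rfl⟩))

lemma del_sub_mem_posRoots {j j' : Fin n} (h : j < j') :
    (del j - del j' : Wt m n) ∈ posRoots m n .ospEven := by
  refine mem_union_left _ ?_
  simp only [posEven, mem_union, mem_image, mem_filter, mem_univ, true_and]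
  exact Or.inl (Or.inl (Or.inl (Or.inr ⟨(j, j'), h, rfl⟩)))

lemma IsDominant.abs_inl_le {lam : Fin m ⊕ Fin n → ℤ} (h : IsDominant .ospEven lam) {i i' : Fin m}
    (hi : i < i') : |lam (Sum.inl i')| ≤ lam (Sum.inl i) := by
  obtain ⟨N, hN⟩ := h.exists_nat_even (s := Sum.inl i) (t := Sum.inl i') (b := true)
    (fun h => hi.ne (Sum.inl_injective h)) rfl (by simp) (by
      simpa [evenWt, eps, del] using eps_sub_mem_posRoots hi)
  obtain ⟨N', hN'⟩ := h.exists_nat_even (s := Sum.inl i) (t := Sum.inl i') (b := false)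
    (fun h => hi.ne (Sum.inl_injective h)) rfl (by simp) (by
      simpa [evenWt, eps, del] using eps_add_mem_posRoots hi)
  simp at hN hN'
  rw [abs_le]
  constructor <;> omega

lemma IsDominant.inr_antitone {lam : Fin m ⊕ Fin n → ℤ} (h : IsDominant .ospEven lam)
    {j j' : Fin n} (hj : j < j') : lam (Sum.inr j') ≤ lam (Sum.inr j) := by
  obtain ⟨N, hN⟩ := h.exists_nat_even (s := Sum.inr j) (t := Sum.inr j') (b := true)
    (fun h => hj.ne (Sum.inr_injective h)) rfl (by simp) (by
      simpa [evenWt, eps, del] using del_sub_mem_posRoots hj)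
  simp at hN
  omega

/-- If `δ_j - ε_i` is positive and the `δ_j`-coordinate of a dominant weight is zero, then so is
its `ε_i`-coordinate. -/
lemma IsDominant.inl_eq_zero {lam : Fin m ⊕ Fin n → ℤ} (h : IsDominant .ospEven lam)
    {i : Fin m} {j : Fin n} (hij : ¬ Precedes (stdWord m n .ospEven) i j)
    (hj : lam (Sum.inr j) = 0) : lam (Sum.inl i) = 0 := by
  obtain ⟨a, b', π, v, hrep, -, hv, hcartan, hpos⟩ := h
  by_contra hi
  set k : EvenIdx m n := (Sum.inr j, true) with hk
  set l : EvenIdx m n := (Sum.inl i, true) with hl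
  have ok : opp k = (Sum.inr j, false) := rfl
  have ol : opp l = (Sum.inl i, false) := rfl
  have pk : evenPar k = 1 := rfl
  have pl : evenPar l = 0 := rfl
  have pol : evenPar (opp l) = 0 := rfl
  have he : rootVec (-1) k l ∈ osp (evenPar (m := m) (n := n)) evenForm := by
    refine rootVec_mem_osp (by simp [hk, hl, opp]) ?_ ?_ <;> rw [pk, pl] <;>
      simp [evenForm, hk, hl, opp, sgn2]
  have hf : rootVec 1 l k ∈ osp (evenPar (m := m) (n := n)) evenForm := by
    refine rootVec_mem_osp (by simp [hk, hl, opp]) ?_ ?_ <;> rw [pk, pl] <;>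
      simp [evenForm, hk, hl, opp, sgn2]
  have hz : rootVec (-1) k (opp l) ∈ osp (evenPar (m := m) (n := n)) evenForm := by
    refine rootVec_mem_osp (by simp [hk, hl, opp]) ?_ ?_ <;> rw [pk, pol] <;>
      simp [evenForm, hk, hl, opp, sgn2]
  have hw1 (t : Fin m ⊕ Fin n → ℂ) : cartan evenWt t * rootVec (-1) k l -
      rootVec (-1) k l * cartan evenWt t = pair (del j - eps i : Wt m n) t • rootVec (-1) k l := by
    rw [cartan_commutator_rootVec, pair_evenWt, pair_evenWt]
    congr 1
    simp [pair, del, eps, hk, hl, sub_mul, sum_sub_distrib, Pi.single_apply]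
  have hw2 (t : Fin m ⊕ Fin n → ℂ) : cartan evenWt t * rootVec (-1) k (opp l) -
      rootVec (-1) k (opp l) * cartan evenWt t =
        pair (eps i + del j : Wt m n) t • rootVec (-1) k (opp l) := by
    rw [cartan_commutator_rootVec, pair_evenWt, pair_evenWt]
    congr 1
    simp [pair, del, eps, hk, ol, add_mul, sum_add_distrib, Pi.single_apply]
    ring
  have hev : (π ⟨_, he⟩).mulVec v = 0 := by
    refine hpos (del j - eps i) ?_ _ hw1
    have h1 := diffRoot_mem_posRoots .ospEven i j
    rwa [diffRoot, if_neg hij] at h1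
  have hzv : (π ⟨_, hz⟩).mulVec v = 0 :=
    hpos (eps i + del j) (sumRoot_mem_posRoots (by simp) i j) _ hw2
  have hlv : (π ⟨_, single_mem_osp j true⟩).mulVec v = 0 :=
    hpos _ (two_del_mem_posRoots j) _ (long_root_weight j)
  have hh : (π ⟨_, cartan_mem_osp (evenWt k - evenWt (opp l))⟩).mulVec v =
      (lam (Sum.inl i) : ℂ) • v := by
    rw [hcartan _ _ rfl, pair_sub_sub, pair_evenWt, pair_evenWt]
    simp [hk, ol, toWt, hj]
  have hlv' := hcartan (del j) ⟨_, cartan_mem_osp (del j)⟩ rfl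
  rw [pair_del_right, toWt, hj, Int.cast_zero, zero_smul] at hlv'
  -- the vector `f v`, where `f` is a root vector for `ε_i - δ_j`
  set u := (π ⟨_, hf⟩).mulVec v with hu
  have hanti := hrep.map_anticommutator ⟨_, he⟩ ⟨_, hf⟩
    ⟨_, cartan_mem_osp (evenWt k - evenWt (opp l))⟩
    (isHomog_rootVec _ _ _ (by rw [pk, pl]; rfl)) (isHomog_rootVec _ _ _ (by rw [pk, pl]; rfl)) (by
      have h1 : l ≠ opp k := by simp [hk, hl, opp]
      have h2 : opp k ≠ l := h1.symm
      have h3 : opp l ≠ k := by simp [hk, hl, opp]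
      have h4 : k ≠ opp l := h3.symm
      simp only [rootVec, mul_add, add_mul, Matrix.single_mul_single_same]
      rw [Matrix.single_mul_single_of_ne _ _ _ _ h1, Matrix.single_mul_single_of_ne _ _ _ _ h2,
        Matrix.single_mul_single_of_ne _ _ _ _ h3, Matrix.single_mul_single_of_ne _ _ _ _ h4,
        cartan_sub_eq, opp_opp]
      have hneg (x y : EvenIdx m n) : Matrix.single x y (-1 : ℂ) = -Matrix.single x y 1 :=
        (Matrix.single_neg _ _ _).symm
      simp only [mul_one, one_mul, hneg]
      abel)
  have hu0 : u ≠ 0 := by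
    intro h0
    have h1 := congrArg (fun M => Matrix.mulVec M v) hanti
    simp only [Matrix.add_mulVec, ← Matrix.mulVec_mulVec, hev, ← hu, h0, Matrix.mulVec_zero,
      add_zero, hh] at h1
    rcases smul_eq_zero.1 h1.symm with h2 | h2
    · exact hi (by exact_mod_cast h2)
    · exact hv h2
  have hcomm1 := hrep.map_commutator (q := 1) ⟨_, cartan_mem_osp (del j)⟩ ⟨_, hf⟩
    ((-1 : ℂ) • ⟨_, hf⟩) (isHomog_cartan _) (isHomog_rootVec _ _ _ (by rw [pk, pl]; rfl)) (by
      simp only [Submodule.coe_smul]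
      rw [cartan_commutator_rootVec, pair_evenWt, pair_evenWt]
      congr 1
      simp [hk, hl])
  have hcomm2 := hrep.map_commutator (q := 1) ⟨_, single_mem_osp j true⟩ ⟨_, hf⟩
    ⟨_, hz⟩ (isHomog_single _ _ _) (isHomog_rootVec _ _ _ (by rw [pk, pl]; rfl)) (by
      have h1 : (Sum.inr j, !true) ≠ l := by simp [hl]
      have h2 : opp l ≠ (Sum.inr j, true) := by simp [hl, opp]
      have h3 : ((Sum.inr j, !true) : EvenIdx m n) = opp k := rfl
      simp only [rootVec, mul_add, add_mul, opp_opp]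
      rw [Matrix.single_mul_single_of_ne _ _ _ _ h1, Matrix.single_mul_single_of_ne _ _ _ _ h2,
        h3, Matrix.single_mul_single_same, ← hk, Matrix.single_mul_single_same, zero_add, add_zero,
        mul_one, sub_eq_add_neg, ← Matrix.single_neg])
  obtain ⟨N, hN⟩ := hrep.exists_nat_long j hu0 (μ := -1) (by
      have h1 := congrArg (fun M => Matrix.mulVec M v) hcomm1
      simp only [Matrix.sub_mulVec, ← Matrix.mulVec_mulVec, hlv', ← hu, Matrix.mulVec_zero,
        sub_zero, map_smul, Matrix.smul_mulVec] at h1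
      exact h1) (by
      have h1 := congrArg (fun M => Matrix.mulVec M v) hcomm2
      simp only [Matrix.sub_mulVec, ← Matrix.mulVec_mulVec, hlv, ← hu, Matrix.mulVec_zero,
        sub_zero, hzv] at h1
      exact h1)
  have : ((-1 : ℤ) : ℂ) = ((N : ℤ) : ℂ) := by push_cast; exact hN
  have : (-1 : ℤ) = N := by exact_mod_cast this
  omega

end Dominance

section Assembly

variable {m n : ℕ}

lemma ne_zero_of_mem_posEven {k : Kind} {α : Wt m n} (h : α ∈ posEven m n k) : α ≠ 0 := by
  have hsub (i i' : Fin m) (h : i < i') : (eps i - eps i' : Wt m n) ≠ 0 := fun h0 => by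
    simpa [eps, h.ne] using congrFun h0 (Sum.inl i)
  have hadd (i i' : Fin m) (h : i < i') : (eps i + eps i' : Wt m n) ≠ 0 := fun h0 => by
    simpa [eps, h.ne] using congrFun h0 (Sum.inl i)
  have hsub' (j j' : Fin n) (h : j < j') : (del j - del j' : Wt m n) ≠ 0 := fun h0 => by
    simpa [del, h.ne] using congrFun h0 (Sum.inr j)
  have hadd' (j j' : Fin n) (h : j < j') : (del j + del j' : Wt m n) ≠ 0 := fun h0 => by
    simpa [del, h.ne] using congrFun h0 (Sum.inr j)
  have hlong (j : Fin n) : ((2 : ℂ) • del j : Wt m n) ≠ 0 := fun h0 => by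
    simpa [del] using congrFun h0 (Sum.inr j)
  have hshort (i : Fin m) : (eps i : Wt m n) ≠ 0 := fun h0 => by
    simpa [eps] using congrFun h0 (Sum.inl i)
  cases k <;> simp only [posEven, mem_union, mem_image, mem_filter, mem_univ, true_and] at h <;>
    aesop

lemma denomR_ne_zero (k : Kind) : denomR m n k ≠ 0 := by
  refine div_ne_zero (prod_ne_zero_iff.2 fun α hα => one_sub_ex_ne_zero ?_)
    (prod_ne_zero_iff.2 fun α _ => one_add_ex_ne_zero _)
  exact neg_ne_zero.2 (ne_zero_of_mem_posEven hα)

open Classical in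
lemma denomR_mul_euler (k : Kind) (lam : Fin m ⊕ Fin n → ℤ) :
    denomR m n k * ex (rho m n k) * euler k lam =
      jW k (ex (toWt lam + rho m n k) /
        ∏ α ∈ (posOdd m n k (stdWord m n k)).filter (InSub k (tailSub k lam)), (1 + ex (-α))) := by
  have h1 := denomR_ne_zero (m := m) (n := n) k
  have h2 := ex_ne_zero (rho m n k)
  rw [euler, ex_neg]
  field_simp

section TailSub

variable {k : Kind} {lam : Fin m ⊕ Fin n → ℤ}

lemma tailSub_fst_le : (tailSub k lam).1 ≤ m := by
  have h := (tailSub_isGreatest k lam).1.1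
  simp only [equalRank, mem_filter, mem_product, mem_range] at h
  omega

lemma tailSub_snd_le : (tailSub k lam).2 ≤ n := by
  have h := (tailSub_isGreatest k lam).1.1
  simp only [equalRank, mem_filter, mem_product, mem_range] at h
  omega

lemma tailSub_fst_eq : (tailSub k lam).1 = (tailSub k lam).2 ∨
    k = .ospEven ∧ (tailSub k lam).1 = (tailSub k lam).2 + 1 := by
  have h := (tailSub_isGreatest k lam).1.1
  simp only [equalRank, mem_filter] at h
  exact h.2

lemma tailSub_eq_tail (hk : k ≠ .ospEven) : tailSub k lam = (tail k lam, tail k lam) := by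
  have h : (tailSub k lam).1 = (tailSub k lam).2 := tailSub_fst_eq.resolve_right fun h => hk h.1
  refine Prod.ext ?_ ?_ <;> simp [tail, h]

lemma tail_eq_snd : tail k lam = (tailSub k lam).2 := by
  rw [tail]
  rcases tailSub_fst_eq (k := k) (lam := lam) with h | ⟨-, h⟩ <;> omega

lemma not_vanishesOn {r : ℕ × ℕ} (hr : r ∈ equalRank m n k) (hlt : ¬ r ≤ tailSub k lam) :
    ¬ VanishesOn k lam r := fun h => hlt ((tailSub_isGreatest k lam).2 ⟨hr, h⟩)

end TailSub

theorem euler_gl (lam : Fin m ⊕ Fin n → ℤ) :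
    (jGl (tail Kind.gl lam) : Frac m n) *
        (denomR m n Kind.gl * ex (rho m n Kind.gl) * euler Kind.gl lam) =
      KW Kind.gl (toWt lam + rhoL m n (tail Kind.gl lam)) (isoS m n Kind.gl (tail Kind.gl lam)) := by
  have ht : tailSub Kind.gl lam = _ := tailSub_eq_tail (by simp)
  have hp := tailSub_fst_le (k := .gl) (lam := lam)
  have hq := tailSub_snd_le (k := .gl) (lam := lam)
  have hV := (tailSub_isGreatest Kind.gl lam).1.2
  rw [denomR_mul_euler]
  rw [ht] at hp hq hV ⊢
  exact jW_sub_gl hp hq hV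

theorem euler_ospOdd (lam : Fin m ⊕ Fin n → ℤ) :
    (jOsp (tNum .ospOdd lam) (tail .ospOdd lam) : Frac m n) *
        (denomR m n .ospOdd * ex (rho m n .ospOdd) * euler .ospOdd lam) =
      KW .ospOdd (toWt lam + rho m n .ospOdd) (isoS m n .ospOdd (tail .ospOdd lam)) := by
  have ht : tailSub Kind.ospOdd lam = _ := tailSub_eq_tail (by simp)
  have hp := tailSub_fst_le (k := .ospOdd) (lam := lam)
  have hq := tailSub_snd_le (k := .ospOdd) (lam := lam)
  have hV := (tailSub_isGreatest Kind.ospOdd lam).1.2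
  have hj : jOsp (tNum .ospOdd lam) (tail .ospOdd lam) =
    2 ^ tail .ospOdd lam * (tail .ospOdd lam).factorial := rfl
  rw [denomR_mul_euler, hj]
  rw [ht] at hp hq hV ⊢
  simp only at hp hq
  refine jW_sub_ospOdd hp hq _ (fun i hi => ?_) fun j hj => ?_
  · have h0 : lam (Sum.inl i) = 0 := (hV.osp_eq_zero (by simp) hi
      (j := ⟨n - 1, by omega⟩) (by simp only; omega)).1
    rw [Pi.add_apply, rho_ospOdd_inl i (by omega), toWt, h0]
    simp
  · have h0 : lam (Sum.inr j) = 0 := (hV.osp_eq_zero (by simp)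
      (i := ⟨m - 1, by omega⟩) (by simp only; omega) hj).2
    rw [Pi.add_apply, rho_ospOdd_inr j (by omega), toWt, h0]
    simp

section OspEven

variable {lam : Fin m ⊕ Fin n → ℤ}

lemma form_eps_ospEven (i : Fin m) : form (toWt lam + rho m n .ospEven) (eps i) = 0 ↔
    lam (Sum.inl i) + (m - 1 - i - n : ℕ) = 0 := by
  rw [form_eps, Pi.add_apply, rho_ospEven_inl, toWt]
  norm_cast

lemma form_del_ospEven (j : Fin n) : form (toWt lam + rho m n .ospEven) (del j) = 0 ↔
    lam (Sum.inr j) + (n - j - m : ℕ) = 0 := by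
  rw [form_del, neg_eq_zero, Pi.add_apply, rho_ospEven_inr, toWt]
  norm_cast

lemma tailSub_ospEven_zero (hq : 1 ≤ (tailSub .ospEven lam).2) :
    (∀ i : Fin m, m ≤ i + (tailSub .ospEven lam).1 → lam (Sum.inl i) = 0) ∧
      ∀ j : Fin n, n ≤ j + (tailSub .ospEven lam).2 → lam (Sum.inr j) = 0 := by
  have hp := tailSub_fst_le (k := .ospEven) (lam := lam)
  have hq' := tailSub_snd_le (k := .ospEven) (lam := lam)
  have hV := (tailSub_isGreatest Kind.ospEven lam).1.2
  have hpq := tailSub_fst_eq (k := .ospEven) (lam := lam)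
  constructor
  · intro i hi
    exact (hV.osp_eq_zero (by simp) hi (j := ⟨n - 1, by omega⟩) (by simp only; omega)).1
  · intro j hj
    exact (hV.osp_eq_zero (by simp) (i := ⟨m - 1, by omega⟩) (by simp only; omega) hj).2

/-- The zero coordinates of `λ + ρ` are those of the tail, provided the last coordinate that does
not belong to the tail is not zero. -/
lemma card_del_zero (hdom : IsDominant .ospEven lam) (hq : 1 ≤ (tailSub .ospEven lam).2)
    (hne : ∀ j : Fin n, (j : ℕ) + (tailSub .ospEven lam).2 + 1 = n →
      lam (Sum.inr j) + (n - j - m : ℕ) ≠ 0) :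
    #{j : Fin n | form (toWt lam + rho m n .ospEven) (del j) = 0} = (tailSub .ospEven lam).2 := by
  have hp := tailSub_fst_le (k := .ospEven) (lam := lam)
  have hq' := tailSub_snd_le (k := .ospEven) (lam := lam)
  have hpq := tailSub_fst_eq (k := .ospEven) (lam := lam)
  have hz := (tailSub_ospEven_zero hq).2
  set q := (tailSub .ospEven lam).2 with hqdef
  have hmain (j : Fin n) : form (toWt lam + rho m n .ospEven) (del j) = 0 ↔ n - q ≤ (j : ℕ) := by
    rw [form_del_ospEven]
    constructor
    · intro h
      by_contra hj
      have hlast := hne ⟨n - q - 1, by omega⟩ (by simp only; omega)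
      have h0 := hdom.inr_nonneg ⟨n - q - 1, by omega⟩
      have hle : lam (Sum.inr ⟨n - q - 1, by omega⟩) ≤ lam (Sum.inr j) := by
        rcases (show j ≤ ⟨n - q - 1, by omega⟩ from Fin.mk_le_mk.2 (by omega)).eq_or_lt with h1 | h1
        · rw [h1]
        · exact hdom.inr_antitone h1
      simp only at hlast
      omega
    · intro hj
      rw [hz j (by omega)]
      omega
  simp only [hmain]
  rw [card_fin_ge]
  omega

lemma card_eps_zero (hdom : IsDominant .ospEven lam) (hq : 1 ≤ (tailSub .ospEven lam).2)
    (hne : ∀ i : Fin m, (i : ℕ) + (tailSub .ospEven lam).1 + 1 = m → lam (Sum.inl i) ≠ 0)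
    (hpq : (tailSub .ospEven lam).1 = (tailSub .ospEven lam).2) :
    #{i : Fin m | form (toWt lam + rho m n .ospEven) (eps i) = 0} = (tailSub .ospEven lam).1 := by
  have hp := tailSub_fst_le (k := .ospEven) (lam := lam)
  have hq' := tailSub_snd_le (k := .ospEven) (lam := lam)
  have hz := (tailSub_ospEven_zero hq).1
  have hmain (i : Fin m) : form (toWt lam + rho m n .ospEven) (eps i) = 0 ↔
      m - (tailSub .ospEven lam).1 ≤ (i : ℕ) := by
    rw [form_eps_ospEven]
    constructor
    · intro h
      by_contra hi
      set l : Fin m := ⟨m - (tailSub .ospEven lam).1 - 1, by omega⟩ with hl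
      have hlast := hne l (by simp only [hl]; omega)
      rcases (show i ≤ l from Fin.mk_le_mk.2 (by omega)).eq_or_lt with h1 | h1
      · have h2 : m - 1 - (l : ℕ) - n = 0 := by simp only [hl]; omega
        rw [h1, h2] at h
        exact hlast (by simpa using h)
      · have h2 := hdom.abs_inl_le h1
        have h3 := abs_pos.2 hlast
        omega
    · intro hi
      rw [hz i (by omega)]
      omega
  simp only [hmain]
  rw [card_fin_ge]
  omega

lemma mem_equalRank {r : ℕ × ℕ} {k : Kind} : r ∈ equalRank m n k ↔
    (r.1 ≤ m ∧ r.2 ≤ n) ∧ (r.1 = r.2 ∨ k = .ospEven ∧ r.1 = r.2 + 1) := by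
  simp only [equalRank, mem_filter, mem_product, mem_range, Nat.lt_succ_iff]

/-- The number `t` tells apart the two families of equal rank subalgebras of `osp(2m|2n)`. -/
lemma jOsp_tNum (hdom : IsDominant .ospEven lam) (hq : 1 ≤ (tailSub .ospEven lam).2) :
    jOsp (tNum .ospEven lam) (tailSub .ospEven lam).2 =
      2 ^ ((tailSub .ospEven lam).1 - 1) * (tailSub .ospEven lam).2.factorial := by
  have hp := tailSub_fst_le (k := .ospEven) (lam := lam)
  have hq' := tailSub_snd_le (k := .ospEven) (lam := lam)
  have hz := tailSub_ospEven_zero hq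
  have hmax {r : ℕ × ℕ} := not_vanishesOn (m := m) (n := n) (k := .ospEven) (lam := lam) (r := r)
  have hpq := (tailSub_fst_eq (k := .ospEven) (lam := lam))
  have hcd := card_del_zero hdom hq
  have hce := card_eps_zero hdom hq
  have htN : tNum .ospEven lam =
    if #{i : Fin m | form (toWt lam + rho m n .ospEven) (eps i) = 0} =
        #{j : Fin n | form (toWt lam + rho m n .ospEven) (del j) = 0} then 0 else 2 := rfl
  have hsub : tailSub .ospEven lam = ((tailSub .ospEven lam).1, (tailSub .ospEven lam).2) := rfl
  generalize (tailSub .ospEven lam).1 = p at *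
  generalize (tailSub .ospEven lam).2 = q at *
  rw [hsub] at hmax
  rcases hpq with rfl | ⟨-, rfl⟩
  · have hlast (i : Fin m) (hi : (i : ℕ) + p + 1 = m) : lam (Sum.inl i) ≠ 0 := fun h0 => by
      refine hmax (r := (p + 1, p)) (mem_equalRank.2 (by simp; omega)) (by simp)
        (vanishesOn_osp (by simp) (fun i' hi' => ?_) hz.2)
      rcases (show (i' : ℕ) = i ∨ m ≤ i' + p by simp only at hi'; omega) with h | h
      · rw [Fin.ext h, h0]
      · exact hz.1 i' h
    have h1 := hce hlast rfl
    have h2 := hcd fun j hj h0 => by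
      by_cases hm : p = m
      · have := hdom.inr_nonneg j
        omega
      · have hj0 := hdom.inr_nonneg j
        refine hlast ⟨m - p - 1, by omega⟩ (by simp only; omega)
          (hdom.inl_eq_zero (j := j) ?_ (by omega))
        rw [precedes_stdWord_ospEven]
        simp only
        omega
    rw [htN, h1, h2, if_pos rfl, jOsp, if_pos rfl, max_eq_right]
    exact Nat.one_le_iff_ne_zero.2 (by positivity)
  · have h2 := hcd fun j hj h0 => by
      have hj0 := hdom.inr_nonneg j
      refine hmax (r := (q + 1, q + 1)) (mem_equalRank.2 (by simp; omega)) (by simp)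
        (vanishesOn_osp (by simp) hz.1 fun j' hj' => ?_)
      rcases (show (j' : ℕ) = j ∨ n ≤ j' + q by simp only at hj'; omega) with h | h
      · rw [Fin.ext h]
        omega
      · exact hz.2 j' h
    have h1 : q + 1 ≤ #{i : Fin m | form (toWt lam + rho m n .ospEven) (eps i) = 0} := by
      have h3 : #{i : Fin m | m - (q + 1) ≤ (i : ℕ)} = q + 1 := by
        rw [card_fin_ge]
        omega
      rw [← h3]
      refine card_le_card fun i hi => ?_
      simp only [mem_filter, mem_univ, true_and] at hi ⊢
      rw [form_eps_ospEven, hz.1 i (by omega)]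
      omega
    rw [htN, if_neg (by omega), jOsp, if_neg (by simp), Nat.add_sub_cancel]

theorem euler_ospEven (hdom : IsDominant .ospEven lam) :
    (jOsp (tNum .ospEven lam) (tail .ospEven lam) : Frac m n) *
        (denomR m n .ospEven * ex (rho m n .ospEven) * euler .ospEven lam) =
      KW .ospEven (toWt lam + rho m n .ospEven) (isoS m n .ospEven (tail .ospEven lam)) := by
  have hp := tailSub_fst_le (k := .ospEven) (lam := lam)
  have hq' := tailSub_snd_le (k := .ospEven) (lam := lam)
  have hpq := tailSub_fst_eq (k := .ospEven) (lam := lam)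
  rw [denomR_mul_euler, tail_eq_snd]
  rcases Nat.eq_zero_or_pos (tailSub .ospEven lam).2 with hq | hq
  · have hj : jOsp (tNum .ospEven lam) 0 = 1 := by
      rw [jOsp]
      split_ifs <;> rfl
    have hS : isoS m n .ospEven 0 = ∅ := by
      simp only [isoS, image_eq_empty, filter_eq_empty_iff]
      intro x _ h
      omega
    rw [hq, hj, hS, KW, prod_empty, Nat.cast_one, one_mul]
    congr 2
    refine (prod_sub_ospEven hp hq' (stdWord m n .ospEven) fun α => 1 + ex (-α)).trans ?_
    have : IsEmpty (Fin (tailSub .ospEven lam).2) := by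
      rw [hq]
      infer_instance
    exact prod_eq_one fun i _ => Fintype.prod_empty _
  · rw [jOsp_tNum hdom hq]
    refine jW_sub_ospEven hp hq' (by omega) (by omega) hq _ (fun i hi => ?_) fun j hj => ?_
    · rw [Pi.add_apply, rho_ospEven_inl, toWt, (tailSub_ospEven_zero hq).1 i hi,
        show m - 1 - (i : ℕ) - n = 0 by omega]
      simp
    · rw [Pi.add_apply, rho_ospEven_inr, toWt, (tailSub_ospEven_zero hq).2 j hj,
        show n - (j : ℕ) - m = 0 by omega]
      simp

end OspEven

end Assembly

end SuperKW

open SuperKW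

theorem mainTheorem3 (m n : ℕ) (lam : Fin m ⊕ Fin n → ℤ) :
    (∀ k : Kind, k = Kind.ospEven ∨ k = Kind.ospOdd → IsDominant k lam →
      (jOsp (tNum k lam) (tail k lam) : Frac m n) *
          (denomR m n k * ex (rho m n k) * euler k lam) =
        KW k (toWt lam + rho m n k) (isoS m n k (tail k lam))) ∧
    (IsDominant Kind.gl lam → IsStable lam →
      (jGl (tail Kind.gl lam) : Frac m n) *
          (denomR m n Kind.gl * ex (rho m n Kind.gl) * euler Kind.gl lam) =
        KW Kind.gl (toWt lam + rhoL m n (tail Kind.gl lam))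
          (isoS m n Kind.gl (tail Kind.gl lam))) := by
  refine ⟨?_, fun _ _ => euler_gl lam⟩
  rintro k (rfl | rfl) hdom
  · exact euler_ospEven hdom
  · exact euler_ospOdd lam
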